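/- Let $k$ be a field with algebraic closure $\bar k$, let $G$ be a connected reductive group over $k$ with Lie algebra $\mathfrak g$, and let $\theta$ be an automorphism of $G_{\bar k}$ of order $m$ with $\mathrm{char}(k)\nmid m$. Fix a primitive $m$-th root of unity $\zeta\in\bar k$ and $n\in\mathbb Z$. Suppose that $(G_{\bar k}^{\theta})^{o}$ and $\mathfrak g_{\bar k}^{\theta=\zeta^n}$ are defined over $k$; let $G^{(0)}\subset G$ and $\mathfrak g^{(1)}\subset\mathfrak g$ be the corresponding subgroup and subspace over $k$. Let $e\in\mathfrak g^{(1)}$ be nilpotent (possibly $0$) with associated cocharacter $\lambda:\mathbb G_m\to G^{(0)}$ over $k$. That is, there are $h,f\in\mathfrak g$, lying in the eigenspaces of $\theta$ for $1$ and $\zeta^{-n}$, such that $[h,e]=2e$, $[h,f]=-2f$, $[e,f]=h$, $d\lambda(1)=h$, $e$ has weight $2$ for $\lambda$, and if $\mathrm{char}(k)=p>0$ then all weights $i$ of $\lambda$ on $\mathfrak g$ satisfy $|i|\le p/2$. (These conditions force $e$ to be nilpotent.) Let $\mathfrak g^{(1)}_{\le 1}$ be the sum of the $\lambda$-weight spaces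 of weight $\le 1$ in $\mathfrak g^{(1)}$. Let $G^{(0)}_{\le 0}\subset G^{(0)}$ be the parabolic subgroup of those $g$ for which $\lim_{t\to\infty}\lambda(t)g\lambda(t)^{-1}$ exists (its Lie algebra is the sum of the non-positive weight spaces), let $E\subset G^{(0)}_{\le 0}$ be the stabilizer of $e+\mathfrak g^{(1)}_{\le 1}$, and $E^{o}$ its identity component. Let $G^{(0)}/E^{o}$ be the quotient scheme (the scheme representing the fppf quotient sheaf). Let $\gamma\in\mathfrak g^{(1)}$. Then the condition $$\mathrm{Ad}(g^{-1})\gamma\in e+\mathfrak g^{(1)}_{\le 1}$$ on $g\in G^{(0)}/E^{o}$ defines (scheme-theoretically) a closed subscheme $\hat{\mathcal H}_e(\gamma)\subset G^{(0)}/E^{o}$. The scheme $\hat{\mathcal H}_e(\gamma)$ is smooth over $k$, and it is a local complete intersection in $G^{(0)}/E^{o}$ of codimension $\dim\mathfrak g^{(1)}-\dim\mathfrak g^{(1)}_{\le 1}$: near each of its points its ideal is generated by a regular sequence of that length. -/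

import Mathlib

open TensorProduct WithConv CategoryTheory AlgebraicGeometry

universe u

namespace GradedLie

/-! An affine group scheme `G` over a field `k` is given by its commutative Hopf algebra `A` of
regular functions.  A closed subscheme of `G` is given by an ideal of `A`.

For a `k`-algebra `R`, the group `G(R)` of `R`-points and the `R`-module `Lie(G) ⊗ R` both sit
inside the associative algebra of `k`-linear maps `A → R` under convolution
`(X * Y)(a) = ∑ X(a₁) Y(a₂)`; there the adjoint action is conjugation and the Lie bracket is the
commutator. -/

section Basic

variable (k A R : Type u) [Field k] [CommRing A] [HopfAlgebra k A] [CommRing R] [Algebra k R]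

/-- The convolution algebra of `k`-linear maps `A → R`. -/
abbrev Fun : Type u := WithConv (A →ₗ[k] R)

/-- The group `G(R)` of `R`-points of `G`. -/
abbrev Pt : Type u := WithConv (A →ₐ[k] R)

end Basic

section Adjoint

variable {k A R : Type u} [Field k] [CommRing A] [HopfAlgebra k A] [CommRing R] [Algebra k R]

/-- A point, regarded as an element of the convolution algebra. -/
noncomputable def Pt.toFun (g : Pt k A R) : Fun k A R := toConv g.ofConv.toLinearMap

/-- The inverse of a point: composition with the antipode. -/
noncomputable def Pt.inv (g : Pt k A R) : Pt k A R :=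
  toConv (g.ofConv.comp (HopfAlgebra.antipodeAlgHom k A))

/-- The adjoint action `X ↦ g X g⁻¹`. -/
noncomputable def Ad (g : Pt k A R) (X : Fun k A R) : Fun k A R :=
  Pt.toFun g * X * Pt.toFun (Pt.inv g)

/-- The point `g ∈ G(R)` lies in the closed subscheme `V(I)` of `G`. -/
def Mem (I : Ideal A) (g : Pt k A R) : Prop := ∀ a ∈ I, g.ofConv a = 0

/-- The scalar extension of a functional `A → k` to a functional `A → R`. -/
noncomputable def extend (R : Type u) [CommRing R] [Algebra k R] (X : Fun k A k) : Fun k A R :=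
  toConv (Algebra.linearMap k R ∘ₗ X.ofConv)

/-- For a subspace `V` of functionals `A → k`, the `R`-module `V ⊗ R` of functionals `A → R`. -/
noncomputable def scalars (R : Type u) [CommRing R] [Algebra k R] (V : Submodule k (Fun k A k)) :
    Submodule R (Fun k A R) :=
  Submodule.span R (extend R '' (V : Set (Fun k A k)))

/-- The ideal of the smallest closed subscheme of `G` which contains all points of a subfunctor
`F` of `G`.  If `F` is representable by a closed subscheme, then this is the ideal of `F`. -/
noncomputable def hull (F : ∀ (R : Type u) [CommRing R] [Algebra k R], Pt k A R → Prop) : Ideal A where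
  carrier := {a | ∀ (R : Type u) [CommRing R] [Algebra k R] (g : Pt k A R),
    F R g → g.ofConv a = 0}
  add_mem' ha hb R _ _ g hg := by rw [map_add, ha R g hg, hb R g hg, add_zero]
  zero_mem' R _ _ g _ := map_zero _
  smul_mem' c a ha R _ _ g hg := by rw [smul_eq_mul, map_mul, ha R g hg, mul_zero]

/-- For a closed subgroup scheme with ideal `J`, the ideal of its identity component: the
functions on the subgroup which vanish on the identity component are generated by the idempotents
which vanish at the identity element. -/
noncomputable def idComp (k : Type u) {A : Type u} [Field k] [CommRing A] [HopfAlgebra k A] (J : Ideal A) :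
    Ideal A :=
  J ⊔ Ideal.span {a | a * a - a ∈ J ∧ Coalgebra.counit (R := k) a = 0}

/-- The Lie algebra of `G`: the point derivations of `A` at the identity element. -/
noncomputable def lie (k A : Type u) [Field k] [CommRing A] [HopfAlgebra k A] : Submodule k (Fun k A k) where
  carrier := {X | ∀ a b : A, X.ofConv (a * b) =
    Coalgebra.counit (R := k) a * X.ofConv b + Coalgebra.counit (R := k) b * X.ofConv a}
  add_mem' {X Y} hX hY a b := by
    simp only [Set.mem_ofPred_eq] at hX hY
    simp only [ofConv_add, LinearMap.add_apply, hX, hY]; ring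
  zero_mem' a b := by simp
  smul_mem' c X hX a b := by
    simp only [Set.mem_ofPred_eq] at hX
    simp only [ofConv_smul, LinearMap.smul_apply, hX, smul_eq_mul]; ring

end Adjoint

section Reductive

/-- The ideal `I` defines a closed subgroup scheme. -/
structure IsSubgroup (k : Type u) {A : Type u} [Field k] [CommRing A] [HopfAlgebra k A]
    (I : Ideal A) : Prop where
  one_mem : ∀ (R : Type u) [CommRing R] [Algebra k R], Mem I (1 : Pt k A R)
  mul_mem : ∀ (R : Type u) [CommRing R] [Algebra k R] (g g' : Pt k A R),
    Mem I g → Mem I g' → Mem I (g * g')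
  inv_mem : ∀ (R : Type u) [CommRing R] [Algebra k R] (g : Pt k A R), Mem I g → Mem I (Pt.inv g)

/-- The closed subgroup scheme defined by `I` is normal. -/
def IsNormal (k : Type u) {A : Type u} [Field k] [CommRing A] [HopfAlgebra k A]
    (I : Ideal A) : Prop :=
  ∀ (R : Type u) [CommRing R] [Algebra k R] (g u : Pt k A R), Mem I u → Mem I (g * u * Pt.inv g)

/-- Translation of functions by a rational point `u`: `(translate u a)(x) = a(xu)`. -/
noncomputable def translate {k A : Type u} [Field k] [CommRing A] [HopfAlgebra k A] (u : Pt k A k) :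
    Module.End k A :=
  (TensorProduct.rid k A).toLinearMap ∘ₗ LinearMap.lTensor A u.ofConv.toLinearMap ∘ₗ
    Coalgebra.comul

/-- The rational point `u` is unipotent: translation of functions by `u` is locally unipotent. -/
def IsUnipotentPt {k A : Type u} [Field k] [CommRing A] [HopfAlgebra k A] (u : Pt k A k) : Prop :=
  ∀ a : A, ∃ N : ℕ, ((translate u - 1) ^ N) a = 0

/-- `G` is a connected reductive group over `k`: it is a smooth connected affine group scheme of
finite type, and over the algebraic closure `K` of `k` the only smooth connected normal unipotent
closed subgroup is trivial. -/
structure IsConnectedReductive (k K A : Type u) [Field k] [Field K] [Algebra k K] [CommRing A]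
    [HopfAlgebra k A] : Prop where
  finiteType : Algebra.FiniteType k A
  smooth : Algebra.Smooth k A
  connected : ConnectedSpace (PrimeSpectrum A)
  radical : ∀ I : Ideal (K ⊗[k] A), IsSubgroup K I → IsNormal K I →
    Algebra.Smooth K ((K ⊗[k] A) ⧸ I) → ConnectedSpace (PrimeSpectrum ((K ⊗[k] A) ⧸ I)) →
    (∀ u : Pt K (K ⊗[k] A) K, Mem I u → IsUnipotentPt u) →
    I = RingHom.ker (Bialgebra.counitAlgHom K (K ⊗[k] A))

end Reductive

section Grading

variable {k K A : Type u} [Field k] [Field K] [Algebra k K] [CommRing A] [HopfAlgebra k A]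

/-- The image in `Lie(G_K)` of an element of `Lie(G)`. -/
noncomputable def baseChange (K : Type u) [Field K] [Algebra k K] (X : Fun k A k) : Fun K (K ⊗[k] A) K :=
  toConv ((TensorProduct.AlgebraTensorModule.rid k K K).toLinearMap ∘ₗ X.ofConv.baseChange K)

lemma baseChange_add (X Y : Fun k A k) :
    baseChange K (X + Y) = baseChange K X + baseChange K Y := by
  simp [baseChange, LinearMap.baseChange_add, LinearMap.comp_add]

lemma baseChange_zero : baseChange K (0 : Fun k A k) = 0 := by
  simp [baseChange]

lemma baseChange_smul (c : k) (X : Fun k A k) :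
    baseChange K (c • X) = algebraMap k K c • baseChange K X := by
  have h : algebraMap k K c • baseChange K X = c • baseChange K X := by
    ext a
    exact algebraMap_smul K c _
  rw [h]
  simp [baseChange, LinearMap.baseChange_smul, LinearMap.comp_smul]

/-- The action on functionals of an automorphism `θ` of the group `G_K`, given as an automorphism
of the Hopf algebra of `G_K`. -/
noncomputable def pushforward (θ : (K ⊗[k] A) ≃ₐc[K] (K ⊗[k] A)) (X : Fun K (K ⊗[k] A) K) :
    Fun K (K ⊗[k] A) K :=
  toConv (X.ofConv ∘ₗ (θ : (K ⊗[k] A) →ₗ[K] (K ⊗[k] A)))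

/-- The eigenspace `Lie(G_K)^{θ = c}`. -/
noncomputable def eigenK (θ : (K ⊗[k] A) ≃ₐc[K] (K ⊗[k] A)) (c : K) : Submodule K (Fun K (K ⊗[k] A) K) where
  carrier := {X | X ∈ lie K (K ⊗[k] A) ∧ pushforward θ X = c • X}
  add_mem' {X Y} hX hY := ⟨add_mem hX.1 hY.1, by
    rw [smul_add, ← hX.2, ← hY.2]; rfl⟩
  zero_mem' := ⟨zero_mem _, by rw [smul_zero]; rfl⟩
  smul_mem' a X hX := ⟨Submodule.smul_mem _ _ hX.1, by
    rw [smul_comm, ← hX.2]; rfl⟩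

/-- The elements of `Lie(G)` which lie in the eigenspace `Lie(G_K)^{θ = c}`. -/
noncomputable def eigen (θ : (K ⊗[k] A) ≃ₐc[K] (K ⊗[k] A)) (c : K) : Submodule k (Fun k A k) where
  carrier := {X | X ∈ lie k A ∧ baseChange K X ∈ eigenK θ c}
  add_mem' {X Y} hX hY := ⟨add_mem hX.1 hY.1, by
    rw [baseChange_add]; exact add_mem hX.2 hY.2⟩
  zero_mem' := ⟨zero_mem _, by rw [baseChange_zero]; exact zero_mem _⟩
  smul_mem' a X hX := ⟨Submodule.smul_mem _ _ hX.1, by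
    rw [baseChange_smul]; exact Submodule.smul_mem _ _ hX.2⟩

/-- The eigenspace `Lie(G_K)^{θ = c}` is defined over `k`. -/
def EigenDefinedOver (θ : (K ⊗[k] A) ≃ₐc[K] (K ⊗[k] A)) (c : K) : Prop :=
  Submodule.span K (baseChange K '' (eigen θ c : Set (Fun k A k))) = eigenK θ c

/-- The ideal of the scheme of fixed points of `θ` in `G_K`. -/
noncomputable def fixedIdeal (θ : (K ⊗[k] A) ≃ₐc[K] (K ⊗[k] A)) : Ideal (K ⊗[k] A) :=
  Ideal.span (Set.range fun a => θ a - a)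

/-- The closed subscheme of `G` with ideal `I₀` is a `k`-form of the identity component of the
fixed points of `θ` in `G_K`. -/
def IsFixedComponent (θ : (K ⊗[k] A) ≃ₐc[K] (K ⊗[k] A)) (I₀ : Ideal A) : Prop :=
  I₀.map (Algebra.TensorProduct.includeRight : A →ₐ[k] K ⊗[k] A) = idComp K (fixedIdeal θ)

end Grading

section Cocharacter

open LaurentPolynomial

variable {k A : Type u} [Field k] [CommRing A] [HopfAlgebra k A]

/-- The point `λ(T) ∈ G(R[T, T⁻¹])` given by a cocharacter `λ : 𝔾ₘ → G`, which is itself given as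
a homomorphism of Hopf algebras `A → k[T, T⁻¹]`. -/
noncomputable def cocharPt (lam : A →ₐc[k] k[T;T⁻¹]) (R : Type u) [CommRing R] [Algebra k R] :
    Pt k A R[T;T⁻¹] :=
  toConv ((AddMonoidAlgebra.mapAlgHom ℤ (Algebra.ofId k R)).comp (lam : A →ₐ[k] k[T;T⁻¹]))

/-- The map `G(R) → G(R[T, T⁻¹])`. -/
noncomputable def constPt {R : Type u} [CommRing R] [Algebra k R] (g : Pt k A R) : Pt k A R[T;T⁻¹] :=
  toConv ((IsScalarTower.toAlgHom k R R[T;T⁻¹]).comp g.ofConv)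

/-- The limit of `λ(t) g λ(t)⁻¹` for `t → ∞` exists: the morphism `t ↦ λ(t) g λ(t)⁻¹` is given by
a homomorphism `A → R[T⁻¹]`. -/
def HasLimitAtInfinity (lam : A →ₐc[k] k[T;T⁻¹]) {R : Type u} [CommRing R] [Algebra k R]
    (g : Pt k A R) : Prop :=
  ∀ (a : A) (i : ℤ), 0 < i →
    ((cocharPt lam R * constPt g * Pt.inv (cocharPt lam R)).ofConv a).coeff i = 0

lemma Ad_add {R : Type u} [CommRing R] [Algebra k R] (g : Pt k A R) (X Y : Fun k A R) :
    Ad g (X + Y) = Ad g X + Ad g Y := by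
  simp [Ad, mul_add, add_mul]

lemma Ad_smul {R : Type u} [CommRing R] [Algebra k R] (g : Pt k A R) (c : k) (X : Fun k A R) :
    Ad g (c • X) = c • Ad g X := by
  simp [Ad]

lemma extend_add (R : Type u) [CommRing R] [Algebra k R] (X Y : Fun k A k) :
    extend R (X + Y) = extend R X + extend R Y := by
  simp [extend, LinearMap.comp_add]

lemma extend_smul (R : Type u) [CommRing R] [Algebra k R] (c : k) (X : Fun k A k) :
    extend R (c • X) = c • extend R X := by
  simp [extend, LinearMap.comp_smul]

/-- The elements of `Lie(G)` of weight `i` for the cocharacter `λ`: `Ad(λ(T)) X = Tⁱ X`. -/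
noncomputable def weight (lam : A →ₐc[k] k[T;T⁻¹]) (i : ℤ) : Submodule k (Fun k A k) where
  carrier := {X | X ∈ lie k A ∧
    Ad (cocharPt lam k) (extend k[T;T⁻¹] X) = (T i : k[T;T⁻¹]) • extend k[T;T⁻¹] X}
  add_mem' {X Y} hX hY := ⟨add_mem hX.1 hY.1, by
    rw [extend_add, Ad_add, hX.2, hY.2, smul_add]⟩
  zero_mem' := ⟨zero_mem _, by
    have : extend k[T;T⁻¹] (0 : Fun k A k) = 0 := by simp [extend]
    rw [this, smul_zero]; simp [Ad]⟩
  smul_mem' c X hX := ⟨Submodule.smul_mem _ _ hX.1, by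
    rw [extend_smul, Ad_smul, hX.2, smul_comm]⟩

/-- The sum of the weight spaces of weight `≤ j` in a subspace `V` of `Lie(G)`. -/
noncomputable def weightLE (lam : A →ₐc[k] k[T;T⁻¹]) (V : Submodule k (Fun k A k)) (j : ℤ) :
    Submodule k (Fun k A k) :=
  ⨆ i : ℤ, ⨆ _ : i ≤ j, V ⊓ weight lam i

/-- `h = dλ(1)`, the image under `dλ` of the derivation `T d/dT` at `T = 1`. -/
def IsDifferential (lam : A →ₐc[k] k[T;T⁻¹]) (h : Fun k A k) : Prop :=
  ∀ a : A, h.ofConv a = (lam a).coeff.sum fun i c => (i : k) * c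

/-- `λ : 𝔾ₘ → G⁽⁰⁾` is an associated cocharacter of `e`, with respect to the `𝔰𝔩₂`-triple
`(e, h, f)` with `e` of degree `n`, `h` of degree `0`, `f` of degree `-n`. The case `e = 0` is
allowed. Here `I₀` is the ideal of `G⁽⁰⁾` and `ζ` is the primitive root of unity. -/
structure IsAssociated {K : Type u} [Field K] [Algebra k K]
    (θ : (K ⊗[k] A) ≃ₐc[K] (K ⊗[k] A)) (ζ : K) (n : ℤ) (I₀ : Ideal A)
    (lam : A →ₐc[k] k[T;T⁻¹]) (e h f : Fun k A k) : Prop where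
  e_mem : e ∈ eigen θ (ζ ^ n)
  h_mem : h ∈ eigen θ (1 : K)
  f_mem : f ∈ eigen θ (ζ ^ (-n))
  lie_h_e : h * e - e * h = (2 : k) • e
  lie_h_f : h * f - f * h = -((2 : k) • f)
  lie_e_f : e * f - f * e = h
  image_le : ∀ a ∈ I₀, lam a = 0
  differential : IsDifferential lam h
  e_weight : e ∈ weight lam 2
  bounded : ringChar k = 0 ∨ ∀ i : ℤ, weight lam i ≠ ⊥ → 2 * |i| ≤ ringChar k

/-- The functor of the closed subgroup `E` of `G⁽⁰⁾`: the points `g` of the parabolic subgroup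
`G⁽⁰⁾_{≤ 0}` (the points of `G⁽⁰⁾` for which `λ(t) g λ(t)⁻¹` has a limit as `t → ∞`) which
stabilize the affine space `e + V_{≤ 1}`. -/
def stabilizer (I₀ : Ideal A) (lam : A →ₐc[k] k[T;T⁻¹]) (V : Submodule k (Fun k A k))
    (e : Fun k A k) (R : Type u) [CommRing R] [Algebra k R] (g : Pt k A R) : Prop :=
  Mem I₀ g ∧ HasLimitAtInfinity lam g ∧
    Ad g '' {Y | Y - extend R e ∈ scalars R (weightLE lam V 1)} =
      {Y | Y - extend R e ∈ scalars R (weightLE lam V 1)}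

/-- The ideal of the identity component `E°` of `E`. -/
noncomputable def stabilizerComponent (I₀ : Ideal A) (lam : A →ₐc[k] k[T;T⁻¹]) (V : Submodule k (Fun k A k))
    (e : Fun k A k) : Ideal A :=
  idComp k (hull (stabilizer I₀ lam V e))

end Cocharacter

section Quotient

variable {k A : Type u} [Field k] [CommRing A] [HopfAlgebra k A]

/-- The morphism `Spec R → V(I)` which corresponds to an `R`-point of `V(I)`. -/
noncomputable def toSpec (I : Ideal A) {R : Type u} [CommRing R] [Algebra k R] (g : Pt k A R)
    (hg : Mem I g) : Spec (.of R) ⟶ Spec (.of (A ⧸ I)) :=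
  Spec.map (CommRingCat.ofHom (Ideal.Quotient.lift I (g.ofConv : A →+* R) hg))

/-- The `k`-scheme `q : Q → Spec k`, with the projection `π`, is the quotient of the group scheme
`V(I)` by right multiplication with its subgroup scheme `V(J)`: it represents the quotient of
sheaves for the fppf topology. That is, `π` is a morphism of `k`-schemes and a covering for the
fppf topology, and two points of `V(I)` have the same image in `Q` exactly if they lie in the same
left coset of `V(J)`. -/
structure IsQuotient (I J : Ideal A) {Q : Scheme.{u}} (q : Q ⟶ Spec (.of k))
    (π : Spec (.of (A ⧸ I)) ⟶ Q) : Prop where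
  over_base : π ≫ q = Spec.map (CommRingCat.ofHom (algebraMap k (A ⧸ I)))
  surjective : Surjective π
  flat : Flat π
  finitePresentation : LocallyOfFinitePresentation π
  coset : ∀ (R : Type u) [CommRing R] [Algebra k R] (g g' : Pt k A R) (hg : Mem I g)
    (hg' : Mem I g'), toSpec I g hg ≫ π = toSpec I g' hg' ≫ π ↔ Mem J (Pt.inv g * g')

/-- `i : H → Q` is the closed subscheme of the quotient `Q` of `V(I)` whose points are the classes
of those `g` for which `Ad(g⁻¹) γ` lies in the affine space `e + W`. -/
structure IsTransporter (I : Ideal A) {Q : Scheme.{u}} (π : Spec (.of (A ⧸ I)) ⟶ Q)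
    (γ e : Fun k A k) (W : Submodule k (Fun k A k)) {H : Scheme.{u}} (i : H ⟶ Q) : Prop where
  closed : IsClosedImmersion i
  factors : ∀ (R : Type u) [CommRing R] [Algebra k R] (g : Pt k A R) (hg : Mem I g),
    (∃ t : Spec (.of R) ⟶ H, t ≫ i = toSpec I g hg ≫ π) ↔
      Ad (Pt.inv g) (extend R γ) - extend R e ∈ scalars R W

/-- The closed subscheme `i : H → Q` is a local complete intersection of codimension `d` in `Q`:
locally on `Q` near `H`, its ideal is generated by a regular sequence of length `d`. -/
def IsLocalCompleteIntersection {Q H : Scheme.{u}} (i : H ⟶ Q) (d : ℕ) : Prop :=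
  ∀ x : H, ∃ (U : Q.affineOpens) (rs : List Γ(Q, U.1)), i x ∈ U.1 ∧ rs.length = d ∧
    RingTheory.Sequence.IsRegular Γ(Q, U.1) rs ∧ Ideal.ofList rs = (Scheme.Hom.ker i).ideal U

end Quotient

end GradedLie

/-! Write `V` for the eigenspace `𝔤⁽¹⁾` and `W` for its part of weight at most `1`. Since `G⁽⁰⁾`
acts on `V`, the transporter condition says that the map `g ↦ Ad(g⁻¹) γ - e` from `G⁽⁰⁾` to `V / W`
vanishes, which is a system of `d = dim V - dim W` equations `F i`. At a solution `g` put `y =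
Ad(g⁻¹) γ`, an element of `e + W`. Replacing `g` by `g (1 + ε X)`, with `X` in the Lie algebra of
degree zero, changes `y` by `-ε [X, y]`. Everything rests on the fact that these brackets together
with `W` span `V`, for every `y` in `e + W`.

For the brackets with `e` this is `𝔰𝔩₂` theory (`IsAssociated.exists_commutator_eq`): `ad e` maps
the part of degree zero and weight `j - 2` onto the part of `V` of weight `j ≥ 2`, because the bound
on the weights keeps the integers that have to be inverted away from the characteristic. Bracketing
with an element of weight at most `1` raises weights by less than bracketing with `e`, so induction
on the highest weight passes from `e` to `e + w` (`IsAssociated.exists_commutator_sub_mem`). Hence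
the differentials of the `F i` are linearly independent along the solutions
(`IsAssociated.exists_equations`).

The rest is geometry. The group `G⁽⁰⁾` is smooth, because a lift of a fixed point can be averaged
over the powers of `θ` (`smooth_of_isFixedComponent`). The quotient `Q` is smooth
(`smooth_of_isQuotient`). Smoothness of `E°` is not available here, so the argument uses only that
the projection is flat, surjective and locally of finite presentation: over the algebraic closure
such a map from a smooth scheme has a target that is smooth on a nonempty open subset, and left
translations carry this subset everywhere. The zero locus of the `F i` is stable under `E°`, and
flatness makes it the preimage of its scheme-theoretic image in `Q`
(`exists_closed_subscheme_of_invariant`).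

The projection need not be smooth and the `F i` need not come from `Q`. In `exists_regular_sequence`
the ideal `J` of the transporter in `Q` generates upstairs the ideal of the `F i`, so at each point
some `d` elements of `J` have independent differentials. Cramer's rule and flatness show that they
generate `J` near the point. By the Jacobian criterion they define a smooth map to affine space,
whose fibre over the origin is the transporter; this gives both the smoothness and the regular
sequence. -/

namespace GradedLie

/-! ### Convolution algebra, group of points and adjoint action -/

section Convolution

variable {k A R R' : Type u} [Field k] [CommRing A] [HopfAlgebra k A]
  [CommRing R] [Algebra k R] [CommRing R'] [Algebra k R']

/-- Composition of an `R`-valued functional with a linear map `R → R'`. -/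
noncomputable def post (φ : R →ₗ[k] R') (X : Fun k A R) : Fun k A R' := toConv (φ ∘ₗ X.ofConv)

/-- The image of a point under a homomorphism `R → R'`. -/
noncomputable def Pt.map (φ : R →ₐ[k] R') (g : Pt k A R) : Pt k A R' := toConv (φ.comp g.ofConv)

@[simp] lemma post_apply (φ : R →ₗ[k] R') (X : Fun k A R) (a : A) :
    (post φ X).ofConv a = φ (X.ofConv a) := rfl

@[simp] lemma map_apply (φ : R →ₐ[k] R') (g : Pt k A R) (a : A) :
    (Pt.map φ g).ofConv a = φ (g.ofConv a) := rfl

@[simp] lemma extend_apply (X : Fun k A k) (a : A) :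
    (extend R X).ofConv a = algebraMap k R (X.ofConv a) := rfl

@[simp] lemma toFun_apply (g : Pt k A R) (a : A) : (Pt.toFun g).ofConv a = g.ofConv a := rfl

@[simp] lemma smul_conv_apply (c : R) (X : Fun k A R) (a : A) :
    (c • X).ofConv a = c * X.ofConv a := rfl

@[ext] lemma Fun.ext {X Y : Fun k A R} (h : ∀ a, X.ofConv a = Y.ofConv a) : X = Y :=
  WithConv.ext (LinearMap.ext h)

lemma Pt.ext {X Y : Pt k A R} (h : ∀ a, X.ofConv a = Y.ofConv a) : X = Y :=
  WithConv.ext (AlgHom.ext h)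

lemma conv_mul_apply {ι : Type*} {a : A} (r : Coalgebra.Repr k a ι) (X Y : Fun k A R) :
    (X * Y).ofConv a = ∑ i ∈ r.index, X.ofConv (r.left i) * Y.ofConv (r.right i) :=
  r.convMul_apply X Y

@[simp] lemma conv_one_apply (a : A) :
    (1 : Fun k A R).ofConv a = algebraMap k R (Coalgebra.counit a) := rfl

lemma pt_one_apply (a : A) :
    (1 : Pt k A R).ofConv a = algebraMap k R (Coalgebra.counit a) := rfl

lemma post_mul (φ : R →ₐ[k] R') (X Y : Fun k A R) :
    post φ.toLinearMap (X * Y) = post φ.toLinearMap X * post φ.toLinearMap Y := by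
  ext a
  simp [conv_mul_apply (Coalgebra.Repr.arbitrary k a)]

lemma post_one (φ : R →ₐ[k] R') : post φ.toLinearMap (1 : Fun k A R) = 1 := by
  ext a; simp

lemma post_sub (φ : R →ₗ[k] R') (X Y : Fun k A R) : post φ (X - Y) = post φ X - post φ Y := by
  ext a; simp

lemma post_add (φ : R →ₗ[k] R') (X Y : Fun k A R) : post φ (X + Y) = post φ X + post φ Y := by
  ext a; simp

lemma extend_eq_post (X : Fun k A k) : extend R X = post (Algebra.ofId k R).toLinearMap X := rfl

lemma post_extend (φ : R →ₐ[k] R') (X : Fun k A k) :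
    post φ.toLinearMap (extend R X) = extend R' X := by
  ext a; simp

lemma extend_mul (X Y : Fun k A k) : extend R (X * Y) = extend R X * extend R Y := by
  simp only [extend_eq_post, post_mul]

lemma extend_sub (X Y : Fun k A k) : extend R (X - Y) = extend R X - extend R Y := by
  simp only [extend_eq_post, post_sub]

noncomputable instance instInvPt : Inv (Pt k A R) := ⟨Pt.inv⟩

noncomputable instance instGroupPt : Group (Pt k A R) where
  inv_mul_cancel g := by
    -- The antipode axiom is an identity between functionals `A → A`; composing it with `g` gives
    -- the inverse law for `g`.
    have h := congrArg (post g.ofConv.toLinearMap)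
      (LinearMap.antipode_mul_id (R := k) (C := A))
    have h2 := post_mul g.ofConv (toConv (HopfAlgebra.antipode k (A := A)))
      (toConv LinearMap.id)
    have h3 := post_one (k := k) (A := A) g.ofConv
    rw [h, h3] at h2
    exact Pt.ext fun a => congrArg (fun Y : Fun k A R => Y.ofConv a) h2.symm

@[simp] lemma inv_eq (g : Pt k A R) : Pt.inv g = g⁻¹ := rfl

/-- Convolution is linear over the target in its right factor. -/
lemma post_mul_left (ι : R →ₐ[k] R') (φ : R' →ₗ[k] R) (hφ : ∀ r s, φ (ι r * s) = r * φ s)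
    (X : Fun k A R) (Y : Fun k A R') :
    post φ (post ι.toLinearMap X * Y) = X * post φ Y := by
  ext a
  simp [conv_mul_apply (Coalgebra.Repr.arbitrary k a), hφ]

/-- Convolution is linear over the target in its left factor. -/
lemma post_mul_right (ι : R →ₐ[k] R') (φ : R' →ₗ[k] R) (hφ : ∀ r s, φ (ι r * s) = r * φ s)
    (X : Fun k A R) (Y : Fun k A R') :
    post φ (Y * post ι.toLinearMap X) = post φ Y * X := by
  ext a
  simp only [conv_mul_apply (Coalgebra.Repr.arbitrary k a), post_apply, map_sum,
    AlgHom.toLinearMap_apply]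
  exact Finset.sum_congr rfl fun i _ => by rw [mul_comm, hφ, mul_comm]

@[simp] lemma toFun_mul (g g' : Pt k A R) :
    Pt.toFun (g * g') = Pt.toFun g * Pt.toFun g' := rfl

@[simp] lemma toFun_one : Pt.toFun (1 : Pt k A R) = 1 := rfl

lemma toFun_injective {g g' : Pt k A R} (h : Pt.toFun g = Pt.toFun g') : g = g' :=
  Pt.ext fun a => by rw [← toFun_apply, h, toFun_apply]

@[simp] lemma toFun_mul_inv (g : Pt k A R) : Pt.toFun g * Pt.toFun g⁻¹ = 1 := by
  rw [← toFun_mul, mul_inv_cancel, toFun_one]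

@[simp] lemma toFun_inv_mul (g : Pt k A R) : Pt.toFun g⁻¹ * Pt.toFun g = 1 := by
  rw [← toFun_mul, inv_mul_cancel, toFun_one]

lemma toFun_map (φ : R →ₐ[k] R') (g : Pt k A R) :
    Pt.toFun (Pt.map φ g) = post φ.toLinearMap (Pt.toFun g) := rfl

lemma map_mul' (φ : R →ₐ[k] R') (g g' : Pt k A R) :
    Pt.map φ (g * g') = Pt.map φ g * Pt.map φ g' :=
  toFun_injective <| by simp only [toFun_map, toFun_mul, post_mul]

lemma map_inv' (φ : R →ₐ[k] R') (g : Pt k A R) : Pt.map φ g⁻¹ = (Pt.map φ g)⁻¹ := rfl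

lemma Ad_def (g : Pt k A R) (X : Fun k A R) : Ad g X = Pt.toFun g * X * Pt.toFun g⁻¹ := rfl

lemma Ad_mul (g g' : Pt k A R) (X : Fun k A R) : Ad (g * g') X = Ad g (Ad g' X) := by
  simp only [Ad_def, mul_inv_rev, toFun_mul, mul_assoc]

@[simp] lemma Ad_one (X : Fun k A R) : Ad 1 X = X := by simp [Ad_def]

lemma Ad_inv_Ad (g : Pt k A R) (X : Fun k A R) : Ad g⁻¹ (Ad g X) = X := by
  rw [← Ad_mul, inv_mul_cancel, Ad_one]

lemma Ad_sub (g : Pt k A R) (X Y : Fun k A R) : Ad g (X - Y) = Ad g X - Ad g Y := by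
  simp [Ad_def, mul_sub, sub_mul]

lemma Ad_smul' (g : Pt k A R) (c : R) (X : Fun k A R) : Ad g (c • X) = c • Ad g X := by
  simp [Ad_def]

lemma Ad_conv_mul (g : Pt k A R) (X Y : Fun k A R) : Ad g (X * Y) = Ad g X * Ad g Y := by
  simp only [Ad_def]
  calc _ = Pt.toFun g * X * 1 * Y * Pt.toFun g⁻¹ := by simp [mul_assoc]
    _ = _ := by rw [← toFun_inv_mul g]; simp only [mul_assoc]

lemma Ad_map (φ : R →ₐ[k] R') (g : Pt k A R) (X : Fun k A R) :
    Ad (Pt.map φ g) (post φ.toLinearMap X) = post φ.toLinearMap (Ad g X) := by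
  simp only [Ad_def, ← map_inv', toFun_map, post_mul]

/-- The adjoint action is linear over the target. -/
lemma post_Ad (ι : R →ₐ[k] R') (φ : R' →ₗ[k] R) (hφ : ∀ r s, φ (ι r * s) = r * φ s)
    (g : Pt k A R) (X : Fun k A R') : post φ (Ad (Pt.map ι g) X) = Ad g (post φ X) := by
  simp only [Ad_def, ← map_inv', toFun_map]
  rw [post_mul_right ι φ hφ, post_mul_left ι φ hφ]

lemma mem_map {I : Ideal A} {g : Pt k A R} (φ : R →ₐ[k] R') (hg : Mem I g) :
    Mem I (Pt.map φ g) := fun a ha => by rw [map_apply, hg a ha, map_zero]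

end Convolution

/-! ### Derivations at the identity element -/

section PointDerivations

variable {k A R R' : Type u} [Field k] [CommRing A] [HopfAlgebra k A]
  [CommRing R] [Algebra k R] [CommRing R'] [Algebra k R']

/-- `X` is a derivation at the identity element with values in `R`. -/
def IsPointDer (X : Fun k A R) : Prop := ∀ a b : A, X.ofConv (a * b) =
  algebraMap k R (Coalgebra.counit a) * X.ofConv b +
    algebraMap k R (Coalgebra.counit b) * X.ofConv a

lemma mem_lie {X : Fun k A k} : X ∈ lie k A ↔ IsPointDer X := Iff.rfl

lemma IsPointDer.map_one {X : Fun k A R} (hX : IsPointDer X) : X.ofConv 1 = 0 := by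
  have h := hX 1 1
  simpa using h

lemma IsPointDer.post {X : Fun k A R} (hX : IsPointDer X) (φ : R →ₗ[k] R') :
    IsPointDer (post φ X) := fun a b => by
  simp only [post_apply, hX a b, map_add, ← Algebra.smul_def, map_smul]

lemma IsPointDer.extend {X : Fun k A k} (hX : X ∈ lie k A) : IsPointDer (extend R X) :=
  IsPointDer.post (mem_lie.1 hX) _

/-- A point derivation which vanishes on generators vanishes. -/
lemma IsPointDer.eq_zero {X : Fun k A R} (hX : IsPointDer X) {s : Set A}
    (hs : Algebra.adjoin k s = ⊤) (h0 : ∀ a ∈ s, X.ofConv a = 0) : X = 0 := by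
  ext a
  have ha : a ∈ Algebra.adjoin k s := by rw [hs]; trivial
  induction ha using Algebra.adjoin_induction with
  | mem x hx => exact h0 x hx
  | algebraMap r =>
    rw [Algebra.algebraMap_eq_smul_one, map_smul, hX.map_one, smul_zero]; rfl
  | add x y _ _ hx hy => rw [map_add, hx, hy]; simp
  | mul x y _ _ hx hy => rw [hX, hx, hy]; simp

lemma lTensor_comul_apply_mul {X Y : Fun k A R} (a b : A) :
    (X * Y).ofConv (a * b) = LinearMap.mul' k R (TensorProduct.map X.ofConv Y.ofConv
      (Coalgebra.comul (R := k) a * Coalgebra.comul b)) := by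
  rw [← Bialgebra.comul_mul]; rfl

/-- A sandwich `g X h` of a point derivation between points is a derivation along `gh`. -/
lemma conj_mul_apply {X : Fun k A R} (hX : IsPointDer X) (g h : Pt k A R) (a b : A) :
    (Pt.toFun g * X * Pt.toFun h).ofConv (a * b) =
      (g * h).ofConv a * (Pt.toFun g * X * Pt.toFun h).ofConv b +
      (g * h).ofConv b * (Pt.toFun g * X * Pt.toFun h).ofConv a := by
  -- The two sides are treated in turn: a derivation along `p` becomes a derivation along `p h`
  -- after right multiplication by `h`, and `g X` is a derivation along `g`.
  have key : ∀ (Y : Fun k A R) (p : Pt k A R), (∀ a b, Y.ofConv (a * b) =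
      p.ofConv a * Y.ofConv b + p.ofConv b * Y.ofConv a) →
      (∀ a b, (Y * Pt.toFun h).ofConv (a * b) = (p * h).ofConv a * (Y * Pt.toFun h).ofConv b +
        (p * h).ofConv b * (Y * Pt.toFun h).ofConv a) := by
    intro Y p hY a b
    simp only [← toFun_apply, toFun_mul]
    have ra := Coalgebra.Repr.arbitrary k a
    have rb := Coalgebra.Repr.arbitrary k b
    rw [lTensor_comul_apply_mul, conv_mul_apply ra, conv_mul_apply ra, conv_mul_apply rb,
      conv_mul_apply rb, ← ra.eq, ← rb.eq]
    simp only [Finset.sum_mul_sum, Algebra.TensorProduct.tmul_mul_tmul, map_sum,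
      TensorProduct.map_tmul, LinearMap.mul'_apply, hY, toFun_apply, map_mul]
    rw [Finset.sum_comm (s := rb.index), ← Finset.sum_add_distrib]
    refine Finset.sum_congr rfl fun i _ => ?_
    rw [← Finset.sum_add_distrib]
    exact Finset.sum_congr rfl fun j _ => by ring
  have key' : ∀ a b, (Pt.toFun g * X).ofConv (a * b) =
      g.ofConv a * (Pt.toFun g * X).ofConv b + g.ofConv b * (Pt.toFun g * X).ofConv a := by
    intro a b
    -- Writing `g` as `g * 1` turns both sides into double sums over the same tensors, which can be
    -- compared term by term.
    have h1 : ∀ a, g.ofConv a = (Pt.toFun g * (1 : Fun k A R)).ofConv a := fun a => by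
      rw [mul_one, toFun_apply]
    rw [h1 a, h1 b]
    have ra := Coalgebra.Repr.arbitrary k a
    have rb := Coalgebra.Repr.arbitrary k b
    rw [lTensor_comul_apply_mul, conv_mul_apply ra, conv_mul_apply ra, conv_mul_apply rb,
      conv_mul_apply rb, ← ra.eq, ← rb.eq]
    simp only [Finset.sum_mul_sum, Algebra.TensorProduct.tmul_mul_tmul, map_sum,
      TensorProduct.map_tmul, LinearMap.mul'_apply, hX _ _, toFun_apply, map_mul, conv_one_apply]
    rw [Finset.sum_comm (s := rb.index), ← Finset.sum_add_distrib]
    refine Finset.sum_congr rfl fun i _ => ?_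
    rw [← Finset.sum_add_distrib]
    exact Finset.sum_congr rfl fun j _ => by ring
  exact key _ g key' a b

lemma IsPointDer.Ad {X : Fun k A R} (hX : IsPointDer X) (g : Pt k A R) : IsPointDer (Ad g X) := by
  intro a b
  rw [Ad_def, conj_mul_apply hX, mul_inv_cancel]
  rfl

/-- The commutator of point derivations is a point derivation. -/
lemma IsPointDer.commutator {X Y : Fun k A R} (hX : IsPointDer X) (hY : IsPointDer Y) :
    IsPointDer (X * Y - Y * X) := by
  intro a b
  have ra := Coalgebra.Repr.arbitrary k a
  have rb := Coalgebra.Repr.arbitrary k b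
  -- The product fails the Leibniz rule by a term that is symmetric in `X` and `Y`, so the failure
  -- cancels in the commutator.
  have main : ∀ {X Y : Fun k A R}, IsPointDer X → IsPointDer Y → (X * Y).ofConv (a * b) =
      algebraMap k R (Coalgebra.counit a) * (X * Y).ofConv b +
      algebraMap k R (Coalgebra.counit b) * (X * Y).ofConv a +
      (X.ofConv a * Y.ofConv b + X.ofConv b * Y.ofConv a) := by
    intro X Y hX hY
    have e1 : ∀ c, algebraMap k R (Coalgebra.counit c) = (1 * 1 : Fun k A R).ofConv c := fun c => by
      rw [mul_one, conv_one_apply]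
    have e2 : ∀ (Z : Fun k A R) c, Z.ofConv c = (Z * 1 : Fun k A R).ofConv c := fun Z c => by
      rw [mul_one]
    have e3 : ∀ (Z : Fun k A R) c, Z.ofConv c = (1 * Z : Fun k A R).ofConv c := fun Z c => by
      rw [one_mul]
    rw [e1 a, e1 b, e2 X a, e2 X b, e3 Y a, e3 Y b]
    rw [lTensor_comul_apply_mul]
    simp only [conv_mul_apply ra, conv_mul_apply rb]
    rw [← ra.eq, ← rb.eq]
    simp only [Finset.sum_mul_sum, Algebra.TensorProduct.tmul_mul_tmul, map_sum,
      TensorProduct.map_tmul, LinearMap.mul'_apply, hX _ _, hY _ _, conv_one_apply]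
    rw [Finset.sum_comm (s := rb.index), Finset.sum_comm (s := rb.index),
      ← Finset.sum_add_distrib, ← Finset.sum_add_distrib, ← Finset.sum_add_distrib]
    refine Finset.sum_congr rfl fun i _ => ?_
    rw [← Finset.sum_add_distrib, ← Finset.sum_add_distrib, ← Finset.sum_add_distrib]
    exact Finset.sum_congr rfl fun j _ => by ring
  simp only [ofConv_sub, LinearMap.sub_apply, main hX hY, main hY hX]
  ring

end PointDerivations

/-! ### Extension of scalars for spaces of functionals -/

section Scalars

variable {k A R R' : Type u} [Field k] [CommRing A] [HopfAlgebra k A]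
  [CommRing R] [Algebra k R] [CommRing R'] [Algebra k R']

lemma extend_mem_scalars {W : Submodule k (Fun k A k)} {X : Fun k A k} (hX : X ∈ W) :
    extend R X ∈ scalars R W := Submodule.subset_span ⟨X, hX, rfl⟩

lemma scalars_mono {W W' : Submodule k (Fun k A k)} (h : W ≤ W') : scalars R W ≤ scalars R W' :=
  Submodule.span_mono (Set.image_mono h)

lemma post_mem_of_mem_scalars {W : Submodule k (Fun k A k)} {Z : Fun k A R}
    (hZ : Z ∈ scalars R W) (φ : R →ₗ[k] k) : post φ Z ∈ W := by
  induction hZ using Submodule.span_induction generalizing φ with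
  | mem x hx =>
    obtain ⟨X, hX, rfl⟩ := hx
    have : post φ (extend R X) = φ 1 • X := by
      ext a
      simp [Algebra.algebraMap_eq_smul_one, mul_comm]
    rw [this]
    exact W.smul_mem _ hX
  | zero =>
    have : post φ (0 : Fun k A R) = 0 := by ext; simp
    rw [this]; exact zero_mem _
  | add x y _ _ hx hy => rw [post_add]; exact add_mem (hx φ) (hy φ)
  | smul r x _ hx =>
    have : post φ (r • x) = post (φ ∘ₗ LinearMap.mulLeft k r) x := by ext; simp
    rw [this]; exact hx _

/-- For an affine group of finite type, an `R`-valued point derivation lies in `W ⊗ R` as soon as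
all its coordinates lie in `W`. -/
lemma mem_scalars [Algebra.FiniteType k A] {W : Submodule k (Fun k A k)} {Z : Fun k A R}
    (hZ : IsPointDer Z) (h : ∀ φ : R →ₗ[k] k, post φ Z ∈ W) : Z ∈ scalars R W := by
  obtain ⟨s, hs⟩ := (inferInstance : Algebra.FiniteType k A).out
  let b := Module.Free.chooseBasis k R
  classical
  -- Only finitely many coordinates occur in the values on the generators. A point derivation that
  -- vanishes on generators is zero, so all other coordinates of `Z` vanish identically.
  let S : Finset _ := s.biUnion fun a => (b.repr (Z.ofConv a)).support
  have hzero : ∀ i ∉ S, post (b.coord i) Z = 0 := by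
    intro i hi
    refine (hZ.post _).eq_zero hs fun a ha => ?_
    by_contra hne
    exact hi (Finset.mem_biUnion.2 ⟨a, ha, Finsupp.mem_support_iff.2 hne⟩)
  have : Z = ∑ i ∈ S, b i • extend R (post (b.coord i) Z) := by
    ext a
    have hsub : (b.repr (Z.ofConv a)).support ⊆ S := by
      intro i hi
      by_contra hne
      have := congrArg (fun Y : Fun k A k => Y.ofConv a) (hzero i hne)
      exact (Finsupp.mem_support_iff.1 hi) this
    conv_lhs => rw [← b.linearCombination_repr (Z.ofConv a), Finsupp.linearCombination_apply,
      Finsupp.sum_of_support_subset _ hsub _ (by simp)]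
    simp only [ofConv_sum, LinearMap.coe_sum, Finset.sum_apply, smul_conv_apply, extend_apply,
      post_apply, Module.Basis.coord_apply]
    exact Finset.sum_congr rfl fun i _ => by rw [Algebra.smul_def, mul_comm]
  rw [this]
  exact Submodule.sum_mem _ fun i _ => Submodule.smul_mem _ _ (extend_mem_scalars (h _))

lemma isPointDer_of_mem_scalars {W : Submodule k (Fun k A k)} (hW : W ≤ lie k A) {Z : Fun k A R}
    (hZ : Z ∈ scalars R W) : IsPointDer Z := by
  induction hZ using Submodule.span_induction with
  | mem x hx =>
    obtain ⟨X, hX, rfl⟩ := hx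
    exact IsPointDer.extend (hW hX)
  | zero => intro a b; simp
  | add x y _ _ hx hy =>
    intro a b
    simp only [ofConv_add, LinearMap.add_apply, hx a b, hy a b]; ring
  | smul r x _ hx => intro a b; simp only [smul_conv_apply, hx a b]; ring

/-- Restriction to a finite set of generators is injective on point derivations. -/
lemma finite_lie [Algebra.FiniteType k A] : Module.Finite k (lie k A) := by
  obtain ⟨s, hs⟩ := (inferInstance : Algebra.FiniteType k A).out
  let f : lie k A →ₗ[k] (s → k) := LinearMap.pi fun a =>
    (LinearMap.applyₗ (a : A)) ∘ₗ (WithConv.linearEquiv k (A →ₗ[k] k)).toLinearMap ∘ₗ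
      (lie k A).subtype
  refine Module.Finite.of_injective f ?_
  rw [← LinearMap.ker_eq_bot, LinearMap.ker_eq_bot']
  intro X hX
  exact Subtype.ext ((mem_lie.1 X.2).eq_zero hs fun a ha => congrFun hX ⟨a, ha⟩)

end Scalars

/-! ### Fixed points of an automorphism -/

section FixedPoints

variable {K H R R' : Type u} [Field K] [CommRing H] [HopfAlgebra K H]
  [CommRing R] [Algebra K R] [CommRing R'] [Algebra K R']

/-- Composition of a functional with an automorphism of the Hopf algebra. -/
noncomputable def pre (θ : H ≃ₐc[K] H) (X : Fun K H R) : Fun K H R :=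
  toConv (X.ofConv ∘ₗ (θ : H →ₗ[K] H))

@[simp] lemma pre_apply (θ : H ≃ₐc[K] H) (X : Fun K H R) (a : H) :
    (pre θ X).ofConv a = X.ofConv (θ a) := rfl

lemma pre_mul (θ : H ≃ₐc[K] H) (X Y : Fun K H R) : pre θ (X * Y) = pre θ X * pre θ Y :=
  WithConv.ext (LinearMap.convMul_comp_coalgHom_distrib X Y (θ : H →ₗc[K] H))

lemma pre_one (θ : H ≃ₐc[K] H) : pre θ (1 : Fun K H R) = 1 := by
  ext a
  simp

lemma mem_span_iff {s : Set H} {g : Pt K H R} :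
    Mem (Ideal.span s) g ↔ ∀ a ∈ s, g.ofConv a = 0 := by
  constructor
  · exact fun h a ha => h a (Ideal.subset_span ha)
  · intro h a ha
    have : Ideal.span s ≤ RingHom.ker (g.ofConv : H →+* R) := Ideal.span_le.2 h
    exact this ha

lemma mem_sup_iff {I J : Ideal H} {g : Pt K H R} : Mem (I ⊔ J) g ↔ Mem I g ∧ Mem J g := by
  constructor
  · exact fun h => ⟨fun a ha => h a (Ideal.mem_sup_left ha), fun a ha => h a (Ideal.mem_sup_right ha)⟩
  · rintro ⟨h1, h2⟩ a ha
    have : I ⊔ J ≤ RingHom.ker (g.ofConv : H →+* R) := sup_le h1 h2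
    exact this ha

lemma mem_idComp_iff {J : Ideal H} {g : Pt K H R} : Mem (idComp K J) g ↔
    Mem J g ∧ ∀ a, a * a - a ∈ J → Coalgebra.counit (R := K) a = 0 → g.ofConv a = 0 := by
  rw [idComp, mem_sup_iff, mem_span_iff]
  simp

/-- The closed subscheme of points fixed by `θ`. -/
lemma mem_fixed_iff {θ : H ≃ₐc[K] H} {g : Pt K H R} :
    Mem (Ideal.span (Set.range fun a => θ a - a)) g ↔ pre θ (Pt.toFun g) = Pt.toFun g := by
  rw [mem_span_iff]
  simp only [Set.mem_range, forall_exists_index, forall_apply_eq_imp_iff, map_sub, sub_eq_zero]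
  exact ⟨fun h => Fun.ext h, fun h a => congrArg (fun Y : Fun K H R => Y.ofConv a) h⟩

lemma isSubgroup_fixed (θ : H ≃ₐc[K] H) :
    IsSubgroup K (Ideal.span (Set.range fun a => θ a - a)) where
  one_mem R _ _ := by rw [mem_fixed_iff, toFun_one, pre_one]
  mul_mem R _ _ g g' hg hg' := by
    rw [mem_fixed_iff] at *
    rw [toFun_mul, pre_mul, hg, hg']
  inv_mem R _ _ g hg := by
    rw [inv_eq]
    rw [mem_fixed_iff] at *
    have h : pre θ (Pt.toFun g⁻¹) * Pt.toFun g = 1 := by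
      conv_lhs => rw [← hg]
      rw [← pre_mul, toFun_inv_mul, pre_one]
    calc _ = pre θ (Pt.toFun g⁻¹) * (Pt.toFun g * Pt.toFun g⁻¹) := by
          rw [toFun_mul_inv, mul_one]
      _ = _ := by rw [← mul_assoc, h, one_mul]

end FixedPoints

/-! ### The identity component of a closed subgroup -/

section IdentityComponent

variable {K H : Type u} [Field K] [CommRing H] [HopfAlgebra K H]

/-- The universal point. -/
noncomputable def univPt (K H : Type u) [Field K] [CommRing H] [HopfAlgebra K H] : Pt K H H :=
  toConv (AlgHom.id K H)

@[simp] lemma map_univPt {R : Type u} [CommRing R] [Algebra K R] (g : Pt K H R) :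
    Pt.map g.ofConv (univPt K H) = g := rfl

lemma mem_iff_map_mk {J : Ideal H} {g : Pt K H H} :
    (∀ a ∈ J, g.ofConv a ∈ J) ↔ Mem J (Pt.map (Ideal.Quotient.mkₐ K J) g) := by
  simp [Mem, Ideal.Quotient.eq_zero_iff_mem]

lemma mem_mk (J : Ideal H) : Mem J (Pt.map (Ideal.Quotient.mkₐ K J) (univPt K H)) :=
  fun _ ha => Ideal.Quotient.eq_zero_iff_mem.2 ha

lemma map_counit (g : Pt K H H) (a : H) :
    (Pt.map (Bialgebra.counitAlgHom K H) g).ofConv a = Coalgebra.counit (R := K) (g.ofConv a) := rfl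

lemma map_counit_univPt : Pt.map (Bialgebra.counitAlgHom K H) (univPt K H) = 1 := rfl

/-- Right translation by `y` preserves `V(J)`, so it carries idempotents on `V(J)` to idempotents.
The translate of `a` takes at the identity the value of `a` at `y`, which is zero; so the translate
also vanishes at `x`. -/
lemma idComp_mul_mem_base {J : Ideal H} (hJ : IsSubgroup K J) {x y : Pt K H K}
    (hx : Mem (idComp K J) x) (hy : Mem (idComp K J) y) : Mem (idComp K J) (x * y) := by
  rw [mem_idComp_iff] at hx hy ⊢
  refine ⟨hJ.mul_mem _ _ _ hx.1 hy.1, fun a ha ha0 => ?_⟩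
  let ρ : Pt K H H := univPt K H * Pt.map (Algebra.ofId K H) y
  have hρ : ∀ a ∈ J, ρ.ofConv a ∈ J := by
    rw [mem_iff_map_mk, map_mul']
    exact hJ.mul_mem _ _ _ (mem_mk J) (mem_map _ (mem_map _ hy.1))
  have hρx : ∀ (z : Pt K H K), Pt.map z.ofConv ρ = z * y := by
    intro z
    rw [map_mul', map_univPt]
    congr 1
    exact Pt.ext fun a => by simp [Algebra.ofId_apply]
  rw [← hρx]
  refine hx.2 (ρ.ofConv a) ?_ ?_
  · rw [← map_mul, ← map_sub]; exact hρ _ ha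
  · have := congrArg (fun z : Pt K H K => z.ofConv a) (hρx 1)
    rw [one_mul] at this
    rw [← hy.2 a ha ha0, ← this]
    rfl

/-- The identity component of a closed subgroup is closed under multiplication. -/
lemma idComp_mul_mem [IsAlgClosed K] [Algebra.FiniteType K H] {J : Ideal H}
    (hJ : IsSubgroup K J) {R : Type u} [CommRing R] [Algebra K R] (g g' : Pt K H R)
    (hg : Mem (idComp K J) g) (hg' : Mem (idComp K J) g') : Mem (idComp K J) (g * g') := by
  -- It suffices to treat the universal pair of points, over `C ⊗ C`.
  let C := H ⧸ idComp K J
  let c : Pt K H C := Pt.map (Ideal.Quotient.mkₐ K _) (univPt K H)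
  let p : Pt K H (C ⊗[K] C) := Pt.map Algebra.TensorProduct.includeLeft c *
    Pt.map Algebra.TensorProduct.includeRight c
  have hc : Mem (idComp K J) c := mem_mk _
  have hp : Mem (idComp K J) p := by
    have hpJ : Mem J p := hJ.mul_mem _ _ _ (mem_map _ (mem_idComp_iff.1 hc).1)
      (mem_map _ (mem_idComp_iff.1 hc).1)
    refine mem_idComp_iff.2 ⟨hpJ, fun a ha ha0 => ?_⟩
    have hidem : p.ofConv a * (1 - p.ofConv a) = 0 := by
      have := hpJ _ ha
      rw [map_sub, map_mul] at this
      rw [mul_sub, mul_one, ← neg_sub, this, neg_zero]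
    -- By the Nullstellensatz a maximal ideal is the kernel of a `K`-point, where the case of
    -- rational points applies. So the idempotent `p(a)` lies in every maximal ideal; then `1 -
    -- p(a)` is a unit, and `p(a) = 0`.
    have hmax : ∀ M : Ideal (C ⊗[K] C), M.IsMaximal → p.ofConv a ∈ M := by
      intro M hM
      let _ := Ideal.Quotient.field M
      have hC : Algebra.FiniteType K C :=
        .of_surjective (Ideal.Quotient.mkₐ K _) (Ideal.Quotient.mkₐ_surjective K _)
      have : Algebra.FiniteType K (C ⊗[K] C) := hC.trans (.baseChange C)
      have : Algebra.FiniteType K ((C ⊗[K] C) ⧸ M) :=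
        .of_surjective (Ideal.Quotient.mkₐ K M) (Ideal.Quotient.mkₐ_surjective K M)
      have : Module.Finite K ((C ⊗[K] C) ⧸ M) := finite_of_finite_type_of_isJacobsonRing _ _
      have hb := IsAlgClosed.algebraMap_bijective_of_isIntegral (k := K) (K := (C ⊗[K] C) ⧸ M)
      let e : K ≃ₐ[K] ((C ⊗[K] C) ⧸ M) := AlgEquiv.ofBijective (Algebra.ofId _ _) hb
      let φ : C ⊗[K] C →ₐ[K] K := (e.symm : _ →ₐ[K] K).comp (Ideal.Quotient.mkₐ K M)
      have hφ : (Pt.map φ p).ofConv a = 0 := by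
        simp only [p, map_mul']
        exact (mem_idComp_iff.1 (idComp_mul_mem_base hJ (mem_map _ (mem_map _ hc))
          (mem_map _ (mem_map _ hc)))).2 a ha ha0
      have : e.symm (Ideal.Quotient.mk M (p.ofConv a)) = 0 := hφ
      rw [map_eq_zero_iff _ e.symm.injective] at this
      exact Ideal.Quotient.eq_zero_iff_mem.1 this
    have hu : IsUnit (1 - p.ofConv a) := by
      by_contra hn
      obtain ⟨M, hM, hMa⟩ := exists_max_ideal_of_mem_nonunits hn
      have := M.add_mem hMa (hmax M hM)
      rw [sub_add_cancel] at this
      exact hM.ne_top (M.eq_top_iff_one.2 this)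
    exact (hu.mul_left_eq_zero).1 hidem
  let φ : C ⊗[K] C →ₐ[K] R := Algebra.TensorProduct.lift (Ideal.Quotient.liftₐ _ g.ofConv hg)
    (Ideal.Quotient.liftₐ _ g'.ofConv hg') fun _ _ => Commute.all _ _
  have : Pt.map φ p = g * g' := by
    simp only [p, map_mul']
    congr 1
    · exact Pt.ext fun a => by
        simp only [φ, c, univPt, map_apply, Algebra.TensorProduct.includeLeft_apply,
          Algebra.TensorProduct.lift_tmul, map_one, mul_one]
        rfl
    · exact Pt.ext fun a => by
        simp only [φ, c, univPt, map_apply, Algebra.TensorProduct.includeRight_apply,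
          Algebra.TensorProduct.lift_tmul, map_one, one_mul]
        rfl
  rw [← this]
  exact mem_map _ hp

lemma isSubgroup_idComp [IsAlgClosed K] [Algebra.FiniteType K H] {J : Ideal H}
    (hJ : IsSubgroup K J) : IsSubgroup K (idComp K J) where
  one_mem R _ _ := by
    refine mem_idComp_iff.2 ⟨hJ.one_mem R, fun a _ ha => ?_⟩
    rw [pt_one_apply, ha, map_zero]
  mul_mem R _ _ g g' := idComp_mul_mem hJ g g'
  inv_mem R _ _ g hg := by
    rw [mem_idComp_iff] at *
    refine ⟨hJ.inv_mem _ _ hg.1, fun a ha ha0 => ?_⟩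
    have hS : ∀ a ∈ J, ((univPt K H)⁻¹).ofConv a ∈ J := by
      rw [mem_iff_map_mk, map_inv']
      exact hJ.inv_mem _ _ (mem_mk J)
    refine hg.2 (((univPt K H)⁻¹).ofConv a) ?_ ?_
    · rw [← map_mul, ← map_sub]; exact hS _ ha
    · rw [← map_counit, map_inv', map_counit_univPt, inv_one, pt_one_apply, ha0, map_zero]

end IdentityComponent

/-! ### Smoothness of fixed points -/

section Smoothness

variable {K H : Type u} [Field K] [CommRing H] [HopfAlgebra K H]

/-- Averaging a lift over a finite group of automorphisms yields an invariant lift. -/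
lemma exists_invariant_lift [Algebra.FormallySmooth K H] (θ : H ≃ₐ[K] H) {m : ℕ}
    (hθ : θ ^ m = 1) (hm : (m : K) ≠ 0) {R : Type u} [CommRing R] [Algebra K R] (I : Ideal R)
    (hI : I ^ 2 = ⊥) (φ : H →ₐ[K] R ⧸ I) (hφ : ∀ a, φ (θ a) = φ a) :
    ∃ ψ : H →ₐ[K] R, (Ideal.Quotient.mkₐ K I).comp ψ = φ ∧ ∀ a, ψ (θ a) = ψ a := by
  obtain ⟨ψ, hψ⟩ := Algebra.FormallySmooth.comp_surjective K H I hI φ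
  have hII : ∀ x ∈ I, ∀ y ∈ I, x * y = 0 := fun x hx y hy => by
    have : x * y ∈ I ^ 2 := by rw [sq]; exact Ideal.mul_mem_mul hx hy
    rwa [hI, Ideal.mem_bot] at this
  have hφi : ∀ (i : ℕ) a, φ ((θ ^ i) a) = φ a := by
    intro i
    induction i with
    | zero => intro a; simp
    | succ i ih => intro a; rw [pow_succ, AlgEquiv.mul_apply, ih, hφ]
  -- An average of algebra homomorphisms is not multiplicative in general. Here the differences `D
  -- i` of two lifts are derivations into the square-zero ideal `I`; so is their average `E`, and
  -- therefore `ψ + E` is again a homomorphism.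
  let D : ℕ → H →ₗ[K] R := fun i => ψ.toLinearMap ∘ₗ (θ ^ i).toLinearMap - ψ.toLinearMap
  have hDdef : ∀ i a, D i a = ψ ((θ ^ i) a) - ψ a := fun _ _ => rfl
  have hψφ : ∀ a, Ideal.Quotient.mk I (ψ a) = φ a := fun a => DFunLike.congr_fun hψ a
  have hDI : ∀ i a, D i a ∈ I := fun i a => by
    rw [← Ideal.Quotient.eq_zero_iff_mem, hDdef, map_sub, hψφ, hψφ, hφi, sub_self]
  have hDmul : ∀ i a b, D i (a * b) = ψ a * D i b + ψ b * D i a := fun i a b => by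
    have := hII _ (hDI i a) _ (hDI i b)
    rw [hDdef, hDdef] at this
    rw [hDdef, hDdef, hDdef, map_mul, map_mul, map_mul]
    linear_combination this
  let E : H →ₗ[K] R := (m : K)⁻¹ • ∑ i ∈ Finset.range m, D i
  have hEI : ∀ a, E a ∈ I := fun a => by
    simp only [E, LinearMap.smul_apply, LinearMap.sum_apply]
    exact Submodule.smul_of_tower_mem I _ (Ideal.sum_mem _ fun i _ => hDI i a)
  have hEmul : ∀ a b, E (a * b) = ψ a * E b + ψ b * E a := fun a b => by
    simp only [E, LinearMap.smul_apply, LinearMap.sum_apply, hDmul, Finset.sum_add_distrib,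
      smul_add, mul_smul_comm, Finset.mul_sum]
  have hE1 : E 1 = 0 := by
    have := hEmul 1 1
    simp only [mul_one, map_one, one_mul] at this
    simpa using this
  have hsum : ∀ a, ψ a + E a = (m : K)⁻¹ • ∑ i ∈ Finset.range m, ψ ((θ ^ i) a) := fun a => by
    simp only [E, LinearMap.smul_apply, LinearMap.sum_apply, hDdef, Finset.sum_sub_distrib,
      Finset.sum_const, Finset.card_range, smul_sub]
    rw [← Nat.cast_smul_eq_nsmul K, smul_smul, inv_mul_cancel₀ hm, one_smul]
    ring
  refine ⟨AlgHom.ofLinearMap (ψ.toLinearMap + E) (by simp [hE1]) (fun a b => ?_), ?_, fun a => ?_⟩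
  · have := hII _ (hEI a) _ (hEI b)
    simp only [LinearMap.add_apply, AlgHom.toLinearMap_apply, map_mul, hEmul]
    linear_combination -this
  · ext a
    change Ideal.Quotient.mk I (ψ a + E a) = φ a
    rw [map_add, hψφ, Ideal.Quotient.eq_zero_iff_mem.2 (hEI a), add_zero]
  · change ψ (θ a) + E (θ a) = ψ a + E a
    rw [hsum, hsum]
    congr 1
    -- Applying `θ` shifts the summation index by one, and `θ ^ m = 1` identifies the two extreme
    -- terms.
    have h := Finset.sum_range_succ' (fun i => ψ ((θ ^ i) a)) m
    rw [Finset.sum_range_succ] at h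
    simp only [hθ, pow_zero, AlgEquiv.one_apply, add_left_inj] at h
    rw [h]
    exact Finset.sum_congr rfl fun i _ => by rw [pow_succ, AlgEquiv.mul_apply]

/-- The identity component of the fixed points of an automorphism of finite order prime to the
characteristic is smooth. -/
lemma formallySmooth_fixed [Algebra.FormallySmooth K H] (θ : H ≃ₐc[K] H) {m : ℕ}
    (hθ : (θ : H ≃ₐ[K] H) ^ m = 1) (hm : (m : K) ≠ 0) :
    Algebra.FormallySmooth K (H ⧸ idComp K (Ideal.span (Set.range fun a => θ a - a))) := by
  refine Algebra.FormallySmooth.of_comp_surjective fun R _ _ I hI φ => ?_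
  have hmk : ∀ a ∈ idComp K (Ideal.span (Set.range fun a => θ a - a)),
      φ (Ideal.Quotient.mk _ a) = 0 := fun a ha => by
    rw [Ideal.Quotient.eq_zero_iff_mem.2 ha, map_zero]
  have hfix : ∀ a, θ a - a ∈ idComp K (Ideal.span (Set.range fun a => θ a - a)) := fun a =>
    Ideal.mem_sup_left (Ideal.subset_span ⟨a, rfl⟩)
  obtain ⟨ψ, hψ, hψθ⟩ := exists_invariant_lift (θ : H ≃ₐ[K] H) hθ hm I hI
    (φ.comp (Ideal.Quotient.mkₐ K _)) fun a => by
      have := hmk _ (hfix a)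
      rw [map_sub, map_sub, sub_eq_zero] at this
      exact this
  -- An invariant lift is a fixed point. It sends an idempotent that vanishes at the identity to an
  -- idempotent lying in `I`, which is zero because `I ^ 2 = 0`.
  have hker : Mem (idComp K (Ideal.span (Set.range fun a => θ a - a)))
      (toConv ψ : Pt K H R) := by
    have hJ : Mem (Ideal.span (Set.range fun a => θ a - a)) (toConv ψ : Pt K H R) :=
      mem_fixed_iff.2 (Fun.ext hψθ)
    refine mem_idComp_iff.2 ⟨hJ, fun a ha ha0 => ?_⟩
    have h1 : ψ a * ψ a = ψ a := by
      have := hJ _ ha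
      rwa [map_sub, map_mul, sub_eq_zero] at this
    have h2 : ψ a ∈ I := by
      rw [← Ideal.Quotient.eq_zero_iff_mem]
      have := DFunLike.congr_fun hψ a
      exact this.trans (hmk a (Ideal.mem_sup_right (Ideal.subset_span ⟨ha, ha0⟩)))
    have h3 : ψ a * ψ a ∈ I ^ 2 := by rw [sq]; exact Ideal.mul_mem_mul h2 h2
    rw [hI, Ideal.mem_bot, h1] at h3
    exact h3
  refine ⟨Ideal.Quotient.liftₐ _ ψ hker, ?_⟩
  refine Ideal.Quotient.algHom_ext _ ?_
  rw [← hψ]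
  rfl

end Smoothness

/-! ### Passage between functionals on `A` and on `K ⊗ A` -/

section ScalarExtension

variable {k K A R R' : Type u} [Field k] [Field K] [Algebra k K] [CommRing A] [HopfAlgebra k A]
  [CommRing R] [Algebra k R] [Algebra K R] [IsScalarTower k K R]
  [CommRing R'] [Algebra k R'] [Algebra K R'] [IsScalarTower k K R']

/-- The `K`-linear extension of a functional on `A` to `K ⊗ A`. -/
noncomputable def liftK (K : Type u) [Field K] [Algebra k K] [Algebra K R] [IsScalarTower k K R]
    (Z : Fun k A R) : Fun K (K ⊗[k] A) R := toConv (Z.ofConv.liftBaseChange K)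

@[simp] lemma liftK_tmul (Z : Fun k A R) (c : K) (a : A) :
    (liftK K Z).ofConv (c ⊗ₜ[k] a) = c • Z.ofConv a := rfl

omit [Algebra k R] [IsScalarTower k K R] in
lemma fun_ext_tmul {X Y : Fun K (K ⊗[k] A) R}
    (h : ∀ a : A, X.ofConv (1 ⊗ₜ[k] a) = Y.ofConv (1 ⊗ₜ[k] a)) : X = Y := by
  refine Fun.ext fun x => ?_
  induction x with
  | zero => simp
  | add x y hx hy => rw [map_add, map_add, hx, hy]
  | tmul c a =>
    have : c ⊗ₜ[k] a = c • ((1 : K) ⊗ₜ[k] a) := by rw [TensorProduct.smul_tmul', smul_eq_mul, mul_one]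
    rw [this, map_smul, map_smul, h]

lemma comul_one_tmul {ι : Type*} {a : A} (r : Coalgebra.Repr k a ι) :
    Coalgebra.comul (R := K) ((1 : K) ⊗ₜ[k] a) =
      ∑ i ∈ r.index, ((1 : K) ⊗ₜ[k] r.left i) ⊗ₜ[K] ((1 : K) ⊗ₜ[k] r.right i) := by
  rw [TensorProduct.comul_tmul, CommSemiring.comul_apply, ← r.eq, TensorProduct.tmul_sum, map_sum]
  rfl

omit [Algebra k R] [IsScalarTower k K R] in
lemma conv_mul_one_tmul {ι : Type*} {a : A} (r : Coalgebra.Repr k a ι)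
    (X Y : Fun K (K ⊗[k] A) R) : (X * Y).ofConv ((1 : K) ⊗ₜ[k] a) =
      ∑ i ∈ r.index, X.ofConv ((1 : K) ⊗ₜ[k] r.left i) * Y.ofConv ((1 : K) ⊗ₜ[k] r.right i) := by
  change LinearMap.mul' K R (TensorProduct.map X.ofConv Y.ofConv (Coalgebra.comul _)) = _
  rw [comul_one_tmul r, map_sum, map_sum]
  rfl

lemma counit_one_tmul (a : A) : Coalgebra.counit (R := K) ((1 : K) ⊗ₜ[k] a) =
    algebraMap k K (Coalgebra.counit a) := by
  rw [TensorProduct.counit_tmul, Algebra.algebraMap_eq_smul_one]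
  simp

lemma liftK_mul (X Y : Fun k A R) : liftK K (X * Y) = liftK K X * liftK K Y := by
  refine fun_ext_tmul fun a => ?_
  rw [conv_mul_one_tmul (Coalgebra.Repr.arbitrary k a)]
  simp [conv_mul_apply (Coalgebra.Repr.arbitrary k a)]

lemma liftK_one : liftK K (1 : Fun k A R) = 1 := by
  refine fun_ext_tmul fun a => ?_
  rw [liftK_tmul, one_smul, conv_one_apply, conv_one_apply, counit_one_tmul,
    ← IsScalarTower.algebraMap_apply]

lemma IsPointDer.liftK {X : Fun k A R} (hX : IsPointDer X) : IsPointDer (liftK K X) := by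
  intro x y
  induction x with
  | zero => simp
  | add x x' hx hx' => simp only [add_mul, map_add, hx, hx', mul_add]; ring
  | tmul c a =>
    induction y with
    | zero => simp
    | add y y' hy hy' => simp only [mul_add, map_add, hy, hy', add_mul]; ring
    | tmul d b =>
      rw [Algebra.TensorProduct.tmul_mul_tmul, liftK_tmul, hX, liftK_tmul, liftK_tmul,
        TensorProduct.counit_tmul, TensorProduct.counit_tmul]
      simp only [CommSemiring.counit_apply, Algebra.smul_def, map_mul,
        ← IsScalarTower.algebraMap_apply]
      ring

/-- The action on functionals on `A`, with values in a `K`-algebra, of an automorphism of `G_K`. -/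
noncomputable def twist (θ : (K ⊗[k] A) ≃ₐc[K] (K ⊗[k] A)) (Z : Fun k A R) : Fun k A R :=
  toConv (((pre θ (liftK K Z)).ofConv.restrictScalars k) ∘ₗ
    (Algebra.TensorProduct.includeRight : A →ₐ[k] K ⊗[k] A).toLinearMap)

variable (θ : (K ⊗[k] A) ≃ₐc[K] (K ⊗[k] A))

lemma twist_apply (Z : Fun k A R) (a : A) :
    (twist θ Z).ofConv a = (liftK K Z).ofConv (θ (1 ⊗ₜ[k] a)) := rfl

lemma liftK_twist (Z : Fun k A R) : liftK K (twist θ Z) = pre θ (liftK K Z) :=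
  fun_ext_tmul fun a => by rw [liftK_tmul, one_smul, twist_apply, pre_apply]

lemma twist_mul (X Y : Fun k A R) : twist θ (X * Y) = twist θ X * twist θ Y := by
  ext a
  have h : (pre θ (liftK K (X * Y))).ofConv (1 ⊗ₜ[k] a) =
      (liftK K (twist θ X * twist θ Y)).ofConv (1 ⊗ₜ[k] a) := by
    rw [liftK_mul, pre_mul, liftK_mul, liftK_twist, liftK_twist]
  rwa [liftK_tmul, one_smul] at h

lemma liftK_sub (X Y : Fun k A R) : liftK K (X - Y) = liftK K X - liftK K Y :=
  fun_ext_tmul fun a => by simp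

lemma twist_sub (X Y : Fun k A R) : twist θ (X - Y) = twist θ X - twist θ Y := by
  ext a; simp [twist_apply, liftK_sub]

lemma twist_post (φ : R →ₗ[K] R') (X : Fun k A R) :
    twist θ (post (φ.restrictScalars k) X) = post (φ.restrictScalars k) (twist θ X) := by
  have : liftK K (post (φ.restrictScalars k) X) = post φ (liftK K X) :=
    fun_ext_tmul fun a => by simp
  ext a; simp [twist_apply, this]

lemma baseChange_eq_liftK (X : Fun k A k) : baseChange K X = liftK K (extend K X) :=
  fun_ext_tmul fun a => by simp [baseChange, Algebra.algebraMap_eq_smul_one]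

/-- A `K`-linear functional on `K ⊗ A` is determined by its values on the elements `1 ⊗ a`. This
allows all computations with the grading to be made with functionals on `A`, by means of `twist`. -/
lemma mem_eigen {c : K} {X : Fun k A k} : X ∈ eigen θ c ↔
    X ∈ lie k A ∧ twist θ (extend K X) = c • extend K X := by
  change X ∈ lie k A ∧ baseChange K X ∈ lie K (K ⊗[k] A) ∧ pre θ (baseChange K X) = _ ↔ _
  refine and_congr_right fun hX => ?_
  have h1 : baseChange K X ∈ lie K (K ⊗[k] A) := by
    rw [baseChange_eq_liftK]
    exact mem_lie.2 (IsPointDer.extend hX).liftK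
  rw [and_iff_right h1, baseChange_eq_liftK, ← liftK_twist]
  constructor
  · intro h
    ext a
    simpa using congrArg (fun Y : Fun K (K ⊗[k] A) K => Y.ofConv (1 ⊗ₜ[k] a)) h
  · intro h
    rw [h]
    exact fun_ext_tmul fun a => by simp

lemma eigen_le_lie (c : K) : eigen θ c ≤ lie k A := fun _ hX => hX.1

lemma twist_extend {c : K} {X : Fun k A k} (hX : X ∈ eigen θ c) :
    twist θ (extend R X) = algebraMap K R c • extend R X := by
  have h := twist_post θ (Algebra.linearMap K R) (extend K X)
  have h2 : post ((Algebra.linearMap K R).restrictScalars k) (extend K X) = extend R X := by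
    ext a
    simp [← IsScalarTower.algebraMap_apply]
  rw [h2, ((mem_eigen θ).1 hX).2] at h
  rw [h]
  ext a
  simp only [post_apply, LinearMap.coe_restrictScalars, smul_conv_apply, extend_apply,
    Algebra.linearMap_apply, map_mul, ← IsScalarTower.algebraMap_apply]

/-- The bracket respects the grading by eigenvalues of `θ`. -/
lemma commutator_mem_eigen {c d : K} {X Y : Fun k A k} (hX : X ∈ eigen θ c) (hY : Y ∈ eigen θ d) :
    X * Y - Y * X ∈ eigen θ (c * d) := by
  refine (mem_eigen θ).2 ⟨mem_lie.2 ((mem_lie.1 hX.1).commutator (mem_lie.1 hY.1)), ?_⟩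
  rw [extend_sub, extend_mul, extend_mul, twist_sub, twist_mul, twist_mul,
    ((mem_eigen θ).1 hX).2, ((mem_eigen θ).1 hY).2]
  simp only [smul_mul_smul_comm, smul_sub, mul_comm d c]

/-- The `R`-point of `G_K` given by an `R`-point of `G`, for a `K`-algebra `R`. -/
noncomputable def liftPt (K : Type u) [Field K] [Algebra k K] [Algebra K R] [IsScalarTower k K R]
    (g : Pt k A R) : Pt K (K ⊗[k] A) R :=
  toConv (Algebra.TensorProduct.lift (Algebra.ofId K R) g.ofConv fun _ _ => Commute.all _ _)

lemma liftPt_tmul (g : Pt k A R) (c : K) (a : A) :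
    (liftPt K g).ofConv (c ⊗ₜ[k] a) = c • g.ofConv a := by
  rw [Algebra.smul_def]; rfl

lemma toFun_liftPt (g : Pt k A R) : Pt.toFun (liftPt K g) = liftK K (Pt.toFun g) :=
  fun_ext_tmul fun a => by
    rw [toFun_apply, liftPt_tmul, liftK_tmul, toFun_apply]

lemma liftPt_mul (g g' : Pt k A R) : liftPt K (g * g') = liftPt K g * liftPt K g' :=
  toFun_injective <| by simp only [toFun_liftPt, toFun_mul, liftK_mul]

lemma liftPt_one : liftPt K (1 : Pt k A R) = 1 :=
  toFun_injective <| by simp only [toFun_liftPt, toFun_one, liftK_one]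

lemma liftPt_inv (g : Pt k A R) : liftPt K g⁻¹ = (liftPt K g)⁻¹ := by
  rw [eq_inv_iff_mul_eq_one, ← liftPt_mul, inv_mul_cancel, liftPt_one]

lemma mem_liftPt {I : Ideal A} {g : Pt k A R} :
    Mem (I.map (Algebra.TensorProduct.includeRight : A →ₐ[k] K ⊗[k] A)) (liftPt K g) ↔
      Mem I g := by
  rw [Ideal.map, mem_span_iff]
  simp [Mem, liftPt_tmul]

end ScalarExtension

/-! ### The group `G⁽⁰⁾` and its action on the eigenspaces -/

section FixedComponent

variable {k K A : Type u} [Field k] [Field K] [Algebra k K] [CommRing A] [HopfAlgebra k A]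
  {θ : (K ⊗[k] A) ≃ₐc[K] (K ⊗[k] A)} {I₀ : Ideal A}

/-- Because `R` embeds in `K ⊗ R`, membership in the `k`-form can be tested over `K`; so the
subgroup property descends to `k`. -/
lemma mem_iff_mem_idComp (hI₀ : IsFixedComponent θ I₀) {R : Type u} [CommRing R] [Algebra k R]
    {g : Pt k A R} : Mem I₀ g ↔ Mem (idComp K (fixedIdeal θ))
      (liftPt K (Pt.map (Algebra.TensorProduct.includeRight : R →ₐ[k] K ⊗[k] R) g)) := by
  rw [← hI₀, mem_liftPt]
  refine ⟨mem_map _, fun h a ha => ?_⟩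
  have hinj : Function.Injective (Algebra.TensorProduct.includeRight : R →ₐ[k] K ⊗[k] R) :=
    Algebra.TensorProduct.includeRight_injective (algebraMap k K).injective
  exact hinj ((h a ha).trans (map_zero _).symm)

lemma isSubgroup_of_isFixedComponent [IsAlgClosed K] [Algebra.FiniteType k A]
    (hI₀ : IsFixedComponent θ I₀) : IsSubgroup k I₀ := by
  have hsub : IsSubgroup K (idComp K (fixedIdeal θ)) :=
    isSubgroup_idComp (isSubgroup_fixed θ)
  refine ⟨fun R _ _ => ?_, fun R _ _ g g' hg hg' => ?_, fun R _ _ g hg => ?_⟩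
  · rw [mem_iff_mem_idComp hI₀]
    have : Pt.map (Algebra.TensorProduct.includeRight : R →ₐ[k] K ⊗[k] R) (1 : Pt k A R) = 1 :=
      Pt.ext fun a => by simp
    rw [this, liftPt_one]
    exact hsub.one_mem _
  · rw [mem_iff_mem_idComp hI₀] at *
    rw [map_mul', liftPt_mul]
    exact hsub.mul_mem _ _ _ hg hg'
  · rw [mem_iff_mem_idComp hI₀] at *
    rw [inv_eq, map_inv', liftPt_inv]
    exact hsub.inv_mem _ _ hg

/-- Points of `G⁽⁰⁾` with values in a `K`-algebra are fixed by `θ`. -/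
lemma twist_toFun (hI₀ : IsFixedComponent θ I₀) {R : Type u} [CommRing R] [Algebra k R]
    [Algebra K R] [IsScalarTower k K R] {g : Pt k A R} (hg : Mem I₀ g) :
    twist θ (Pt.toFun g) = Pt.toFun g := by
  have h : Mem (idComp K (fixedIdeal θ)) (liftPt K g) := by rw [← hI₀, mem_liftPt]; exact hg
  have h2 := mem_fixed_iff.1 (mem_idComp_iff.1 h).1
  rw [toFun_liftPt, ← liftK_twist] at h2
  ext a
  simpa using congrArg (fun Y : Fun K (K ⊗[k] A) R => Y.ofConv (1 ⊗ₜ[k] a)) h2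

/-- The group `G⁽⁰⁾` acts on the eigenspaces of `θ`. -/
lemma Ad_mem_scalars_eigen [IsAlgClosed K] [Algebra.FiniteType k A]
    (hI₀ : IsFixedComponent θ I₀) {R : Type u} [CommRing R] [Algebra k R]
    {g : Pt k A R} (hg : Mem I₀ g) {c : K} {X : Fun k A k} (hX : X ∈ eigen θ c) :
    Ad g (extend R X) ∈ scalars R (eigen θ c) := by
  have hder : IsPointDer (Ad g (extend R X)) := (IsPointDer.extend hX.1).Ad g
  refine mem_scalars hder fun φ => (mem_eigen θ).2 ⟨mem_lie.2 (hder.post φ), ?_⟩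
  let i : R →ₐ[k] K ⊗[k] R := Algebra.TensorProduct.includeRight
  -- The coordinate `φ` extends `K`-linearly to `K ⊗ R`. There the twist by `θ` is defined, commutes
  -- with `ψ` and fixes the image of `g`.
  let ψ : K ⊗[k] R →ₗ[K] K := ((Algebra.linearMap k K) ∘ₗ φ).liftBaseChange K
  have h1 : extend K (post φ (Ad g (extend R X))) =
      post (ψ.restrictScalars k) (Ad (Pt.map i g) (extend (K ⊗[k] R) X)) := by
    rw [← post_extend i, Ad_map]
    ext a
    simp [ψ, i]
  have hinv : twist θ (Pt.toFun (Pt.map i g)⁻¹) = Pt.toFun (Pt.map i g)⁻¹ :=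
    twist_toFun hI₀ ((isSubgroup_of_isFixedComponent hI₀).inv_mem _ _ (mem_map i hg))
  rw [h1, twist_post, Ad_def, twist_mul, twist_mul, twist_toFun hI₀ (mem_map i hg), hinv,
    twist_extend θ hX]
  ext a
  simp only [mul_smul_comm, smul_mul_assoc, post_apply, smul_conv_apply]
  simp only [← Algebra.smul_def, LinearMap.coe_restrictScalars, map_smul, smul_eq_mul]

/-- Elements of the Lie algebra fixed by `θ` are tangent to `G⁽⁰⁾`. -/
lemma eigen_one_apply (hI₀ : IsFixedComponent θ I₀) {X : Fun k A k} (hX : X ∈ eigen θ (1 : K))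
    {a : A} (ha : a ∈ I₀) : X.ofConv a = 0 := by
  have hD : IsPointDer (liftK K (extend K X)) := (IsPointDer.extend hX.1).liftK
  have hfix : pre θ (liftK K (extend K X)) = liftK K (extend K X) := by
    rw [← liftK_twist, ((mem_eigen θ).1 hX).2, one_smul]
  -- The functions that vanish at the identity together with their derivative along `X` form an
  -- ideal, by the Leibniz rule. So only generators of the ideal of the fixed component have to be
  -- tested.
  let T : Ideal (K ⊗[k] A) :=
    { carrier := {x | Coalgebra.counit (R := K) x = 0 ∧ (liftK K (extend K X)).ofConv x = 0}
      add_mem' := fun {x y} hx hy => ⟨by rw [map_add, hx.1, hy.1, add_zero],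
        by rw [map_add, hx.2, hy.2, add_zero]⟩
      zero_mem' := ⟨map_zero _, map_zero _⟩
      smul_mem' := fun c x hx => ⟨by rw [smul_eq_mul, Bialgebra.counit_mul, hx.1, mul_zero],
        by rw [smul_eq_mul, hD, hx.1, hx.2, map_zero, zero_mul, mul_zero, add_zero]⟩ }
  have h1 : fixedIdeal θ ≤ T := by
    refine Ideal.span_le.2 ?_
    rintro _ ⟨x, rfl⟩
    refine ⟨?_, ?_⟩
    · have hc : Coalgebra.counit (R := K) (θ x) = Coalgebra.counit (R := K) x :=
        CoalgHomClass.counit_comp_apply θ x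
      rw [map_sub, hc, sub_self]
    · rw [map_sub, sub_eq_zero]
      exact congrArg (fun Y : Fun K (K ⊗[k] A) K => Y.ofConv x) hfix
  -- If `a` vanishes at the identity, then so does the derivative of `a * a`. Since `a * a - a` is
  -- already in `T`, the derivative of `a` is zero too.
  have h2 : idComp K (fixedIdeal θ) ≤ T := by
    refine sup_le h1 (Ideal.span_le.2 fun x hx => ⟨hx.2, ?_⟩)
    have := (h1 hx.1).2
    rw [map_sub, hD, hx.2, map_zero, zero_mul, zero_add, zero_sub, neg_eq_zero] at this
    exact this
  have h3 : (1 : K) ⊗ₜ[k] a ∈ T := h2 (hI₀ ▸ Ideal.mem_map_of_mem _ ha)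
  have h4 := h3.2
  rw [liftK_tmul, one_smul, extend_apply, map_eq_zero] at h4
  exact h4

lemma scalars_eigen_one_apply (hI₀ : IsFixedComponent θ I₀) {R : Type u} [CommRing R]
    [Algebra k R] {X : Fun k A R} (hX : X ∈ scalars R (eigen θ (1 : K))) {a : A} (ha : a ∈ I₀) :
    X.ofConv a = 0 := by
  induction hX using Submodule.span_induction with
  | mem x hx =>
    obtain ⟨Y, hY, rfl⟩ := hx
    rw [extend_apply, eigen_one_apply hI₀ hY ha, map_zero]
  | zero => rfl
  | add x y _ _ hx hy => rw [ofConv_add, LinearMap.add_apply, hx, hy, add_zero]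
  | smul r x _ hx => rw [smul_conv_apply, hx, mul_zero]

/-- The group `G⁽⁰⁾` is smooth. -/
lemma smooth_of_isFixedComponent [Algebra.Smooth k A] (hI₀ : IsFixedComponent θ I₀) {m : ℕ}
    (hθ : orderOf (θ : (K ⊗[k] A) ≃ₐ[K] (K ⊗[k] A)) = m) (hm : (m : k) ≠ 0) :
    Algebra.Smooth k (A ⧸ I₀) := by
  have hmK : (m : K) ≠ 0 := by
    rw [← map_natCast (algebraMap k K)]
    exact (map_ne_zero _).2 hm
  have hfs : Algebra.FormallySmooth K ((K ⊗[k] A) ⧸ idComp K (fixedIdeal θ)) :=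
    formallySmooth_fixed θ (hθ ▸ pow_orderOf_eq_one _) hmK
  have hfp : Algebra.FinitePresentation K ((K ⊗[k] A) ⧸ idComp K (fixedIdeal θ)) := by
    have : Algebra.FiniteType K (K ⊗[k] A) := inferInstance
    rw [← Algebra.FinitePresentation.of_finiteType]
    exact .of_surjective (Ideal.Quotient.mkₐ K _) (Ideal.Quotient.mkₐ_surjective K _)
  have hs : Algebra.Smooth K ((K ⊗[k] A) ⧸ idComp K (fixedIdeal θ)) := ⟨hfs, hfp⟩
  rw [← hI₀] at hs
  -- After extension to `K` the coordinate ring becomes that of the fixed component, and smoothness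
  -- descends along the faithfully flat `k → K`.
  let e : K ⊗[k] (A ⧸ I₀) ≃ₐ[K] (K ⊗[k] A) ⧸ I₀.map
      (Algebra.TensorProduct.includeRight : A →ₐ[k] K ⊗[k] A) :=
    Algebra.TensorProduct.tensorQuotientEquiv K A K I₀
  have : Algebra.Smooth K (K ⊗[k] (A ⧸ I₀)) := .of_equiv e.symm
  exact Algebra.Smooth.of_smooth_tensorProduct_of_faithfullyFlat K

end FixedComponent

/-! ### Weight decomposition under a cocharacter -/

section Weights

open LaurentPolynomial

variable {k A : Type u} [Field k] [CommRing A] [HopfAlgebra k A] (lam : A →ₐc[k] k[T;T⁻¹])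

/-- The `i`-th coefficient of a Laurent polynomial. -/
noncomputable def coeffL (k : Type u) [Field k] (i : ℤ) : k[T;T⁻¹] →ₗ[k] k :=
  Finsupp.lapply i ∘ₗ (AddMonoidAlgebra.coeffLinearEquiv k (S := k) (M := ℤ)).toLinearMap

@[simp] lemma coeffL_apply (i : ℤ) (p : k[T;T⁻¹]) : coeffL k i p = p.coeff i := rfl

lemma coeff_C_mul_T (c : k) (i j : ℤ) : (C c * T i : k[T;T⁻¹]).coeff j = if i = j then c else 0 := by
  rw [← single_eq_C_mul_T, AddMonoidAlgebra.coeff_single, Finsupp.single_apply]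

lemma cocharPt_apply (a : A) : (cocharPt lam k).ofConv a = lam a := by
  refine LaurentPolynomial.ext fun i => ?_
  exact AddMonoidAlgebra.coeff_mapAlgHom _ _ _

/-- The component of weight `i` of an element of the Lie algebra. -/
noncomputable def comp (i : ℤ) : Fun k A k →ₗ[k] Fun k A k where
  toFun X := post (coeffL k i) (Ad (cocharPt lam k) (extend k[T;T⁻¹] X))
  map_add' X Y := by rw [extend_add, Ad_add, post_add]
  map_smul' c X := by
    rw [extend_smul, Ad_smul]
    ext a
    simp

lemma comp_apply (i : ℤ) (X : Fun k A k) :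
    comp lam i X = post (coeffL k i) (Ad (cocharPt lam k) (extend k[T;T⁻¹] X)) := rfl

lemma comp_mem_lie {X : Fun k A k} (hX : X ∈ lie k A) (i : ℤ) : comp lam i X ∈ lie k A :=
  mem_lie.2 (((IsPointDer.extend hX).Ad _).post _)

/-- Only the exponents in finitely many Laurent polynomials matter: the values, on generators of
`A`, of the translates of a finite spanning set of the Lie algebra. -/
lemma exists_finset_comp [Algebra.FiniteType k A] :
    ∃ S : Finset ℤ, ∀ X ∈ lie k A, ∀ i ∉ S, comp lam i X = 0 := by
  classical
  obtain ⟨s, hs⟩ := (inferInstance : Algebra.FiniteType k A).out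
  have := finite_lie (k := k) (A := A)
  obtain ⟨t, ht⟩ := (Submodule.fg_iff_finiteDimensional (lie k A)).2 this
  refine ⟨t.biUnion fun X => s.biUnion fun a =>
    ((Ad (cocharPt lam k) (extend k[T;T⁻¹] X)).ofConv a).coeff.support, fun X hX i hi => ?_⟩
  simp only [Finset.mem_biUnion, not_exists, not_and, Finsupp.mem_support_iff, not_not] at hi
  rw [← ht] at hX
  induction hX using Submodule.span_induction with
  | mem x hx =>
    have hxl : x ∈ lie k A := ht ▸ Submodule.subset_span hx
    exact (mem_lie.1 (comp_mem_lie lam hxl i)).eq_zero hs fun a ha => hi x hx a ha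
  | zero => exact map_zero _
  | add x y _ _ hx hy => rw [map_add, hx, hy, add_zero]
  | smul c x _ hx => rw [map_smul, hx, smul_zero]

lemma map_counit_cocharPt :
    Pt.map (Bialgebra.counitAlgHom k k[T;T⁻¹]) (cocharPt lam k) = 1 := by
  refine Pt.ext fun a => ?_
  rw [map_apply, cocharPt_apply, pt_one_apply]
  exact CoalgHomClass.counit_comp_apply lam a

lemma counit_eq_sum (p : k[T;T⁻¹]) {S : Finset ℤ} (hS : ∀ i ∉ S, p.coeff i = 0) :
    Coalgebra.counit (R := k) p = ∑ i ∈ S, p.coeff i := by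
  have h : ∀ p : k[T;T⁻¹], Coalgebra.counit (R := k) p = p.coeff.sum fun _ c => c := by
    intro p
    induction p using LaurentPolynomial.induction_on' with
    | add p q hp hq =>
      rw [map_add, hp, hq, AddMonoidAlgebra.coeff_add, Finsupp.sum_add_index'] <;> simp
    | C_mul_T n a =>
      rw [LaurentPolynomial.counit_C_mul_T, ← single_eq_C_mul_T, AddMonoidAlgebra.coeff_single]
      simp
  rw [h]
  exact Finsupp.sum_of_support_subset _ (fun i hi => by
    by_contra hc; exact (Finsupp.mem_support_iff.1 hi) (hS i hc)) _ (by simp)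

/-- The counit of `k[T, T⁻¹]` is evaluation at `T = 1`. It sends `λ(T)` to the identity and a
Laurent polynomial to the sum of its coefficients. -/
lemma sum_comp {S : Finset ℤ} {X : Fun k A k} (hS : ∀ i ∉ S, comp lam i X = 0) :
    ∑ i ∈ S, comp lam i X = X := by
  have h : post (Bialgebra.counitAlgHom k k[T;T⁻¹]).toLinearMap
      (Ad (cocharPt lam k) (extend k[T;T⁻¹] X)) = X := by
    rw [← Ad_map, map_counit_cocharPt, Ad_one, post_extend]
    rfl
  ext a
  conv_rhs => rw [← h]
  rw [post_apply, AlgHom.toLinearMap_apply, Bialgebra.counitAlgHom_apply, counit_eq_sum _ (S := S)]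
  · simp [comp_apply]
  · intro i hi
    exact congrArg (fun Y : Fun k A k => Y.ofConv a) (hS i hi)

lemma map_comul_cocharPt :
    Pt.map (Bialgebra.comulAlgHom k k[T;T⁻¹]) (cocharPt lam k) =
      Pt.map (Algebra.TensorProduct.includeLeft (R := k) (S := k) (B := k[T;T⁻¹]))
        (cocharPt lam k) * Pt.map Algebra.TensorProduct.includeRight (cocharPt lam k) := by
  refine toFun_injective (Fun.ext fun a => ?_)
  rw [toFun_mul, conv_mul_apply (Coalgebra.Repr.arbitrary k a)]
  simp only [toFun_apply, map_apply, cocharPt_apply, Bialgebra.comulAlgHom_apply,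
    Algebra.TensorProduct.includeLeft_apply, Algebra.TensorProduct.includeRight_apply,
    Algebra.TensorProduct.tmul_mul_tmul, mul_one, one_mul]
  have h := CoalgHomClass.map_comp_comul_apply lam a
  rw [← h, ← (Coalgebra.Repr.arbitrary k a).eq, map_sum]
  rfl

/-- The functional `id ⊗ coeffᵢ`. -/
noncomputable def coeffR (k : Type u) [Field k] (i : ℤ) :
    k[T;T⁻¹] ⊗[k] k[T;T⁻¹] →ₗ[k] k[T;T⁻¹] :=
  (TensorProduct.rid k _).toLinearMap ∘ₗ LinearMap.lTensor _ (coeffL k i)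

lemma coeffR_tmul (i : ℤ) (p q : k[T;T⁻¹]) : coeffR k i (p ⊗ₜ q) = q.coeff i • p := rfl

lemma coeffR_mul (i : ℤ) (r : k[T;T⁻¹]) (s : k[T;T⁻¹] ⊗[k] k[T;T⁻¹]) :
    coeffR k i (Algebra.TensorProduct.includeLeft (R := k) (S := k) r * s) =
      r * coeffR k i s := by
  induction s with
  | zero => simp
  | add x y hx hy => rw [mul_add, map_add, hx, hy, map_add, mul_add]
  | tmul p q =>
    rw [Algebra.TensorProduct.includeLeft_apply, Algebra.TensorProduct.tmul_mul_tmul, one_mul,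
      coeffR_tmul, coeffR_tmul, mul_smul_comm]

lemma coeffR_comul (i : ℤ) (p : k[T;T⁻¹]) :
    coeffR k i (Coalgebra.comul p) = (T i : k[T;T⁻¹]) * algebraMap k _ (p.coeff i) := by
  induction p using LaurentPolynomial.induction_on' with
  | add p q hp hq => 
    rw [map_add, map_add, hp, hq, AddMonoidAlgebra.coeff_add, Finsupp.add_apply, map_add, mul_add]
  | C_mul_T n a =>
    rw [LaurentPolynomial.comul_C_mul_T_self, coeffR_tmul, coeff_C_mul_T]
    split_ifs with h
    · rw [h, Algebra.smul_def, mul_comm]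
    · rw [zero_smul, map_zero, mul_zero]

/-- Compare the coefficients of `T'ⁱ` in `Ad(λ(T T')) X = Ad(λ(T)) Ad(λ(T')) X`. On the left the
comultiplication gives `Tⁱ` times the component, on the right appears `Ad(λ(T))` applied to the
component. -/
lemma comp_mem_weight {X : Fun k A k} (hX : X ∈ lie k A) (i : ℤ) :
    comp lam i X ∈ weight lam i := by
  refine ⟨comp_mem_lie lam hX i, ?_⟩
  have h := Ad_map (Bialgebra.comulAlgHom k k[T;T⁻¹]) (cocharPt lam k) (extend k[T;T⁻¹] X)
  rw [map_comul_cocharPt, Ad_mul, post_extend, ← post_extend Algebra.TensorProduct.includeRight,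
    Ad_map] at h
  have h2 := congrArg (post (coeffR k i)) h
  rw [post_Ad _ _ (coeffR_mul i)] at h2
  have h3 : ∀ Y : Fun k A k[T;T⁻¹], post (coeffR k i)
      (post (Algebra.TensorProduct.includeRight (R := k) (A := k[T;T⁻¹])).toLinearMap Y) =
      extend k[T;T⁻¹] (post (coeffL k i) Y) := by
    intro Y
    ext a
    simp [coeffR_tmul, Algebra.algebraMap_eq_smul_one]
  rw [h3] at h2
  rw [comp_apply, h2]
  ext a
  simp [coeffR_comul]

variable {lam} in
lemma comp_of_mem_weight {X : Fun k A k} {i : ℤ} (hX : X ∈ weight lam i) (j : ℤ) :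
    comp lam j X = if i = j then X else 0 := by
  rw [comp_apply, hX.2]
  ext a
  rw [post_apply, smul_conv_apply, extend_apply, mul_comm, ← C_eq_algebraMap, coeffL_apply,
    coeff_C_mul_T]
  split_ifs <;> rfl

variable {lam} in
lemma commutator_mem_weight {X Y : Fun k A k} {i j : ℤ} (hX : X ∈ weight lam i)
    (hY : Y ∈ weight lam j) : X * Y - Y * X ∈ weight lam (i + j) := by
  refine ⟨mem_lie.2 ((mem_lie.1 hX.1).commutator (mem_lie.1 hY.1)), ?_⟩
  rw [extend_sub, extend_mul, extend_mul, Ad_sub, Ad_conv_mul, Ad_conv_mul, hX.2, hY.2, T_add]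
  simp only [smul_mul_smul_comm, smul_sub, mul_comm (T j : k[T;T⁻¹])]

/-- The derivation `T d/dT`, followed by evaluation at `T = 1`. -/
noncomputable def eulerAtOne (k : Type u) [Field k] : k[T;T⁻¹] →ₗ[k] k :=
  (Finsupp.lsum k fun i : ℤ => (i : k) • LinearMap.id) ∘ₗ
    (AddMonoidAlgebra.coeffLinearEquiv k (S := k) (M := ℤ)).toLinearMap

lemma eulerAtOne_apply (p : k[T;T⁻¹]) :
    eulerAtOne k p = p.coeff.sum fun i c => (i : k) * c := rfl

lemma eulerAtOne_C_mul_T (c : k) (i : ℤ) : eulerAtOne k (C c * T i) = i * c := by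
  rw [eulerAtOne_apply, ← single_eq_C_mul_T, AddMonoidAlgebra.coeff_single,
    Finsupp.sum_single_index (by simp)]

lemma eulerAtOne_T_mul (i : ℤ) (p : k[T;T⁻¹]) :
    eulerAtOne k (T i * p) = i * Coalgebra.counit (R := k) p + eulerAtOne k p := by
  induction p using LaurentPolynomial.induction_on' with
  | add p q hp hq => rw [mul_add, map_add, hp, hq, map_add, map_add]; ring
  | C_mul_T n a =>
    have : (T i * (C a * T n) : k[T;T⁻¹]) = C a * T (i + n) := by rw [T_add]; ring
    rw [this, eulerAtOne_C_mul_T, eulerAtOne_C_mul_T, LaurentPolynomial.counit_C_mul_T]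
    push_cast
    simp
    ring

/-- The differential of `λ` acts on the space of weight `i` as `i`. -/
lemma differential_commutator {h : Fun k A k} (hh : IsDifferential lam h) {X : Fun k A k} {i : ℤ}
    (hX : X ∈ weight lam i) : h * X - X * h = (i : k) • X := by
  have h0 : post (eulerAtOne k) (Pt.toFun (cocharPt lam k)) = h := by
    ext a
    rw [post_apply, toFun_apply, cocharPt_apply, hh a]; rfl
  -- The claim is the derivative `T d/dT` at `T = 1` of the identity `λ(T) X = Tⁱ X λ(T)`.
  have h1 : Pt.toFun (cocharPt lam k) * extend k[T;T⁻¹] X =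
      (T i : k[T;T⁻¹]) • (extend k[T;T⁻¹] X * Pt.toFun (cocharPt lam k)) := by
    rw [← smul_mul_assoc, ← hX.2, Ad_def, mul_assoc, toFun_inv_mul, mul_one]
  have h2 := congrArg (post (eulerAtOne k)) h1
  have hk : ∀ (φ : k[T;T⁻¹] →ₗ[k] k) (r : k) s, φ (Algebra.ofId k k[T;T⁻¹] r * s) = r * φ s := by
    intro φ r s
    rw [Algebra.ofId_apply, ← Algebra.smul_def, map_smul, smul_eq_mul]
  rw [extend_eq_post, post_mul_right _ _ (hk _), h0] at h2
  rw [h2]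
  have h3 : ∀ Y : Fun k A k[T;T⁻¹], post (eulerAtOne k) ((T i : k[T;T⁻¹]) • Y) =
      (i : k) • post (Coalgebra.counit (R := k)) Y + post (eulerAtOne k) Y := by
    intro Y
    ext a
    exact eulerAtOne_T_mul i _
  have h4 : post (Coalgebra.counit (R := k)) (Pt.toFun (cocharPt lam k)) = 1 :=
    (toFun_map (Bialgebra.counitAlgHom k k[T;T⁻¹]) (cocharPt lam k)).symm.trans
      (by rw [map_counit_cocharPt, toFun_one])
  rw [h3, post_mul_left _ _ (hk _), post_mul_left _ _ (hk _), h0, h4, mul_one, add_sub_cancel_right]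

end Weights

/-! ### Representations of `𝔰𝔩₂` with small weights -/

section SlTwo

/-- In a representation of `𝔰𝔩₂`, commuting the raising operator past powers of the lowering
operator. -/
lemma raise_lower_pow {k M : Type*} [Field k] [AddCommGroup M] [Module k M]
    {E F H : Module.End k M} (hEF : E * F - F * E = H) (hHF : H * F - F * H = -((2 : k) • F))
    {z : M} {c : k} (hz : H z = c • z) (s : ℕ) :
    E ((F ^ (s + 1)) z) = (F ^ (s + 1)) (E z) + ((s + 1) * (c - s)) • (F ^ s) z := by
  have h1 : ∀ x, E (F x) = F (E x) + H x := fun x => by rw [← hEF]; simp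
  have h2 : ∀ x, H (F x) = F (H x) - (2 : k) • F x := fun x => by
    have := LinearMap.congr_fun hHF x
    simp only [LinearMap.sub_apply, Module.End.mul_apply, LinearMap.neg_apply,
      LinearMap.smul_apply] at this
    rw [sub_eq_iff_eq_add] at this
    rw [this]; abel
  have h3 : ∀ t : ℕ, H ((F ^ t) z) = (c - 2 * t) • (F ^ t) z := by
    intro t
    induction t with
    | zero => simp [hz]
    | succ t ih =>
      rw [pow_succ', Module.End.mul_apply, h2, ih, map_smul, ← sub_smul]
      push_cast
      ring_nf
  induction s with
  | zero => simp [h1, hz]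
  | succ s ih =>
    rw [pow_succ' F (s + 1), Module.End.mul_apply, h1, ih, h3, map_add, map_smul,
      Module.End.mul_apply, add_assoc]
    rw [← Module.End.mul_apply F (F ^ s), ← pow_succ', ← add_smul]
    push_cast
    ring_nf

/-- In a representation of `𝔰𝔩₂`, lowering and raising a vector of positive weight is in the image
of the raising operator, as long as the weights involved are small. -/
lemma lower_raise_mem {k M : Type*} [Field k] [AddCommGroup M] [Module k M]
    {E F H : Module.End k M} (hEF : E * F - F * E = H) (hHF : H * F - F * H = -((2 : k) • F))
    {y : M} {j : ℕ} (hy : ∀ s : ℕ, H ((E ^ s) y) = ((j + 2 * s : ℕ) : k) • (E ^ s) y)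
    (hne : ∀ s : ℕ, (E ^ s) y ≠ 0 → ((s + 1 : ℕ) : k) ≠ 0 ∧ ((j + s : ℕ) : k) ≠ 0)
    {N : ℕ} (hN : (E ^ N) y = 0) (P : Submodule k M)
    (hP : ∀ s : ℕ, (F ^ (s + 1)) ((E ^ s) y) ∈ P) : y ∈ P.map E := by
  -- Descending induction on `s`, starting at `s = N` where `E ^ N` kills `y`. The identity `E
  -- F^(s+1) E^s y = F^(s+1) E^(s+1) y + (s+1)(j+s) F^s E^s y` expresses case `s` through case `s +
  -- 1`, as the integer factor is invertible unless `E ^ s y = 0`.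
  suffices h : ∀ t s : ℕ, s + t = N → (F ^ s) ((E ^ s) y) ∈ P.map E by
    simpa using h N 0 (zero_add N)
  intro t
  induction t with
  | zero => rintro s rfl; rw [add_zero] at hN; rw [hN, map_zero]; exact zero_mem _
  | succ t ih =>
    intro s hs
    have h1 := ih (s + 1) (by omega)
    have h2 := raise_lower_pow hEF hHF (hy s) s
    rw [← Module.End.mul_apply E (E ^ s), ← pow_succ'] at h2
    by_cases h0 : (E ^ s) y = 0
    · rw [h0, map_zero]; exact zero_mem _
    obtain ⟨h3, h4⟩ := hne s h0
    have h5 : ((s + 1) * (((j + 2 * s : ℕ) : k) - s)) = ((s + 1 : ℕ) : k) * ((j + s : ℕ) : k) := by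
      push_cast; ring
    rw [h5] at h2
    have h6 : (((s + 1 : ℕ) : k) * ((j + s : ℕ) : k)) • (F ^ s) ((E ^ s) y) ∈ P.map E := by
      rw [← sub_eq_iff_eq_add'] at h2
      rw [← h2]
      exact sub_mem ⟨_, hP s, rfl⟩ h1
    exact (Submodule.smul_mem_iff _ (mul_ne_zero h3 h4)).1 h6

end SlTwo

/-! ### Transversality of the adjoint orbits to `V_{≤ 1}` -/

section Surjectivity

open LaurentPolynomial

variable {k K A : Type u} [Field k] [Field K] [Algebra k K] [CommRing A] [HopfAlgebra k A]
  {θ : (K ⊗[k] A) ≃ₐc[K] (K ⊗[k] A)} {I₀ : Ideal A} {lam : A →ₐc[k] k[T;T⁻¹]}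

/-- The commutator with `X` as a linear map. -/
noncomputable def adL (X : Fun k A k) : Module.End k (Fun k A k) :=
  LinearMap.mulLeft k X - LinearMap.mulRight k X

@[simp] lemma adL_apply (X Y : Fun k A k) : adL X Y = X * Y - Y * X := rfl

lemma adL_commutator (X Y : Fun k A k) : adL X * adL Y - adL Y * adL X = adL (X * Y - Y * X) := by
  refine LinearMap.ext fun Z => ?_
  simp only [LinearMap.sub_apply, Module.End.mul_apply, adL_apply]
  noncomm_ring

lemma adL_smul (c : k) (X : Fun k A k) : adL (c • X) = c • adL X := by
  refine LinearMap.ext fun Z => ?_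
  simp [smul_sub]

lemma adL_neg (X : Fun k A k) : adL (-X) = -adL X := by
  refine LinearMap.ext fun Z => ?_
  simp; abel

lemma mem_cocharPt (hl : ∀ a ∈ I₀, lam a = 0) : Mem I₀ (cocharPt lam k) := fun a ha => by
  rw [cocharPt_apply, hl a ha]

lemma mem_weightLE {V : Submodule k (Fun k A k)} {X : Fun k A k} {i j : ℤ} (hij : i ≤ j)
    (hV : X ∈ V) (hX : X ∈ weight lam i) : X ∈ weightLE lam V j :=
  Submodule.mem_iSup_of_mem i (Submodule.mem_iSup_of_mem hij ⟨hV, hX⟩)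

lemma weightLE_le (V : Submodule k (Fun k A k)) (j : ℤ) : weightLE lam V j ≤ V :=
  iSup_le fun _ => iSup_le fun _ => inf_le_left

lemma weightLE_induction {V : Submodule k (Fun k A k)} {j : ℤ} {P : Fun k A k → Prop}
    (h : ∀ i ≤ j, ∀ X ∈ V, X ∈ weight lam i → P X) (h0 : P 0) (ha : ∀ X Y, P X → P Y → P (X + Y))
    {X : Fun k A k} (hX : X ∈ weightLE lam V j) : P X := by
  refine Submodule.iSup_induction (motive := P) _ hX (fun i x hx => ?_) h0 ha
  by_cases hij : i ≤ j
  · rw [iSup_pos hij] at hx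
    exact h i hij x hx.1 hx.2
  · rw [iSup_neg hij, Submodule.mem_bot] at hx
    rwa [hx]

variable {ζ : K} {n : ℤ} {e h f : Fun k A k}

lemma IsAssociated.adL_iterate_mem (hlam : IsAssociated θ ζ n I₀ lam e h f) (hζ : ζ ≠ 0)
    {Y : Fun k A k} (hY : Y ∈ eigen θ (ζ ^ n)) (s : ℕ) :
    (adL e ^ s) Y ∈ eigen θ (ζ ^ (n * (s + 1))) := by
  induction s with
  | zero => simpa using hY
  | succ s ih =>
    rw [pow_succ', Module.End.mul_apply, adL_apply]
    have := commutator_mem_eigen θ hlam.e_mem ih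
    rw [← zpow_add₀ hζ] at this
    have h0 : n * (((s + 1 : ℕ) : ℤ) + 1) = n + n * (s + 1) := by push_cast; ring
    rwa [h0]

lemma IsAssociated.adL_f_iterate_mem (hlam : IsAssociated θ ζ n I₀ lam e h f) (hζ : ζ ≠ 0)
    {Y : Fun k A k} {l : ℤ} (hY : Y ∈ eigen θ (ζ ^ l)) (s : ℕ) :
    (adL f ^ s) Y ∈ eigen θ (ζ ^ (l - n * s)) := by
  induction s with
  | zero => simpa using hY
  | succ s ih =>
    rw [pow_succ', Module.End.mul_apply, adL_apply]
    have := commutator_mem_eigen θ hlam.f_mem ih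
    rw [← zpow_add₀ hζ] at this
    have h0 : l - n * ((s + 1 : ℕ) : ℤ) = -n + (l - n * s) := by push_cast; ring
    rwa [h0]

lemma IsAssociated.adL_iterate_weight (hlam : IsAssociated θ ζ n I₀ lam e h f)
    {Y : Fun k A k} {j : ℤ} (hY : Y ∈ weight lam j) (s : ℕ) :
    (adL e ^ s) Y ∈ weight lam (j + 2 * s) := by
  induction s with
  | zero => simpa using hY
  | succ s ih =>
    rw [pow_succ', Module.End.mul_apply, adL_apply]
    have := commutator_mem_weight hlam.e_weight ih
    convert this using 2
    push_cast; ring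

/-- A weight `l` that occurs satisfies `2 l ≤ p` in characteristic `p > 0`, so a positive `t ≤ l` is
smaller than `p`. -/
lemma cast_ne_zero_of_weight (hb : ringChar k = 0 ∨ ∀ i : ℤ, weight lam i ≠ ⊥ →
    2 * |i| ≤ ringChar k) {X : Fun k A k} {l : ℕ} (hX : X ∈ weight lam l) (h0 : X ≠ 0)
    {t : ℕ} (ht : 0 < t) (htl : t ≤ l) : (t : k) ≠ 0 := by
  rw [Ne, ringChar.spec]
  rcases hb with hb | hb
  · rw [hb, zero_dvd_iff]; omega
  · have h1 := hb l fun hbot => h0 (by rwa [hbot, Submodule.mem_bot] at hX)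
    have h2 : |(l : ℤ)| = l := abs_of_nonneg (by positivity)
    rw [h2] at h1
    intro hd
    have := Nat.le_of_dvd ht hd
    omega

variable [IsAlgClosed K] [Algebra.FiniteType k A]

lemma comp_mem_eigen (hI₀ : IsFixedComponent θ I₀) (hl : ∀ a ∈ I₀, lam a = 0) {c : K}
    {X : Fun k A k} (hX : X ∈ eigen θ c) (i : ℤ) : comp lam i X ∈ eigen θ c :=
  post_mem_of_mem_scalars (Ad_mem_scalars_eigen hI₀ (mem_cocharPt hl) hX) _

/-- The cocharacter has values in `G⁽⁰⁾`, so the eigenspace is a sum of weight spaces, and finitely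
many weights occur. The bound is written `1 + t` in preparation for an induction on `t` that ends at
weight `1`. -/
lemma exists_eigen_le_weightLE (hI₀ : IsFixedComponent θ I₀) (hl : ∀ a ∈ I₀, lam a = 0) (c : K) :
    ∃ t : ℕ, eigen θ c ≤ weightLE lam (eigen θ c) (1 + t) := by
  obtain ⟨S, hS⟩ := exists_finset_comp lam
  refine ⟨∑ i ∈ S, i.natAbs, fun X hX => ?_⟩
  rw [← sum_comp lam (hS X hX.1)]
  refine sum_mem fun i hi => mem_weightLE (i := i) ?_ (comp_mem_eigen hI₀ hl hX i)
    (comp_mem_weight lam hX.1 i)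
  have h1 : i.natAbs ≤ ∑ i ∈ S, i.natAbs :=
    Finset.single_le_sum (f := fun i : ℤ => i.natAbs) (fun _ _ => Nat.zero_le _) hi
  omega

/-- The map `ad e` from the part of degree `0` and weight `j - 2` onto the part of degree `n` and
weight `j ≥ 2` is surjective. -/
lemma IsAssociated.exists_commutator_eq (hlam : IsAssociated θ ζ n I₀ lam e h f) (hζ : ζ ≠ 0)
    (hI₀ : IsFixedComponent θ I₀) {Y : Fun k A k} {j : ℤ} (hj : 2 ≤ j)
    (hY : Y ∈ eigen θ (ζ ^ n)) (hYj : Y ∈ weight lam j) :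
    ∃ X ∈ eigen θ (1 : K), X ∈ weight lam (j - 2) ∧ e * X - X * e = Y := by
  obtain ⟨S, hS⟩ := exists_finset_comp lam
  obtain ⟨l, rfl⟩ := Int.eq_ofNat_of_zero_le (by omega : 0 ≤ j)
  have hw : ∀ s : ℕ, (adL e ^ s) Y ∈ weight lam ((l + 2 * s : ℕ) : ℤ) := fun s => by
    have := hlam.adL_iterate_weight hYj s
    push_cast
    exact this
  have hN : ∃ N : ℕ, (adL e ^ N) Y = 0 := by
    -- With this exponent the weight exceeds every element of `S`.
    refine ⟨∑ i ∈ S, i.natAbs + 1, ?_⟩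
    have h1 := hw (∑ i ∈ S, i.natAbs + 1)
    have h2 := hS _ h1.1 ((l + 2 * (∑ i ∈ S, i.natAbs + 1) : ℕ) : ℤ) fun hi => by
      have := Finset.single_le_sum (f := fun i : ℤ => i.natAbs) (fun _ _ => Nat.zero_le _) hi
      simp only [Int.natAbs_natCast] at this
      omega
    rwa [comp_of_mem_weight h1, if_pos rfl] at h2
  obtain ⟨N, hN⟩ := hN
  -- The preimage has degree zero because `s` applications of `ad e` to `Y` and `s + 1` applications
  -- of `ad f` add up to degree `n (s + 1) - n (s + 1)`.
  have key : Y ∈ (eigen θ (1 : K)).map (adL e) := by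
    refine lower_raise_mem (E := adL e) (F := adL f) (H := adL h) (j := l) ?_ ?_ ?_ ?_ hN _ ?_
    · rw [adL_commutator, hlam.lie_e_f]
    · rw [adL_commutator, hlam.lie_h_f, adL_neg, adL_smul]
    · intro s
      rw [adL_apply, differential_commutator lam hlam.differential (hw s)]
      simp
    · intro s hs
      exact ⟨cast_ne_zero_of_weight hlam.bounded (hw s) hs (by omega) (by omega),
        cast_ne_zero_of_weight hlam.bounded (hw s) hs (by omega) (by omega)⟩
    · intro s
      have := hlam.adL_f_iterate_mem hζ (hlam.adL_iterate_mem hζ hY s) (s + 1)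
      have h0 : n * ((s : ℤ) + 1) - n * ((s + 1 : ℕ) : ℤ) = 0 := by push_cast; ring
      rwa [h0, zpow_zero] at this
  obtain ⟨X, hX, hXY⟩ := key
  -- As `ad e` raises weights by exactly `2`, only the component of `X` of weight `l - 2`
  -- contributes to `Y`.
  refine ⟨comp lam (l - 2) X, comp_mem_eigen hI₀ hlam.image_le hX _, comp_mem_weight lam hX.1 _, ?_⟩
  have h1 : ∀ i, comp lam l (adL e (comp lam i X)) =
      if i = l - 2 then adL e (comp lam (l - 2) X) else 0 := by
    intro i
    have := commutator_mem_weight hlam.e_weight (comp_mem_weight lam hX.1 i)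
    rw [adL_apply, comp_of_mem_weight this]
    by_cases hi : i = l - 2
    · rw [if_pos hi, if_pos (by omega), hi, adL_apply]
    · rw [if_neg hi, if_neg (by omega)]
  have h2 : comp lam l (adL e X) = adL e (comp lam (l - 2) X) := by
    conv_lhs => rw [← sum_comp lam (hS X hX.1)]
    rw [map_sum, map_sum, Finset.sum_congr rfl fun i _ => h1 i, Finset.sum_ite_eq']
    split_ifs with hmem
    · rfl
    · rw [hS X hX.1 _ hmem, map_zero]
  rw [hXY, comp_of_mem_weight hYj, if_pos rfl] at h2
  exact h2.symm

/-- The adjoint action of the Lie algebra of `G⁽⁰⁾` at a point of `e + V_{≤ 1}` is transversal to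
`V_{≤ 1}`. -/
lemma IsAssociated.exists_commutator_sub_mem (hlam : IsAssociated θ ζ n I₀ lam e h f)
    (hζ : ζ ≠ 0) (hI₀ : IsFixedComponent θ I₀) {R : Type u} [CommRing R] [Algebra k R]
    {w y : Fun k A R} (hw : w ∈ scalars R (weightLE lam (eigen θ (ζ ^ n)) 1))
    (hy : y ∈ scalars R (eigen θ (ζ ^ n))) :
    ∃ X ∈ scalars R (eigen θ (1 : K)),
      (X * (extend R e + w) - (extend R e + w) * X) - y ∈
        scalars R (weightLE lam (eigen θ (ζ ^ n)) 1) := by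
  obtain ⟨t, ht⟩ := exists_eigen_le_weightLE hI₀ hlam.image_le (ζ ^ n)
  replace hy := scalars_mono ht hy
  clear ht
  set V := eigen θ (ζ ^ n)
  -- The claim is `R`-linear in `y`, so it is enough to treat elements coming from `k`.
  have hspan : ∀ t : ℕ, (∀ Y ∈ weightLE lam V (1 + t), ∃ X ∈ scalars R (eigen θ (1 : K)),
      (X * (extend R e + w) - (extend R e + w) * X) - extend R Y ∈ scalars R (weightLE lam V 1)) →
      ∀ y ∈ scalars R (weightLE lam V (1 + t)), ∃ X ∈ scalars R (eigen θ (1 : K)),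
      (X * (extend R e + w) - (extend R e + w) * X) - y ∈ scalars R (weightLE lam V 1) := by
    intro t ht y hy
    induction hy using Submodule.span_induction with
    | mem x hx => obtain ⟨Y, hY, rfl⟩ := hx; exact ht Y hY
    | zero => exact ⟨0, zero_mem _, by simp⟩
    | add x y _ _ hx hy =>
      obtain ⟨X, hX, hX'⟩ := hx
      obtain ⟨Z, hZ, hZ'⟩ := hy
      refine ⟨X + Z, add_mem hX hZ, ?_⟩
      convert add_mem hX' hZ' using 1
      noncomm_ring
    | smul r x _ hx =>
      obtain ⟨X, hX, hX'⟩ := hx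
      refine ⟨r • X, Submodule.smul_mem _ _ hX, ?_⟩
      convert Submodule.smul_mem _ r hX' using 1
      rw [smul_sub, smul_sub, smul_mul_assoc, mul_smul_comm]
  refine hspan t ?_ y hy
  clear hy y
  induction t with
  | zero =>
    intro Y hY
    refine ⟨0, zero_mem _, ?_⟩
    rw [zero_mul, mul_zero, sub_zero, zero_sub]
    refine neg_mem (extend_mem_scalars ?_)
    simpa using hY
  | succ t ih =>
    intro Y hY
    refine weightLE_induction (P := fun Y => ∃ X ∈ scalars R (eigen θ (1 : K)),
      (X * (extend R e + w) - (extend R e + w) * X) - extend R Y ∈ scalars R (weightLE lam V 1))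
      ?_ ?_ ?_ hY
    rotate_left
    · exact ⟨0, zero_mem _, by simp [extend_eq_post, post]⟩
    · intro X Y hX hY
      obtain ⟨X', hX', hX⟩ := hX
      obtain ⟨Z, hZ, hZ'⟩ := hY
      refine ⟨X' + Z, add_mem hX' hZ, ?_⟩
      convert add_mem hX hZ' using 1
      rw [extend_add]
      noncomm_ring
    · intro i hi X hX hXi
      by_cases hi2 : i ≤ 1 + t
      · exact ih X (mem_weightLE hi2 hX hXi)
      -- Here `X` has the top weight `i = t + 2`. With `[e, Z] = X` one has `[-Z, e + w] = X - [Z,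
      -- w]`. The error `[Z, w]` has weight at most `(i - 2) + 1 = t + 1`, so the induction
      -- hypothesis removes it.
      obtain ⟨Z, hZ, hZi, hZX⟩ := hlam.exists_commutator_eq hζ hI₀ (by omega) hX hXi
      have hwZ : extend R Z * w - w * extend R Z ∈ scalars R (weightLE lam V (1 + t)) := by
        clear hspan ih
        induction hw using Submodule.span_induction with
        | mem x hx =>
          obtain ⟨U, hU, rfl⟩ := hx
          rw [← extend_mul, ← extend_mul, ← extend_sub]
          refine extend_mem_scalars ?_
          refine weightLE_induction (P := fun U => Z * U - U * Z ∈ weightLE lam V (1 + t))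
            ?_ (by simp) ?_ hU
          rotate_left
          · intro X Y hX hY
            convert add_mem hX hY using 1
            noncomm_ring
          · intro a ha X hX hXa
            refine mem_weightLE (i := i - 2 + a) (by push_cast at hi; omega) ?_
              (commutator_mem_weight hZi hXa)
            have := commutator_mem_eigen θ hZ hX
            rwa [one_mul] at this
        | zero => simp
        | add x y _ _ hx hy =>
          convert add_mem hx hy using 1
          noncomm_ring
        | smul r x _ hx =>
          convert Submodule.smul_mem _ r hx using 1
          rw [smul_sub, smul_mul_assoc, mul_smul_comm]
      obtain ⟨Z', hZ', h'⟩ := hspan t ih _ hwZ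
      refine ⟨Z' - extend R Z, sub_mem hZ' (extend_mem_scalars hZ), ?_⟩
      convert h' using 1
      rw [← hZX, extend_sub, extend_mul, extend_mul]
      noncomm_ring

end Surjectivity

/-! ### Coordinates on `V / W` and the functions on the group they define -/

section Coordinates

variable {k A : Type u} [Field k] [CommRing A] [HopfAlgebra k A]

lemma smul_extend_apply {R : Type u} [CommRing R] [Algebra k R] {W : Submodule k (Fun k A k)}
    {a : A} (ha : ∀ X ∈ W, X.ofConv a = 0) {Z : Fun k A R} (hZ : Z ∈ scalars R W) :
    Z.ofConv a = 0 := by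
  induction hZ using Submodule.span_induction with
  | mem x hx =>
    obtain ⟨Y, hY, rfl⟩ := hx
    rw [extend_apply, ha Y hY, map_zero]
  | zero => rfl
  | add x y _ _ hx hy => rw [ofConv_add, LinearMap.add_apply, hx, hy, add_zero]
  | smul r x _ hx => rw [smul_conv_apply, hx, mul_zero]

lemma IsPointDer.of_mem_scalars {R : Type u} [CommRing R] [Algebra k R]
    {V : Submodule k (Fun k A k)} (hV : V ≤ lie k A) {Z : Fun k A R} (hZ : Z ∈ scalars R V) :
    IsPointDer Z :=
  isPointDer_of_mem_scalars hV hZ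

/-- Functions on the group whose differentials form a basis of the space of functionals on a space
`V` of tangent vectors which vanish on `W`. -/
lemma exists_coordinates [Algebra.FiniteType k A] {V W : Submodule k (Fun k A k)}
    (hV : V ≤ lie k A) (hW : W ≤ V) : ∃ (d : ℕ) (a : Fin d → A) (v : Fin d → Fun k A k),
    Module.finrank k V = Module.finrank k W + d ∧ (∀ l, v l ∈ V) ∧
    (∀ l i, (v l).ofConv (a i) = if l = i then 1 else 0) ∧
    ∀ (R : Type u) [CommRing R] [Algebra k R] (Z : Fun k A R), Z ∈ scalars R V →
      (Z ∈ scalars R W ↔ ∀ i, Z.ofConv (a i) = 0) := by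
  have := finite_lie (k := k) (A := A)
  have : Module.Finite k V := .of_injective (Submodule.inclusion hV) (Submodule.inclusion_injective hV)
  let W' : Submodule k V := W.comap V.subtype
  let b := Module.finBasis k (V ⧸ W')
  let ev : A →ₗ[k] Module.Dual k V :=
    LinearMap.flip ((WithConv.linearEquiv k (A →ₗ[k] k)).toLinearMap ∘ₗ V.subtype)
  -- Each functional on the finite-dimensional space `V` is evaluation at some `a` in `A`, since an
  -- element of `V` on which all evaluations vanish is zero. The `a i` lift the dual basis of `V /
  -- W`, and the `v l` lift the basis.
  have hev : Function.Surjective ev := by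
    rw [← LinearMap.range_eq_top, ← Subspace.dualCoannihilator_dualAnnihilator_eq (W := LinearMap.range ev),
      Submodule.dualAnnihilator_eq_top_iff, eq_bot_iff]
    intro X hX
    rw [Submodule.mem_dualCoannihilator] at hX
    exact Subtype.ext (Fun.ext fun a => hX _ ⟨a, rfl⟩)
  choose a ha using fun i => hev ((b.coord i) ∘ₗ W'.mkQ)
  choose v hv using fun i => W'.mkQ_surjective (b i)
  have ha' : ∀ i (X : V), X.1.ofConv (a i) = b.coord i (W'.mkQ X) := fun i X =>
    LinearMap.congr_fun (ha i) X
  have hmem : ∀ X (hX : X ∈ V), X ∈ W ↔ ∀ i, X.ofConv (a i) = 0 := by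
    intro X hX
    have h1 : X ∈ W ↔ W'.mkQ ⟨X, hX⟩ = 0 := by
      rw [Submodule.mkQ_apply, Submodule.Quotient.mk_eq_zero]; rfl
    rw [h1, ← b.forall_coord_eq_zero_iff]
    exact forall_congr' fun i => by rw [← ha' i ⟨X, hX⟩]
  refine ⟨_, a, fun l => (v l).1, ?_, fun l => (v l).2, fun l i => ?_, fun R _ _ Z hZ => ?_⟩
  · have h1 := Submodule.finrank_quotient_add_finrank W'
    have h2 : Module.finrank k W' = Module.finrank k W :=
      (Submodule.comapSubtypeEquivOfLe hW).finrank_eq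
    rw [← h1, h2, add_comm]
  · rw [ha', hv, Module.Basis.coord_apply, Module.Basis.repr_self, Finsupp.single_apply]
  · refine ⟨fun h i => smul_extend_apply (fun X hX => (hmem X (hW hX)).1 hX i) h, fun h => ?_⟩
    refine mem_scalars (IsPointDer.of_mem_scalars hV hZ) fun φ => ?_
    rw [hmem _ (post_mem_of_mem_scalars hZ φ)]
    intro i
    rw [post_apply, h i, map_zero]

/-- The function `g ↦ (Ad(g⁻¹) γ - e)(a)` on the group. -/
noncomputable def transporterFun (γ e : Fun k A k) (a : A) : A :=
  (Ad (univPt k A)⁻¹ (extend A γ) - extend A e).ofConv a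

/-- The function `g ↦ (Ad(g) X - Y)(a)` on the group. -/
noncomputable def orbitFun (X Y : Fun k A k) (a : A) : A :=
  (Ad (univPt k A) (extend A X) - extend A Y).ofConv a

variable {R : Type u} [CommRing R] [Algebra k R]

lemma apply_transporterFun (g : Pt k A R) (γ e : Fun k A k) (a : A) :
    g.ofConv (transporterFun γ e a) = (Ad g⁻¹ (extend R γ) - extend R e).ofConv a := by
  have h := Ad_map g.ofConv (univPt k A)⁻¹ (extend A γ)
  rw [post_extend, map_inv', map_univPt] at h
  rw [h, ← post_extend g.ofConv e, ← post_sub]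
  rfl

lemma apply_orbitFun (g : Pt k A R) (X Y : Fun k A k) (a : A) :
    g.ofConv (orbitFun X Y a) = (Ad g (extend R X) - extend R Y).ofConv a := by
  have h := Ad_map g.ofConv (univPt k A) (extend A X)
  rw [post_extend, map_univPt] at h
  rw [h, ← post_extend g.ofConv Y, ← post_sub]
  rfl

lemma mem_hull_of_le {F : ∀ (R : Type u) [CommRing R] [Algebra k R], Pt k A R → Prop} {a : A}
    (h : ∀ (R : Type u) [CommRing R] [Algebra k R] (g : Pt k A R), F R g → g.ofConv a = 0) :
    a ∈ hull F := fun R _ _ g hg => h R g hg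

end Coordinates

/-! ### Invariance of the transporter condition under `E°` -/

section Invariance

open LaurentPolynomial

variable {k A : Type u} [Field k] [CommRing A] [HopfAlgebra k A] [Algebra.FiniteType k A]
  {I₀ : Ideal A} {lam : A →ₐc[k] k[T;T⁻¹]} {V : Submodule k (Fun k A k)} {e : Fun k A k}
  {R : Type u} [CommRing R] [Algebra k R]

/-- The points of the hull of the stabilizer stabilize the affine space. -/
lemma Ad_mem_of_mem_hull (hV : V ≤ lie k A) (he : e ∈ V) (hsub : IsSubgroup k I₀)
    (hAd : ∀ (R : Type u) [CommRing R] [Algebra k R] (g : Pt k A R), Mem I₀ g →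
      ∀ X ∈ V, Ad g (extend R X) ∈ scalars R V) {u : Pt k A R}
    (hu : Mem (stabilizerComponent I₀ lam V e) u) {Y : Fun k A R}
    (hY : Y - extend R e ∈ scalars R (weightLE lam V 1)) :
    Ad u Y - extend R e ∈ scalars R (weightLE lam V 1) ∧
      Ad u⁻¹ Y - extend R e ∈ scalars R (weightLE lam V 1) := by
  have hW : weightLE lam V 1 ≤ V := weightLE_le V 1
  obtain ⟨d, a, v, -, -, -, ha⟩ := exists_coordinates hV hW
  replace hu : Mem (hull (stabilizer I₀ lam V e)) u := fun x hx => hu x (Ideal.mem_sup_left hx)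
  have huI : Mem I₀ u := fun x hx => hu x (mem_hull_of_le fun R _ _ g hg => hg.1 x hx)
  have stab : ∀ (R : Type u) [CommRing R] [Algebra k R] (g : Pt k A R), stabilizer I₀ lam V e R g →
      (∀ Y, Y - extend R e ∈ scalars R (weightLE lam V 1) →
        Ad g Y - extend R e ∈ scalars R (weightLE lam V 1)) ∧
      (∀ Y, Y - extend R e ∈ scalars R (weightLE lam V 1) →
        Ad g⁻¹ Y - extend R e ∈ scalars R (weightLE lam V 1)) := by
    intro R _ _ g hg
    have h := hg.2.2
    refine ⟨fun Y hY => ?_, fun Y hY => ?_⟩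
    · have : Ad g Y ∈ {Y | Y - extend R e ∈ scalars R (weightLE lam V 1)} := by
        rw [← h]; exact ⟨Y, hY, rfl⟩
      exact this
    · have : Y ∈ {Y | Y - extend R e ∈ scalars R (weightLE lam V 1)} := hY
      rw [← h] at this
      obtain ⟨Z, hZ, rfl⟩ := this
      rw [Ad_inv_Ad]; exact hZ
  -- A point of the hull need not be known to lie in the functor `stabilizer`. Therefore the
  -- stabilizing property is rewritten as the vanishing of functions on the group; these vanish at
  -- all points of the functor, hence belong to the ideal `hull`.
  have main : ∀ u' : Pt k A R, Mem I₀ u' →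
      (∀ i, (Ad u' (extend R e) - extend R e).ofConv (a i) = 0) →
      (∀ w ∈ weightLE lam V 1, ∀ i, (Ad u' (extend R w)).ofConv (a i) = 0) →
      Ad u' Y - extend R e ∈ scalars R (weightLE lam V 1) := by
    intro u' hu' h1 h2
    have h3 : Ad u' (extend R e) - extend R e ∈ scalars R (weightLE lam V 1) :=
      (ha R _ (sub_mem (hAd R u' hu' e he) (extend_mem_scalars he))).2 h1
    have h4 : ∀ w ∈ scalars R (weightLE lam V 1), Ad u' w ∈ scalars R (weightLE lam V 1) := by
      intro w hw
      induction hw using Submodule.span_induction with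
      | mem x hx =>
        obtain ⟨X, hX, rfl⟩ := hx
        exact (ha R _ (hAd R u' hu' X (hW hX))).2 (h2 X hX)
      | zero =>
        have : Ad u' (0 : Fun k A R) = 0 := by simp [Ad_def]
        rw [this]; exact zero_mem _
      | add x y _ _ hx hy => rw [Ad_add]; exact add_mem hx hy
      | smul r x _ hx => rw [Ad_smul']; exact Submodule.smul_mem _ _ hx
    have h5 := add_mem (h4 _ hY) h3
    rwa [Ad_sub, sub_add_sub_cancel] at h5
  have base : ∀ (R : Type u) [CommRing R] [Algebra k R],
      extend R e - extend R e ∈ scalars R (weightLE lam V 1) := fun R _ _ => by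
    rw [sub_self]; exact zero_mem _
  -- The linear part is obtained by subtracting the images of the two points `e + w` and `e` of the
  -- affine space.
  have lin : ∀ (R : Type u) [CommRing R] [Algebra k R] (g : Pt k A R),
      (∀ Y, Y - extend R e ∈ scalars R (weightLE lam V 1) →
        Ad g Y - extend R e ∈ scalars R (weightLE lam V 1)) → ∀ w ∈ weightLE lam V 1,
      Ad g (extend R w) ∈ scalars R (weightLE lam V 1) := by
    intro R _ _ g hg w hw
    have h1 := hg (extend R w + extend R e) (by
      rw [add_sub_cancel_right]; exact extend_mem_scalars hw)
    have h2 := sub_mem h1 (hg _ (base R))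
    rwa [Ad_add, sub_sub_sub_cancel_right, add_sub_cancel_right] at h2
  have van : ∀ (R : Type u) [CommRing R] [Algebra k R] (Z : Fun k A R),
      Z ∈ scalars R (weightLE lam V 1) → ∀ i, Z.ofConv (a i) = 0 := fun R _ _ Z hZ =>
    (ha R Z (scalars_mono hW hZ)).1 hZ
  constructor
  · refine main u huI (fun i => ?_) fun w hw i => ?_
    · rw [← apply_orbitFun]
      refine hu _ (mem_hull_of_le fun R _ _ g hg => ?_)
      rw [apply_orbitFun]
      exact van R _ ((stab R g hg).1 _ (base R)) i
    · have h0 : extend R (0 : Fun k A k) = 0 := by ext; simp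
      rw [← sub_zero (Ad u _), ← h0, ← apply_orbitFun]
      refine hu _ (mem_hull_of_le fun R _ _ g hg => ?_)
      have h0 : extend R (0 : Fun k A k) = 0 := by ext; simp
      rw [apply_orbitFun, h0, sub_zero]
      exact van R _ (lin R g (stab R g hg).1 w hw) i
  · refine main u⁻¹ (hsub.inv_mem _ _ huI) (fun i => ?_) fun w hw i => ?_
    · rw [← apply_transporterFun]
      refine hu _ (mem_hull_of_le fun R _ _ g hg => ?_)
      rw [apply_transporterFun]
      exact van R _ ((stab R g hg).2 _ (base R)) i
    · have h0 : extend R (0 : Fun k A k) = 0 := by ext; simp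
      rw [← sub_zero (Ad u⁻¹ _), ← h0, ← apply_transporterFun]
      refine hu _ (mem_hull_of_le fun R _ _ g hg => ?_)
      have h0 : extend R (0 : Fun k A k) = 0 := by ext; simp
      rw [apply_transporterFun, h0, sub_zero]
      exact van R _ (lin R g⁻¹ (stab R g hg).2 w hw) i

/-- The transporter condition only depends on the coset. -/
lemma transporter_iff_of_mem_stabilizerComponent (hV : V ≤ lie k A) (he : e ∈ V)
    (hsub : IsSubgroup k I₀)
    (hAd : ∀ (R : Type u) [CommRing R] [Algebra k R] (g : Pt k A R), Mem I₀ g →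
      ∀ X ∈ V, Ad g (extend R X) ∈ scalars R V) {g g' : Pt k A R}
    (hu : Mem (stabilizerComponent I₀ lam V e) (Pt.inv g * g')) (γ : Fun k A k) :
    Ad (Pt.inv g) (extend R γ) - extend R e ∈ scalars R (weightLE lam V 1) ↔
      Ad (Pt.inv g') (extend R γ) - extend R e ∈ scalars R (weightLE lam V 1) := by
  simp only [inv_eq] at *
  constructor
  · intro h
    have := (Ad_mem_of_mem_hull hV he hsub hAd hu h).2
    rwa [← Ad_mul, mul_inv_rev, inv_inv, mul_assoc, mul_inv_cancel, mul_one] at this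
  · intro h
    have := (Ad_mem_of_mem_hull hV he hsub hAd hu h).1
    rwa [← Ad_mul, mul_assoc, mul_inv_cancel, mul_one] at this

end Invariance

/-! ### Dual numbers and derivatives of functions on the group -/

section Tangent

variable {k A R : Type u} [Field k] [CommRing A] [HopfAlgebra k A] [CommRing R] [Algebra k R]

/-- The point `1 + ε X` with values in the dual numbers. -/
noncomputable def expPt (X : Fun k A R) (hX : IsPointDer X) : Pt k A (DualNumber R) :=
  toConv (AlgHom.ofLinearMap
    (((TrivSqZeroExt.inlAlgHom k R R).toLinearMap ∘ₗ (1 : Fun k A R).ofConv) +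
      ((TrivSqZeroExt.inrHom R R).restrictScalars k ∘ₗ X.ofConv))
    (by
      refine TrivSqZeroExt.ext ?_ ?_
      · simp
      · simp [hX.map_one])
    (fun a b => by
      refine TrivSqZeroExt.ext ?_ ?_
      · simp [TrivSqZeroExt.algebraMap_eq_inl']
      · simp [hX a b, TrivSqZeroExt.algebraMap_eq_inl', mul_comm]))

lemma fst_expPt (X : Fun k A R) (hX : IsPointDer X) (a : A) :
    TrivSqZeroExt.fst ((expPt X hX).ofConv a) = (1 : Fun k A R).ofConv a := by
  change TrivSqZeroExt.fst (TrivSqZeroExt.inl (M := R) (algebraMap k R (Coalgebra.counit a)) +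
    TrivSqZeroExt.inr (X.ofConv a)) = _
  simp

lemma snd_expPt (X : Fun k A R) (hX : IsPointDer X) (a : A) :
    TrivSqZeroExt.snd ((expPt X hX).ofConv a) = X.ofConv a := by
  change TrivSqZeroExt.snd (TrivSqZeroExt.inl (M := R) (algebraMap k R (Coalgebra.counit a)) +
    TrivSqZeroExt.inr (X.ofConv a)) = _
  simp

/-- The constant term of a functional with values in the dual numbers. -/
noncomputable def fstFun (Z : Fun k A (DualNumber R)) : Fun k A R :=
  post ((TrivSqZeroExt.fstHom k R R).toLinearMap) Z

/-- The coefficient of `ε` of a functional with values in the dual numbers. -/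
noncomputable def sndFun (Z : Fun k A (DualNumber R)) : Fun k A R :=
  post ((TrivSqZeroExt.sndHom R R).restrictScalars k) Z

lemma fstFun_mul (Y Z : Fun k A (DualNumber R)) : fstFun (Y * Z) = fstFun Y * fstFun Z :=
  post_mul _ _ _

lemma sndFun_mul (Y Z : Fun k A (DualNumber R)) :
    sndFun (Y * Z) = fstFun Y * sndFun Z + sndFun Y * fstFun Z := by
  ext a
  simp [sndFun, fstFun, conv_mul_apply (Coalgebra.Repr.arbitrary k a), ← Finset.sum_add_distrib,
    mul_comm]

lemma fstFun_expPt (X : Fun k A R) (hX : IsPointDer X) :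
    fstFun (Pt.toFun (expPt X hX)) = 1 := Fun.ext (fst_expPt X hX)

lemma sndFun_expPt (X : Fun k A R) (hX : IsPointDer X) :
    sndFun (Pt.toFun (expPt X hX)) = X := Fun.ext (snd_expPt X hX)

lemma fstFun_const (Z : Fun k A R) :
    fstFun (post (TrivSqZeroExt.inlAlgHom k R R).toLinearMap Z) = Z := by
  ext a; simp [fstFun]

lemma sndFun_const (Z : Fun k A R) :
    sndFun (post (TrivSqZeroExt.inlAlgHom k R R).toLinearMap Z) = 0 := by
  ext a; simp [sndFun]

/-- A left translate of a point derivation which is tangent to a closed subgroup is tangent to this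
subgroup. -/
lemma IsSubgroup.mul_tangent_apply {I : Ideal A} (hI : IsSubgroup k I) {g : Pt k A R}
    (hg : Mem I g) {X : Fun k A R} (hX : IsPointDer X) (hXI : ∀ a ∈ I, X.ofConv a = 0)
    {a : A} (ha : a ∈ I) : (Pt.toFun g * X).ofConv a = 0 := by
  -- The product `g (1 + ε X)` is a point of the subgroup over the dual numbers, and its coefficient
  -- of `ε` is `g X`.
  have h1 : Mem I (expPt X hX) := fun a ha => TrivSqZeroExt.ext
    (by rw [fst_expPt]; exact hI.one_mem R a ha) (by rw [snd_expPt, hXI a ha]; rfl)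
  have h2 := hI.mul_mem _ _ _ (mem_map (TrivSqZeroExt.inlAlgHom k R R) hg) h1 a ha
  have h3 := sndFun_mul (Pt.toFun (Pt.map (TrivSqZeroExt.inlAlgHom k R R) g))
    (Pt.toFun (expPt X hX))
  rw [toFun_map, fstFun_const, sndFun_const, sndFun_expPt, zero_mul, add_zero] at h3
  rw [← h3]
  exact congrArg TrivSqZeroExt.snd h2

/-- The derivative of the function `g ↦ (Ad(g⁻¹) γ - e)(a)`. -/
lemma mul_apply_transporterFun (g : Pt k A R) {X : Fun k A R} (hX : IsPointDer X)
    (γ e : Fun k A k) (a : A) : (Pt.toFun g * X).ofConv (transporterFun γ e a) =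
      (Ad g⁻¹ (extend R γ) * X - X * Ad g⁻¹ (extend R γ)).ofConv a := by
  let ι := TrivSqZeroExt.inlAlgHom k R R
  let p := Pt.map ι g * expPt X hX
  have h3 := sndFun_mul (Pt.toFun (Pt.map ι g)) (Pt.toFun (expPt X hX))
  rw [toFun_map, fstFun_const, sndFun_const, sndFun_expPt, zero_mul, add_zero] at h3
  have h4 : (Pt.toFun g * X).ofConv (transporterFun γ e a) =
      TrivSqZeroExt.snd (p.ofConv (transporterFun γ e a)) :=
    (congrArg (fun Y : Fun k A R => Y.ofConv (transporterFun γ e a)) h3).symm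
  set U := Ad p⁻¹ (extend (DualNumber R) γ) with hU
  have h5 : TrivSqZeroExt.snd (p.ofConv (transporterFun γ e a)) = (sndFun U).ofConv a := by
    rw [apply_transporterFun, ofConv_sub, LinearMap.sub_apply, TrivSqZeroExt.snd_sub]
    have : TrivSqZeroExt.snd ((extend (DualNumber R) e).ofConv a) = 0 := by
      rw [extend_apply]; rfl
    rw [this, sub_zero]; rfl
  set Z := Ad g⁻¹ (extend R γ) with hZ
  -- With `Z = Ad(g⁻¹) γ` this reads `(1 + ε X) U = Z (1 + ε X)`. Comparing coefficients of `ε`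
  -- gives the derivative of `U` as `Z X - X Z`, without computing the inverse of `1 + ε X`.
  have h6 : Pt.toFun (expPt X hX) * U = post ι.toLinearMap Z * Pt.toFun (expPt X hX) := by
    have : U = Ad (expPt X hX)⁻¹ (post ι.toLinearMap Z) := by
      rw [hU, hZ, mul_inv_rev, Ad_mul, ← map_inv', ← post_extend ι γ, Ad_map]
    rw [this, Ad_def, inv_inv, ← mul_assoc, ← mul_assoc, toFun_mul_inv, one_mul]
  have h7 := congrArg fstFun h6
  rw [fstFun_mul, fstFun_mul, fstFun_expPt, fstFun_const, one_mul, mul_one] at h7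
  have h8 := congrArg sndFun h6
  rw [sndFun_mul, sndFun_mul, fstFun_expPt, sndFun_expPt, fstFun_const, sndFun_const, one_mul,
    zero_mul, add_zero, h7, ← eq_sub_iff_add_eq] at h8
  rw [h4, h5, h8]

end Tangent

/-! ### Equations of the transporter on the group -/

section Equations

open LaurentPolynomial

variable {k K A : Type u} [Field k] [Field K] [Algebra k K] [CommRing A] [HopfAlgebra k A]
  {θ : (K ⊗[k] A) ≃ₐc[K] (K ⊗[k] A)} {I₀ : Ideal A} {lam : A →ₐc[k] k[T;T⁻¹]}
  [IsAlgClosed K] [Algebra.FiniteType k A] {ζ : K} {n : ℤ} {e h f : Fun k A k}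

/-- The transporter is cut out by functions whose differentials along the transporter are linearly
independent. -/
lemma IsAssociated.exists_equations (hlam : IsAssociated θ ζ n I₀ lam e h f) (hζ : ζ ≠ 0)
    (hI₀ : IsFixedComponent θ I₀) {γ : Fun k A k} (hγ : γ ∈ eigen θ (ζ ^ n)) :
    ∃ (d : ℕ) (F : Fin d → A), Module.finrank k (eigen θ (ζ ^ n)) =
      Module.finrank k (weightLE lam (eigen θ (ζ ^ n)) 1) + d ∧
    (∀ (R : Type u) [CommRing R] [Algebra k R] (g : Pt k A R), Mem I₀ g →
      (Ad (Pt.inv g) (extend R γ) - extend R e ∈ scalars R (weightLE lam (eigen θ (ζ ^ n)) 1) ↔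
        ∀ i, g.ofConv (F i) = 0)) ∧
    ∀ (R : Type u) [CommRing R] [Algebra k R] (g : Pt k A R), Mem I₀ g →
      (∀ i, g.ofConv (F i) = 0) → ∀ l, ∃ D : A →ₗ[k] R,
        (∀ a b, D (a * b) = g.ofConv a * D b + g.ofConv b * D a) ∧ (∀ a ∈ I₀, D a = 0) ∧
        ∀ i, D (F i) = if l = i then 1 else 0 := by
  have hV := eigen_le_lie θ (ζ ^ n)
  have hW : weightLE lam (eigen θ (ζ ^ n)) 1 ≤ eigen θ (ζ ^ n) := weightLE_le _ 1
  have hsub := isSubgroup_of_isFixedComponent hI₀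
  obtain ⟨d, a, v, hd, hv, hva, ha⟩ := exists_coordinates hV hW
  have h1 : ∀ (R : Type u) [CommRing R] [Algebra k R] (g : Pt k A R), Mem I₀ g →
      (Ad (Pt.inv g) (extend R γ) - extend R e ∈ scalars R (weightLE lam (eigen θ (ζ ^ n)) 1) ↔
        ∀ i, g.ofConv (transporterFun γ e (a i)) = 0) := by
    intro R _ _ g hg
    simp only [apply_transporterFun]
    exact ha R _ (sub_mem (Ad_mem_scalars_eigen hI₀ (hsub.inv_mem _ _ hg) hγ)
      (extend_mem_scalars hlam.e_mem))
  refine ⟨d, fun i => transporterFun γ e (a i), hd, h1, fun R _ _ g hg hF l => ?_⟩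
  -- The derivative along `g X` is the negative of the bracket of `X` with `Ad(g⁻¹) γ`. So solving
  -- for `-v l` modulo `W` yields the value `1` on the function with index `l` and `0` on the
  -- others.
  obtain ⟨X, hX, hXl⟩ := hlam.exists_commutator_sub_mem hζ hI₀ ((h1 R g hg).2 hF)
    (neg_mem (extend_mem_scalars (R := R) (hv l)))
  rw [add_sub_cancel, sub_neg_eq_add] at hXl
  have hXd : IsPointDer X := IsPointDer.of_mem_scalars (eigen_le_lie θ 1) hX
  refine ⟨(Pt.toFun g * X).ofConv, fun b c => ?_, fun b hb => ?_, fun i => ?_⟩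
  · simpa using conj_mul_apply hXd g 1 b c
  · exact hsub.mul_tangent_apply hg hXd (fun a ha => scalars_eigen_one_apply hI₀ hX ha) hb
  · rw [mul_apply_transporterFun g hXd]
    have h2 := smul_extend_apply (fun X hX => by
      have := (ha k _ (extend_mem_scalars (hW hX))).1 (extend_mem_scalars hX) i
      simpa using this) hXl
    rw [ofConv_add, LinearMap.add_apply, extend_apply, hva, ← eq_neg_iff_add_eq_zero] at h2
    rw [← neg_sub, ofConv_neg, LinearMap.neg_apply]
    simp only [inv_eq] at h2
    rw [h2, neg_neg]
    split_ifs <;> simp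

end Equations

/-! ### Jacobian criterion and smooth maps to affine space -/

section Jacobian

open KaehlerDifferential IsLocalRing

/-- A Jacobian criterion: elements of a smooth local algebra with linearly independent differentials
at the closed point define a formally smooth morphism to affine space. -/
lemma formallySmooth_mvPolynomial {k L κ : Type u} [Field k] [CommRing L] [Algebra k L]
    [IsLocalRing L] [Algebra.FormallySmooth k L] [Algebra.EssFiniteType k L] [Field κ] [Algebra L κ]
    [IsLocalHom (algebraMap L κ)] {d : ℕ}
    [Algebra (MvPolynomial (Fin d) k) L] [IsScalarTower k (MvPolynomial (Fin d) k) L]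
    (ψ : Fin d → Ω[L⁄k] →ₗ[L] κ)
    (hψ : (Matrix.of fun l j =>
      ψ l (D k L (algebraMap (MvPolynomial (Fin d) k) L (MvPolynomial.X j)))).det ≠ 0) :
    Algebra.FormallySmooth (MvPolynomial (Fin d) k) L := by
  let P := MvPolynomial (Fin d) k
  let φ : L ⊗[P] Ω[P⁄k] →ₗ[L] Ω[L⁄k] := mapBaseChange k P L
  let b := (mvPolynomialBasis k (Fin d)).baseChange L
  have : Module.Finite L (L ⊗[P] Ω[P⁄k]) := .of_basis b
  have : Module.Finite L Ω[L⁄k] := inferInstance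
  have : Module.Free L Ω[L⁄k] := Module.free_of_flat_of_isLocalRing
  -- A map of finite free modules over a local ring splits if it is injective over the residue
  -- field. There a kernel vector is annihilated by the matrix of the `ψ l`, which is invertible
  -- over `κ`.
  obtain ⟨φ', hφ'⟩ : ∃ φ', φ' ∘ₗ φ = LinearMap.id := by
    rw [split_injective_iff_lTensor_residueField_injective, ← LinearMap.ker_eq_bot,
      LinearMap.ker_eq_bot']
    let _ : Algebra (ResidueField L) κ := (ResidueField.lift (algebraMap L κ)).toAlgebra
    have : IsScalarTower L (ResidueField L) κ := .of_algebraMap_eq fun _ => rfl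
    let bb := b.baseChange (ResidueField L)
    intro x hx
    have hxs := bb.sum_repr x
    have hm : ∀ j, φ (1 ⊗ₜ D k P (MvPolynomial.X j)) =
        D k L (algebraMap P L (MvPolynomial.X j)) := fun j => by
      rw [mapBaseChange_tmul, one_smul, map_D]
    have h1 : ∀ l, ∑ j, algebraMap _ κ (bb.repr x j) *
        ψ l (D k L (algebraMap (MvPolynomial (Fin d) k) L (MvPolynomial.X j))) = 0 := by
      intro l
      have h2 := congrArg ((ψ l).liftBaseChange (ResidueField L)) hx
      rw [← hxs, map_sum, map_sum, map_zero] at h2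
      rw [← h2]
      refine Finset.sum_congr rfl fun j _ => ?_
      have hb : bb j = 1 ⊗ₜ[L] (1 ⊗ₜ[P] D k P (MvPolynomial.X j)) := by
        simp [bb, b, mvPolynomialBasis_apply, P]
      rw [hb, TensorProduct.smul_tmul', LinearMap.lTensor_tmul, hm,
        LinearMap.liftBaseChange_tmul, smul_eq_mul, mul_one, Algebra.smul_def]
    have h3 : (fun j => algebraMap _ κ (bb.repr x j)) = 0 := by
      refine Matrix.eq_zero_of_mulVec_eq_zero hψ (funext fun l => ?_)
      rw [Pi.zero_apply, ← h1 l, Matrix.mulVec, dotProduct]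
      exact Finset.sum_congr rfl fun j _ => mul_comm _ _
    rw [← hxs]
    refine Finset.sum_eq_zero fun j _ => ?_
    rw [(map_eq_zero _).1 (congrFun h3 j), zero_smul]
  have hinj : Function.Injective φ := Function.HasLeftInverse.injective
    ⟨φ', LinearMap.congr_fun hφ'⟩
  -- The retraction makes `Ω[L⁄P]` a direct summand of the projective module `Ω[L⁄k]`. Moreover the
  -- boundary map of the first cotangent homology lands in the kernel of `φ`, which is zero, so this
  -- homology comes from that of `L` over `k`, which vanishes.
  constructor
  · have h1 := (exact_mapBaseChange_map k P L).split_tfae'.out 1 0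
    obtain ⟨-, s, hs⟩ := h1.1 ⟨map_surjective k P L, φ', hφ'⟩
    exact .of_split s _ hs
  · refine subsingleton_of_forall_eq 0 fun x => ?_
    have h1 : Algebra.H1Cotangent.δ k P L x = 0 := hinj <| by
      rw [map_zero]; exact (Algebra.H1Cotangent.exact_δ_mapBaseChange k P L).apply_apply_eq_zero x
    obtain ⟨y, rfl⟩ := (Algebra.H1Cotangent.exact_map_δ k P L x).1 h1
    rw [Subsingleton.elim y 0, map_zero]

/-- Elements of a smooth algebra whose differentials are linearly independent at a prime ideal
define, near this prime ideal, a smooth morphism to affine space. -/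
lemma exists_smooth_away {k O κ : Type u} [Field k] [CommRing O] [Algebra k O]
    [Algebra.Smooth k O] (y : Ideal O) [y.IsPrime] [Field κ] [Algebra k κ] [Algebra O κ]
    [IsScalarTower k O κ] (hy : RingHom.ker (algebraMap O κ) = y) {d : ℕ}
    [Algebra (MvPolynomial (Fin d) k) O] [IsScalarTower k (MvPolynomial (Fin d) k) O]
    (D : Fin d → Derivation k O κ)
    (hD : (Matrix.of fun l j =>
      D l (algebraMap (MvPolynomial (Fin d) k) O (MvPolynomial.X j))).det ≠ 0)
    {h₁ : O} (hh₁ : h₁ ∉ y) :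
    ∃ h ∉ y, h₁ ∣ h ∧ Algebra.Smooth (MvPolynomial (Fin d) k) (Localization.Away h) := by
  let L := Localization.AtPrime y
  have hunit : ∀ x : y.primeCompl, IsUnit (algebraMap O κ x) := fun x => by
    rw [isUnit_iff_ne_zero]
    intro h0
    have h1 : (x : O) ∈ RingHom.ker (algebraMap O κ) := h0
    rw [hy] at h1
    exact x.2 h1
  let _ : Algebra L κ := (IsLocalization.lift hunit).toAlgebra
  have : IsScalarTower O L κ := .of_algebraMap_eq fun x => (IsLocalization.lift_eq hunit x).symm
  have : IsLocalHom (algebraMap L κ) := by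
    refine ⟨fun x hx => ?_⟩
    obtain ⟨a, s, rfl⟩ := IsLocalization.exists_mk'_eq y.primeCompl x
    rw [IsLocalization.AtPrime.isUnit_mk'_iff L y]
    intro ha
    have ha' : algebraMap O κ a = 0 := by rw [← RingHom.mem_ker, hy]; exact ha
    rw [RingHom.algebraMap_toAlgebra, IsLocalization.lift_mk', isUnit_iff_ne_zero, ha',
      zero_mul] at hx
    exact hx rfl
  have : Algebra.FormallyEtale O L := .of_isLocalization y.primeCompl
  have : Algebra.FormallySmooth k L := .comp k O L
  have : IsScalarTower k L κ := .of_algebraMap_eq fun x => by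
    rw [IsScalarTower.algebraMap_apply k O κ, IsScalarTower.algebraMap_apply k O L,
      ← IsScalarTower.algebraMap_apply O L κ]
  have : IsScalarTower k (MvPolynomial (Fin d) k) L := .of_algebraMap_eq fun x => by
    rw [IsScalarTower.algebraMap_apply k O L,
      IsScalarTower.algebraMap_apply (MvPolynomial (Fin d) k) O L,
      ← IsScalarTower.algebraMap_apply k (MvPolynomial (Fin d) k) O]
  -- Localization is formally étale, so the derivations of `O` induce linear forms on `Ω[L⁄k]` with
  -- the same values on the coordinates.
  have hs : Algebra.IsSmoothAt (MvPolynomial (Fin d) k) y := by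
    refine formallySmooth_mvPolynomial (κ := κ) (fun l =>
      ((D l).liftKaehlerDifferential.liftBaseChange L) ∘ₗ
        (tensorKaehlerEquivOfFormallyEtale k O L).symm.toLinearMap) ?_
    convert hD using 4 with l
    funext j
    rw [IsScalarTower.algebraMap_apply (MvPolynomial (Fin d) k) O L, LinearMap.comp_apply,
      LinearEquiv.coe_coe, tensorKaehlerEquivOfFormallyEtale_symm_D_algebraMap,
      LinearMap.liftBaseChange_tmul, one_smul, Derivation.liftKaehlerDifferential_comp_D]
  have : Algebra.FinitePresentation (MvPolynomial (Fin d) k) O :=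
    Algebra.FinitePresentation.of_restrict_scalars_finitePresentation k _ O
  obtain ⟨h₂, hh₂, hsm⟩ := hs.exists_notMem_smooth
  refine ⟨h₁ * h₂, fun hm => (‹y.IsPrime›.mem_or_mem hm).elim hh₁ hh₂, dvd_mul_right _ _, ?_⟩
  rw [← Algebra.basicOpen_subset_smoothLocus_iff_smooth] at hsm ⊢
  refine subset_trans ?_ hsm
  rw [PrimeSpectrum.basicOpen_mul]
  exact Set.inter_subset_right

/-- The coordinates form a regular sequence in a polynomial ring. -/
lemma isWeaklyRegular_X {k : Type u} [Field k] (d : ℕ) :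
    RingTheory.Sequence.IsWeaklyRegular (MvPolynomial (Fin d) k)
      (List.ofFn fun i => (MvPolynomial.X i : MvPolynomial (Fin d) k)) := by
  refine ⟨fun i hi => ?_⟩
  rw [List.length_ofFn] at hi
  have hspan : Ideal.ofList (List.take i (List.ofFn fun i => (MvPolynomial.X i :
      MvPolynomial (Fin d) k))) • (⊤ : Submodule (MvPolynomial (Fin d) k) _) =
      Ideal.span (MvPolynomial.X '' {j : Fin d | j.1 < i}) := by
    rw [smul_eq_mul, Ideal.mul_top]
    refine congrArg Ideal.span (Set.ext fun x => ?_)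
    simp only [Set.mem_ofPred_eq, List.mem_take_iff_getElem, Set.mem_image, List.length_ofFn,
      List.getElem_ofFn]
    constructor
    · rintro ⟨j, hj, rfl⟩
      exact ⟨⟨j, by omega⟩, (by omega : j < i), rfl⟩
    · rintro ⟨j, hj, rfl⟩
      exact ⟨j, lt_min hj j.2, rfl⟩
  rw [hspan]
  simp only [List.getElem_ofFn]
  rw [isSMulRegular_iff_right_eq_zero_of_smul]
  intro x
  obtain ⟨p, rfl⟩ := Ideal.Quotient.mk_surjective x
  intro hx
  have hx' : MvPolynomial.X (⟨i, hi⟩ : Fin d) * p ∈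
      Ideal.span (MvPolynomial.X '' {j : Fin d | j.1 < i}) := Ideal.Quotient.eq_zero_iff_mem.1 hx
  refine Ideal.Quotient.eq_zero_iff_mem.2 ?_
  -- Membership in an ideal generated by variables is tested on monomials, and multiplication by the
  -- variable with index `i` does not change the exponents of those with smaller index.
  rw [MvPolynomial.mem_ideal_span_X_image] at hx' ⊢
  intro m hm
  obtain ⟨j, hj, hj0⟩ := hx' (Finsupp.single ⟨i, hi⟩ 1 + m) (by
    rw [MvPolynomial.mem_support_iff, MvPolynomial.coeff_X_mul]
    exact MvPolynomial.mem_support_iff.1 hm)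
  refine ⟨j, hj, ?_⟩
  rwa [Finsupp.add_apply, Finsupp.single_eq_of_ne, zero_add] at hj0
  rintro rfl
  simp at hj

/-- The fibre over the origin of a smooth morphism to affine space is smooth, and is cut out by a
weakly regular sequence. -/
lemma isWeaklyRegular_and_smooth_quotient {k S : Type u} [Field k] [CommRing S] [Algebra k S]
    {d : ℕ} [Algebra (MvPolynomial (Fin d) k) S] [IsScalarTower k (MvPolynomial (Fin d) k) S]
    [Algebra.Smooth (MvPolynomial (Fin d) k) S] :
    RingTheory.Sequence.IsWeaklyRegular S
      (List.ofFn fun i => algebraMap (MvPolynomial (Fin d) k) S (MvPolynomial.X i)) ∧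
    Algebra.Smooth k (S ⧸ Ideal.span (Set.range fun i : Fin d =>
      algebraMap (MvPolynomial (Fin d) k) S (MvPolynomial.X i))) := by
  let P := MvPolynomial (Fin d) k
  have : Module.Flat P S := inferInstance
  constructor
  · have h1 := RingTheory.Sequence.IsWeaklyRegular.of_flat (S := S) (isWeaklyRegular_X (k := k) d)
    rwa [List.map_ofFn] at h1
  · let I : Ideal P := Ideal.span (Set.range fun i : Fin d => (MvPolynomial.X i : P))
    have hI : Ideal.span (Set.range fun i : Fin d =>
        algebraMap (MvPolynomial (Fin d) k) S (MvPolynomial.X i)) = I.map (algebraMap P S) := by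
      rw [Ideal.map_span, ← Set.range_comp]; rfl
    rw [hI]
    have hI0 : I ≤ RingHom.ker (MvPolynomial.constantCoeff (σ := Fin d) (R := k)) := by
      refine Ideal.span_le.2 ?_
      rintro _ ⟨i, rfl⟩
      exact MvPolynomial.constantCoeff_X _ i
    have : Nontrivial (P ⧸ I) := Ideal.Quotient.nontrivial_iff.2
      (ne_top_of_le_ne_top (RingHom.ker_ne_top _) hI0)
    have hbij : Function.Bijective (Algebra.ofId k (P ⧸ I)) := by
      refine ⟨(algebraMap k (P ⧸ I)).injective, fun x => ?_⟩
      obtain ⟨p, rfl⟩ := Ideal.Quotient.mk_surjective x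
      induction p using MvPolynomial.induction_on with
      | C a => exact ⟨a, rfl⟩
      | add p q hp hq =>
        obtain ⟨a, ha⟩ := hp
        obtain ⟨b, hb⟩ := hq
        exact ⟨a + b, by rw [map_add, ha, hb, map_add]⟩
      | mul_X p i =>
        refine ⟨0, ?_⟩
        rw [map_zero, eq_comm, Ideal.Quotient.eq_zero_iff_mem]
        exact Ideal.mul_mem_left _ _ (Ideal.subset_span ⟨i, rfl⟩)
    have : Algebra.Smooth k (P ⧸ I) := .of_equiv (AlgEquiv.ofBijective _ hbij)
    have : Algebra.Smooth (P ⧸ I) ((P ⧸ I) ⊗[P] S) := inferInstance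
    have : Algebra.Smooth (P ⧸ I) (S ⧸ I.map (algebraMap P S)) :=
      .of_equiv (A := (P ⧸ I) ⊗[P] S) (Algebra.TensorProduct.quotIdealMapEquivQuotTensor S I).symm
    have : IsScalarTower k (P ⧸ I) (S ⧸ I.map (algebraMap P S)) := by
      refine @IsScalarTower.of_algebraMap_eq k (P ⧸ I) (S ⧸ I.map (algebraMap P S)) _ _ _ _ _ _
        fun x => ?_
      change Ideal.Quotient.mk _ (algebraMap k S x) =
        Ideal.Quotient.mk _ (algebraMap P S (algebraMap k P x))
      rw [← IsScalarTower.algebraMap_apply]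
    exact .comp k (P ⧸ I) _

end Jacobian

/-! ### Descent of equations along a flat homomorphism -/

section RegularSequence

/-- Membership in an ideal near a prime can be checked after a flat base change. -/
lemma exists_notMem_mul_mem {O C : Type u} [CommRing O] [CommRing C] [Algebra O C]
    [Module.Flat O C] (P : Ideal C) [P.IsPrime] (I : Ideal O) {t : O} {c : C} (hc : c ∉ P)
    (h : c * algebraMap O C t ∈ I.map (algebraMap O C)) :
    ∃ m : O, algebraMap O C m ∉ P ∧ m * t ∈ I := by
  let := Localization.AtPrime.algebraOfLiesOver (P.under O) P
  have : IsLocalHom (algebraMap (Localization.AtPrime <| P.under O) (Localization.AtPrime P)) := by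
    rw [RingHom.algebraMap_toAlgebra]
    exact Localization.isLocalHom_localRingHom (P.under O) P (algebraMap O C) Ideal.LiesOver.over
  -- A flat local homomorphism is faithfully flat, so an ideal of the local ring of `O` is the
  -- contraction of its extension.
  have : Module.FaithfullyFlat (Localization.AtPrime (P.under O)) (Localization.AtPrime P) :=
    Module.FaithfullyFlat.of_flat_of_isLocalHom
  let Oy := Localization.AtPrime (P.under O)
  let CP := Localization.AtPrime P
  have h1 : algebraMap O Oy t ∈ I.map (algebraMap O Oy) := by
    rw [← Ideal.comap_map_eq_self_of_faithfullyFlat (B := CP) (I.map (algebraMap O Oy)),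
      Ideal.mem_comap, Ideal.map_map, ← IsScalarTower.algebraMap_apply,
      ← IsScalarTower.algebraMap_eq, IsScalarTower.algebraMap_eq O C CP, ← Ideal.map_map,
      RingHom.comp_apply,
      IsLocalization.algebraMap_mem_map_algebraMap_iff P.primeCompl]
    exact ⟨c, hc, h⟩
  rw [IsLocalization.algebraMap_mem_map_algebraMap_iff (P.under O).primeCompl] at h1
  obtain ⟨m, hm, hmt⟩ := h1
  exact ⟨m, hm, hmt⟩

/-- The product of the multipliers of finitely many generators serves for the whole ideal, and it
avoids `y` because `y` is prime. -/
lemma exists_notMem_forall_mul_mem {O : Type u} [CommRing O] (y : Ideal O) [y.IsPrime]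
    {I J : Ideal O} (hJ : J.FG) (h : ∀ t ∈ J, ∃ m ∉ y, m * t ∈ I) :
    ∃ m ∉ y, ∀ t ∈ J, m * t ∈ I := by
  classical
  obtain ⟨T, rfl⟩ := hJ
  choose! m hm hmt using h
  refine ⟨∏ t ∈ T, m t, fun hmem => ?_, fun t ht => ?_⟩
  · obtain ⟨t, ht, hty⟩ := (Ideal.IsPrime.prod_mem_iff).1 hmem
    exact hm t (Ideal.subset_span ht) hty
  · induction ht using Submodule.span_induction with
    | mem x hx =>
      rw [← Finset.mul_prod_erase T m hx, mul_comm (m x), mul_assoc]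
      exact I.mul_mem_left _ (hmt x (Ideal.subset_span hx))
    | zero => rw [mul_zero]; exact zero_mem _
    | add x y _ _ hx hy => rw [mul_add]; exact add_mem hx hy
    | smul r x _ hx => rw [smul_eq_mul, mul_left_comm]; exact I.mul_mem_left _ hx

/-- An ideal in a smooth algebra which becomes, after a flat base change, generated by functions
with linearly independent differentials at a point, is near this point generated by a regular
sequence, and defines a smooth closed subscheme. -/
theorem exists_regular_sequence {k O C κ : Type u} [Field k] [CommRing O] [Algebra k O]
    [Algebra.Smooth k O] [CommRing C] [Algebra O C] [Module.Flat O C] [Algebra k C]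
    [IsScalarTower k O C] [Field κ] [Algebra k κ] [Algebra O κ] [Algebra C κ] [IsScalarTower O C κ]
    [IsScalarTower k O κ] [IsScalarTower k C κ] {d : ℕ} {J : Ideal O} {F : Fin d → C}
    (hJF : J.map (algebraMap O C) = Ideal.span (Set.range F))
    (hF : ∀ i, algebraMap C κ (F i) = 0) (D : Fin d → C →ₗ[k] κ)
    (hD : ∀ l a b, D l (a * b) = algebraMap C κ a * D l b + algebraMap C κ b * D l a)
    (hDF : ∀ l i, D l (F i) = if l = i then 1 else 0) :
    ∃ (h : O) (s : Fin d → O), algebraMap O κ h ≠ 0 ∧ (∀ j, s j ∈ J) ∧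
      ∀ (S : Type u) [CommRing S] [Algebra O S] [Algebra k S] [IsScalarTower k O S]
        [IsLocalization.Away h S],
        RingTheory.Sequence.IsWeaklyRegular S (List.ofFn fun j => algebraMap O S (s j)) ∧
        J.map (algebraMap O S) = Ideal.span (Set.range fun j => algebraMap O S (s j)) ∧
        Algebra.Smooth k (S ⧸ J.map (algebraMap O S)) := by
  have hker : ∀ x ∈ J.map (algebraMap O C), algebraMap C κ x = 0 := by
    intro x hx
    rw [hJF] at hx
    have : Ideal.span (Set.range F) ≤ RingHom.ker (algebraMap C κ) :=
      Ideal.span_le.2 (by rintro _ ⟨i, rfl⟩; exact hF i)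
    exact this hx
  let vec : O → Fin d → κ := fun x l => D l (algebraMap O C x)
  -- The elements of `J C` vanish at the point, so on them the derivations are linear over `C`.
  -- Hence the vectors of derivatives of `J` already span those of `J C`, among which are the
  -- standard basis vectors, given by the `F i`.
  have hspan : Submodule.span κ (vec '' J) = ⊤ := by
    have h1 : ∀ c ∈ J.map (algebraMap O C),
        (fun l => D l c) ∈ Submodule.span κ (vec '' (J : Set O)) := by
      intro c hc
      induction hc using Submodule.span_induction with
      | mem x hx =>
        obtain ⟨t, ht, rfl⟩ := hx
        exact Submodule.subset_span ⟨t, ht, rfl⟩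
      | zero => simp only [map_zero]; exact zero_mem _
      | add x y _ _ hx hy => simp only [map_add]; exact add_mem hx hy
      | smul r x hx' hx =>
        have h0 : algebraMap C κ x = 0 := hker x hx'
        simp only [smul_eq_mul, hD, h0, zero_mul, add_zero]
        exact Submodule.smul_mem _ (algebraMap C κ r) hx
    rw [eq_top_iff, ← (Pi.basisFun κ (Fin d)).span_eq, Submodule.span_le]
    rintro _ ⟨i, rfl⟩
    have h2 := h1 (F i) (hJF ▸ Ideal.subset_span ⟨i, rfl⟩)
    have h3 : Pi.basisFun κ (Fin d) i = fun l => D l (F i) := funext fun l => by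
      rw [hDF, Pi.basisFun_apply, Pi.single_apply]
    rw [h3]
    exact h2
  obtain ⟨s, hsJ, hs⟩ : ∃ s : Fin d → O, (∀ j, s j ∈ J) ∧
      (Matrix.of fun l j => D l (algebraMap O C (s j))).det ≠ 0 := by
    obtain ⟨f, hf, -, hli⟩ := Submodule.exists_fun_fin_finrank_span_eq κ (vec '' (J : Set O))
    have hd : Module.finrank κ (Submodule.span κ (vec '' (J : Set O))) = d := by
      rw [hspan, finrank_top, Module.finrank_fin_fun]
    choose g hg hgf using hf
    refine ⟨fun j => g (Fin.cast hd.symm j), fun j => hg _, ?_⟩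
    rw [← isUnit_iff_ne_zero, ← Matrix.isUnit_iff_isUnit_det,
      ← Matrix.linearIndependent_cols_iff_isUnit]
    have h1 : (Matrix.of fun l j => D l (algebraMap O C (g (Fin.cast hd.symm j)))).col =
        f ∘ Fin.cast hd.symm := funext fun j => hgf (Fin.cast hd.symm j)
    rw [h1]
    exact hli.comp (Fin.cast hd.symm) (Fin.cast_injective _)
  let y : Ideal O := RingHom.ker (algebraMap O κ)
  let P : Ideal C := RingHom.ker (algebraMap C κ)
  have : y.IsPrime := RingHom.ker_isPrime _
  have : P.IsPrime := RingHom.ker_isPrime _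
  have hyP : ∀ m : O, algebraMap O C m ∉ P → m ∉ y := fun m hm hmy => hm <| by
    rw [RingHom.mem_ker, ← IsScalarTower.algebraMap_apply]; exact hmy
  let I : Ideal O := Ideal.span (Set.range s)
  -- Write `s = M F` over `C`. At the point the transpose of `M` is the matrix of derivatives of
  -- `s`, so `det M` does not vanish there, and by Cramer's rule `det M` multiplies every `F i` into
  -- the ideal generated by `s`.
  obtain ⟨c, hcP, hc⟩ : ∃ c ∉ P, ∀ x ∈ J.map (algebraMap O C), c * x ∈ I.map (algebraMap O C) := by
    have ha : ∀ j, ∃ a : Fin d → C, ∑ i, a i * F i = algebraMap O C (s j) := fun j =>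
      (Ideal.mem_span_range_iff_exists_fun).1 (hJF ▸ Ideal.mem_map_of_mem _ (hsJ j))
    choose a ha using ha
    let M : Matrix (Fin d) (Fin d) C := Matrix.of a
    refine ⟨M.det, fun hmem => hs ?_, ?_⟩
    · have h1 : (Matrix.of fun l j => D l (algebraMap O C (s j))) =
          ((algebraMap C κ).mapMatrix M).transpose := by
        ext l j
        rw [Matrix.of_apply, ← ha, map_sum, Matrix.transpose_apply, RingHom.mapMatrix_apply,
          Matrix.map_apply]
        simp only [hD, hF, zero_mul, add_zero, hDF, mul_ite, mul_one, mul_zero,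
          Finset.sum_ite_eq, Finset.mem_univ, if_true]
        rfl
      rw [h1, Matrix.det_transpose, ← RingHom.map_det]
      exact hmem
    · intro x hx
      rw [hJF] at hx
      induction hx using Submodule.span_induction with
      | mem x hx =>
        obtain ⟨i, rfl⟩ := hx
        have h1 : M.mulVec F = fun j => algebraMap O C (s j) := funext fun j => ha j
        have h2 : M.det * F i = M.adjugate.mulVec (fun j => algebraMap O C (s j)) i := by
          rw [← h1, Matrix.mulVec_mulVec, Matrix.adjugate_mul, Matrix.smul_mulVec,
            Matrix.one_mulVec]
          rfl
        rw [h2, Matrix.mulVec, dotProduct]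
        exact sum_mem fun j _ => Ideal.mul_mem_left _ _
          (Ideal.mem_map_of_mem (algebraMap O C) (Ideal.subset_span (Set.mem_range_self j) : s j ∈ I))
      | zero => rw [mul_zero]; exact zero_mem _
      | add x y _ _ hx hy => rw [mul_add]; exact add_mem hx hy
      | smul r x _ hx => rw [smul_eq_mul, mul_left_comm]; exact Ideal.mul_mem_left _ _ hx
  have : IsNoetherianRing O := Algebra.FiniteType.isNoetherianRing k O
  -- Flatness brings the inclusion down to `O`: after inverting `h₁`, the `s j` generate `J`.
  obtain ⟨h₁, hh₁, hh₁J⟩ := exists_notMem_forall_mul_mem y (I := I) (IsNoetherian.noetherian J)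
    fun t ht => by
      obtain ⟨m, hm, hmt⟩ := exists_notMem_mul_mem P I hcP (hc _ (Ideal.mem_map_of_mem _ ht))
      exact ⟨m, hyP m hm, hmt⟩
  let _ : Algebra (MvPolynomial (Fin d) k) O := (MvPolynomial.aeval s).toAlgebra
  have hX : ∀ j, algebraMap (MvPolynomial (Fin d) k) O (MvPolynomial.X j) = s j := fun j =>
    MvPolynomial.aeval_X s j
  have : IsScalarTower k (MvPolynomial (Fin d) k) O := .of_algebraMap_eq fun x =>
    ((MvPolynomial.aeval s).commutes x).symm
  let DO : Fin d → Derivation k O κ := fun l =>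
    { toLinearMap := D l ∘ₗ (IsScalarTower.toAlgHom k O C).toLinearMap
      map_one_eq_zero' := by
        have := hD l 1 1
        simpa using this
      leibniz' := fun a b => by
        simp [hD, Algebra.smul_def, ← IsScalarTower.algebraMap_apply] }
  -- Taking `h` to be a multiple of `h₁` makes two things hold after inverting `h`: the `s j`
  -- generate `J`, and they define a smooth map to affine space.
  obtain ⟨h, hhy, hdvd, hsm⟩ := exists_smooth_away (κ := κ) y rfl DO (by
    simp only [hX]; exact hs) hh₁
  refine ⟨h, s, hhy, hsJ, fun S _ _ _ _ _ => ?_⟩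
  let _ : Algebra (MvPolynomial (Fin d) k) S :=
    ((algebraMap O S).comp (algebraMap (MvPolynomial (Fin d) k) O)).toAlgebra
  have : IsScalarTower (MvPolynomial (Fin d) k) O S := .of_algebraMap_eq fun _ => rfl
  have : IsScalarTower k (MvPolynomial (Fin d) k) S := .of_algebraMap_eq fun x => by
    rw [IsScalarTower.algebraMap_apply k O S,
      IsScalarTower.algebraMap_apply (MvPolynomial (Fin d) k) O S,
      ← IsScalarTower.algebraMap_apply k (MvPolynomial (Fin d) k) O]
  have : Algebra.Smooth (MvPolynomial (Fin d) k) S := .of_equiv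
    ((IsLocalization.algEquiv (Submonoid.powers h) (Localization.Away h) S).restrictScalars
      (MvPolynomial (Fin d) k))
  have hX' : ∀ j, algebraMap (MvPolynomial (Fin d) k) S (MvPolynomial.X j) =
      algebraMap O S (s j) := fun j => by
    rw [IsScalarTower.algebraMap_apply (MvPolynomial (Fin d) k) O S, hX]
  have key := isWeaklyRegular_and_smooth_quotient (k := k) (S := S) (d := d)
  rw [funext hX'] at key
  have hJS : J.map (algebraMap O S) = Ideal.span (Set.range fun j => algebraMap O S (s j)) := by
    refine le_antisymm (Ideal.map_le_iff_le_comap.2 fun t ht => ?_) (Ideal.span_le.2 ?_)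
    · have h1 : algebraMap O S (h₁ * t) ∈ I.map (algebraMap O S) :=
        Ideal.mem_map_of_mem _ (hh₁J t ht)
      have h2 : IsUnit (algebraMap O S h₁) := isUnit_of_dvd_unit (map_dvd _ hdvd)
        (IsLocalization.Away.algebraMap_isUnit h)
      rw [map_mul, Ideal.unit_mul_mem_iff_mem _ h2, Ideal.map_span, ← Set.range_comp] at h1
      exact h1
    · rintro _ ⟨j, rfl⟩
      exact Ideal.mem_map_of_mem _ (hsJ j)
  refine ⟨key.1, hJS, ?_⟩
  rw [hJS]
  exact key.2

end RegularSequence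

/-! ### Generic smoothness of the target of a flat map -/

/-- By flatness `C` embeds in its base change to the fraction field of `S`, which is étale over a
field and hence reduced. -/
lemma isReduced_of_etale (S C : Type u) [CommRing S] [IsDomain S] [CommRing C]
    [Algebra S C] [Algebra.Etale S C] : IsReduced C := by
  have : Module.Flat S C := inferInstance
  have h := Algebra.TensorProduct.includeRight_injective (R := S) (A := FractionRing S) (B := C)
    (FaithfulSMul.algebraMap_injective S (FractionRing S))
  have : IsReduced (FractionRing S ⊗[S] C) :=
    Algebra.FormallyUnramified.isReduced_of_field (FractionRing S) _
  exact isReduced_of_injective (Algebra.TensorProduct.includeRight (R := S) (A := FractionRing S) (B := C)) h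

/-- A smooth algebra over a field is reduced. -/
lemma isReduced_of_smooth (K C : Type u) [Field K] [CommRing C] [Algebra K C]
    [Algebra.Smooth K C] : IsReduced C := by
  refine ⟨fun x hx => ?_⟩
  by_contra hne
  have hann : Ideal.span {x} ≠ ⊥ := by simpa using hne
  -- Near a maximal ideal that contains the annihilator of `x`, the algebra is étale over a
  -- polynomial ring and so reduced. Then a power of some `f` outside this ideal kills `x`, a
  -- contradiction.
  obtain ⟨p, hp, hle⟩ := Ideal.exists_le_maximal (Submodule.annihilator (Ideal.span {x})) (by
    rw [Ne, Submodule.annihilator_eq_top_iff]; exact hann)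
  have : Algebra.IsSmoothAt K p := inferInstance
  obtain ⟨f, hf, n, _, _, _⟩ := Algebra.IsSmoothAt.exists_isStandardEtale_mvPolynomial (R := K) (p := p)
  have : IsReduced (Localization.Away f) := isReduced_of_etale (MvPolynomial (Fin n) K) _
  have h0 : algebraMap C (Localization.Away f) x = 0 := (hx.map _).eq_zero
  rw [IsLocalization.map_eq_zero_iff (.powers f)] at h0
  obtain ⟨⟨_, m, rfl⟩, hm⟩ := h0
  refine hf (hp.isPrime.mem_of_pow_mem m (hle ?_))
  rw [Submodule.mem_annihilator_span_singleton]
  exact hm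

/-- The hypotheses make `P` the kernel of the localization map, so the primality of `P` rules out
zero divisors. -/
lemma isDomain_away {C : Type u} [CommRing C] (P : Ideal C) [P.IsPrime] {c : C} (hc : c ∉ P)
    (h : ∀ t ∈ P, ∃ n, c ^ n * t = 0) : IsDomain (Localization.Away c) := by
  have key : ∀ x, algebraMap C (Localization.Away c) x = 0 ↔ x ∈ P := fun x => by
    rw [IsLocalization.map_eq_zero_iff (.powers c)]
    constructor
    · rintro ⟨⟨_, m, rfl⟩, hm⟩
      exact (Ideal.IsPrime.mem_or_mem ‹_› (hm ▸ zero_mem P : c ^ m * x ∈ P)).resolve_left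
        fun hcm => hc (Ideal.IsPrime.mem_of_pow_mem ‹_› m hcm)
    · intro hx
      obtain ⟨n, hn⟩ := h x hx
      exact ⟨⟨c ^ n, n, rfl⟩, hn⟩
  have hunit : ∀ s : Submonoid.powers c, IsUnit (algebraMap C (Localization.Away c) s) :=
    IsLocalization.map_units _
  have : Nontrivial (Localization.Away c) := by
    refine nontrivial_of_ne 1 0 fun h1 => ?_
    rw [← map_one (algebraMap C _), key] at h1
    exact ‹P.IsPrime›.ne_top ((Ideal.eq_top_iff_one _).2 h1)
  have : NoZeroDivisors (Localization.Away c) := by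
    refine ⟨fun {a b} hab => ?_⟩
    obtain ⟨⟨x, s⟩, hx⟩ := IsLocalization.surj (.powers c) a
    obtain ⟨⟨y, t⟩, hy⟩ := IsLocalization.surj (.powers c) b
    have : algebraMap C (Localization.Away c) (x * y) = 0 := by
      rw [map_mul, ← hx, ← hy, mul_mul_mul_comm, hab, zero_mul]
    rw [key] at this
    rcases Ideal.IsPrime.mem_or_mem ‹_› this with hm | hm <;> rw [← key] at hm
    · left
      rw [hm] at hx
      exact (hunit s).mul_left_eq_zero.mp hx
    · right
      rw [hm] at hy
      exact (hunit t).mul_left_eq_zero.mp hy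
  exact IsDomain.mk

lemma isField_localization_of_mem_minimalPrimes {C : Type u} [CommRing C] [IsReduced C]
    {P : Ideal C} [P.IsPrime] (hP : P ∈ minimalPrimes C) : IsField (Localization.AtPrime P) := by
  have := Ring.KrullDimLE.of_isLocalization P hP (Localization.AtPrime P)
  have : IsReduced (Localization.AtPrime P) := inferInstance
  exact Ring.KrullDimLE.isField_of_isReduced

/-- A nontrivial reduced noetherian ring has a localization which is a domain. -/
lemma exists_isDomain_away (C : Type u) [CommRing C] [IsReduced C] [IsNoetherianRing C]
    [Nontrivial C] : ∃ c : C, IsDomain (Localization.Away c) := by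
  obtain ⟨M, hM⟩ := Ideal.exists_maximal C
  obtain ⟨P, hP, -⟩ := Ideal.exists_minimalPrimes_le (I := ⊥) (J := M) bot_le
  have hPp : P.IsPrime := hP.1.1
  have hF := isField_localization_of_mem_minimalPrimes hP
  rw [IsLocalRing.isField_iff_maximalIdeal_eq] at hF
  obtain ⟨c, hc, h⟩ := exists_notMem_forall_mul_mem P (I := ⊥) (J := P)
    (IsNoetherian.noetherian P) fun t ht => by
      have : algebraMap C (Localization.AtPrime P) t ∈ IsLocalRing.maximalIdeal _ :=
        (IsLocalization.AtPrime.to_map_mem_maximal_iff _ P t).2 ht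
      rw [hF, Ideal.mem_bot, IsLocalization.map_eq_zero_iff P.primeCompl] at this
      obtain ⟨⟨m, hm⟩, h⟩ := this
      exact ⟨m, hm, h⟩
  exact ⟨c, isDomain_away P hc fun t ht => ⟨1, by rw [pow_one]; exact h t ht⟩⟩

/-- A closed point of the generic fibre of `O → C` has a residue field `E` which is finite over the
fraction field of `O`. For a suitable `y ≠ 0` the image of `C` in `E` is integral over the
localization of `O` at `y`, and the Artin–Tate lemma applies to the subalgebra of `E` generated by
this image and `1 / y`. -/
lemma exists_finiteType_away (K O C : Type u) [Field K] [CommRing O] [IsDomain O] [CommRing C]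
    [IsDomain C] [Algebra K O] [Algebra K C] [Algebra O C] [IsScalarTower K O C]
    [FaithfulSMul O C] [Algebra.FiniteType K C] :
    ∃ g : O, g ≠ 0 ∧ Algebra.FiniteType K (Localization.Away g) := by
  let F := FractionRing O
  have hOC : Function.Injective (algebraMap O (FractionRing C)) := by
    rw [IsScalarTower.algebraMap_eq O C]
    exact (FaithfulSMul.algebraMap_injective C (FractionRing C)).comp
      (FaithfulSMul.algebraMap_injective O C)
  have : Algebra.FiniteType O C := Algebra.FiniteType.of_restrictScalars_finiteType K O C
  have : Nontrivial (F ⊗[O] C) := by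
    let φ : F →ₐ[O] FractionRing C := IsFractionRing.liftAlgHom (g := Algebra.ofId O _) hOC
    exact (Algebra.TensorProduct.lift φ (IsScalarTower.toAlgHom O C (FractionRing C))
      (fun _ _ => mul_comm _ _)).toRingHom.domain_nontrivial
  obtain ⟨M, hM⟩ := Ideal.exists_maximal (F ⊗[O] C)
  let E := (F ⊗[O] C) ⧸ M
  let : Field E := Ideal.Quotient.field M
  have : Module.Finite F E := finite_of_finite_type_of_isJacobsonRing F E
  have : Algebra.IsIntegral F E := Algebra.IsIntegral.of_finite F E
  have : Algebra.IsAlgebraic F E := Algebra.IsIntegral.isAlgebraic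
  have hOE : Function.Injective (algebraMap O E) := by
    rw [IsScalarTower.algebraMap_eq O F E]
    exact (algebraMap F E).injective.comp (IsFractionRing.injective O F)
  have : Algebra.IsAlgebraic O E := (IsFractionRing.comap_isAlgebraic_iff (A := O) (K := F) (C := E)).mpr inferInstance
  let ψ : C →ₐ[O] E := (Ideal.Quotient.mkₐ O M).comp Algebra.TensorProduct.includeRight
  obtain ⟨s, hs⟩ := (inferInstance : Algebra.FiniteType K C).out
  classical
  obtain ⟨y, hy, hint⟩ := Algebra.IsAlgebraic.exists_integral_multiples O (s.image ψ)
  refine ⟨y, hy, ?_⟩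
  let S := Localization.Away y
  have hyE : IsUnit (algebraMap O E y) := by
    rw [isUnit_iff_ne_zero]; exact (map_ne_zero_iff _ hOE).mpr hy
  let : Algebra S E := (IsLocalization.Away.lift y hyE).toAlgebra
  have : IsScalarTower O S E := .of_algebraMap_eq fun x => (IsLocalization.Away.lift_eq y hyE x).symm
  have : IsScalarTower K S E := .of_algebraMap_eq fun x => by
    rw [IsScalarTower.algebraMap_apply K O S, ← IsScalarTower.algebraMap_apply O S E,
      ← IsScalarTower.algebraMap_apply K O E]
  have hSE : Function.Injective (algebraMap S E) := by
    rw [injective_iff_map_eq_zero]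
    intro a ha
    obtain ⟨⟨x, t⟩, hx⟩ := IsLocalization.surj (.powers y) a
    have h1 : algebraMap O E x = 0 := by
      rw [IsScalarTower.algebraMap_apply O S E, ← hx, map_mul, ha, zero_mul]
    rw [(map_eq_zero_iff _ hOE).mp h1, map_zero] at hx
    exact (IsLocalization.map_units S t).mul_left_eq_zero.mp hx
  let Φ : Polynomial C →ₐ[K] E := Polynomial.eval₂AlgHom (ψ.restrictScalars K) (algebraMap O E y)⁻¹
    (fun _ => mul_comm _ _)
  have hyS : (algebraMap O E y)⁻¹ = algebraMap S E (IsLocalization.Away.invSelf y) := by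
    refine inv_eq_of_mul_eq_one_right ?_
    rw [IsScalarTower.algebraMap_apply O S E, ← map_mul, IsLocalization.Away.mul_invSelf, map_one]
  have hint' : ∀ c, IsIntegral S (ψ c) := by
    intro c
    have hc : c ∈ Algebra.adjoin K (s : Set C) := hs ▸ Algebra.mem_top
    induction hc using Algebra.adjoin_induction with
    | mem x hx =>
      have h1 := (hint _ (Finset.mem_image_of_mem ψ hx)).tower_top (A := S)
      have h2 : ψ x = algebraMap S E (IsLocalization.Away.invSelf y) * (y • ψ x) := by
        rw [← hyS, Algebra.smul_def, inv_mul_cancel_left₀ hyE.ne_zero]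
      rw [h2]
      exact isIntegral_algebraMap.mul h1
    | algebraMap r =>
      have : ψ (algebraMap K C r) = algebraMap S E (algebraMap K S r) := by
        rw [← IsScalarTower.algebraMap_apply]
        exact (ψ.restrictScalars K).commutes r
      rw [this]
      exact isIntegral_algebraMap
    | add x y _ _ hx hy => rw [map_add]; exact hx.add hy
    | mul x y _ _ hx hy => rw [map_mul]; exact hx.mul hy
  have hΦX : Φ Polynomial.X = (algebraMap O E y)⁻¹ := Polynomial.eval₂_X _ _
  have hΦC : ∀ c, Φ (Polynomial.C c) = ψ c := fun c => Polynomial.eval₂_C _ _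
  have hΦ : ∀ z, IsIntegral S (Φ z) := by
    intro z
    induction z using Polynomial.induction_on' with
    | add p q hp hq => rw [map_add]; exact hp.add hq
    | monomial n a =>
      rw [← Polynomial.C_mul_X_pow_eq_monomial, map_mul, map_pow, hΦX, hΦC, hyS]
      exact (hint' a).mul (isIntegral_algebraMap.pow n)
  -- The range of `Φ` contains the image of `S`. It is of finite type over `K`, being a quotient of
  -- `C[X]`, and integral over `S`, hence a finite `S`-module.
  let C' : Subalgebra S E := { Φ.range with
    algebraMap_mem' := fun a => by
      obtain ⟨⟨x, _, n, rfl⟩, hx⟩ := IsLocalization.surj (.powers y) a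
      refine ⟨Polynomial.C (algebraMap O C x) * Polynomial.X ^ n, ?_⟩
      change Φ _ = _
      rw [map_mul, map_pow, hΦX, hΦC, ψ.commutes, IsScalarTower.algebraMap_apply O S E, ← hx,
        map_mul, map_pow, map_pow, ← IsScalarTower.algebraMap_apply O S E, mul_assoc, ← mul_pow,
        mul_inv_cancel₀ hyE.ne_zero, one_pow, mul_one] }
  have hKC' : Algebra.FiniteType K C' := by
    have : Algebra.FiniteType K (Polynomial C) := .trans (S := C) inferInstance inferInstance
    exact this.of_surjective (Φ.codRestrict (C'.restrictScalars K) fun z => ⟨z, rfl⟩) (by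
      rintro ⟨_, z, rfl⟩
      exact ⟨z, rfl⟩)
  have : Algebra.FiniteType S C' := Algebra.FiniteType.of_restrictScalars_finiteType K S C'
  have : Algebra.IsIntegral S C' := ⟨by
    rintro ⟨_, z, rfl⟩
    rw [← isIntegral_algebraMap_iff (A := C') (B := E) Subtype.val_injective]
    exact hΦ z⟩
  have : Module.Finite S C' := Algebra.IsIntegral.finite
  refine ⟨fg_of_fg_of_fg K S C' hKC'.out Module.Finite.fg_top ?_⟩
  intro a b hab
  exact hSE congr(($hab).1)

/-- A domain of finite type over a perfect field is generically smooth. -/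
lemma exists_smooth_away_of_isDomain (K T : Type u) [Field K] [PerfectField K] [CommRing T]
    [IsDomain T] [Algebra K T] [Algebra.FiniteType K T] :
    ∃ u : T, u ≠ 0 ∧ Algebra.Smooth K (Localization.Away u) := by
  -- The local ring at the generic point is a field, and every field extension of a perfect field is
  -- formally smooth. Smoothness then spreads to a neighbourhood.
  have hF := isField_localization_of_mem_minimalPrimes (C := T) (P := ⊥) (by
    rw [IsDomain.minimalPrimes_eq_singleton_bot]; rfl)
  let : Field (Localization.AtPrime (⊥ : Ideal T)) := hF.toField
  have : Algebra.FinitePresentation K T := Algebra.FinitePresentation.of_finiteType.mp inferInstance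
  have : Algebra.IsSmoothAt K (⊥ : Ideal T) := Algebra.FormallySmooth.of_perfectField
  obtain ⟨u, hu, h⟩ := Algebra.IsSmoothAt.exists_notMem_smooth K (⊥ : Ideal T)
  exact ⟨u, hu, h⟩

/-- Up to a unit of `S`, the element `z` is the image of some element of `R`. -/
lemma exists_isLocalization_away {R S T : Type u} [CommRing R] [CommRing S] [CommRing T]
    [Algebra R S] [Algebra S T] [Algebra R T] [IsScalarTower R S T] (x : R)
    [IsLocalization.Away x S] (z : S) [IsLocalization.Away z T] :
    ∃ y : R, IsLocalization.Away y T := by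
  obtain ⟨⟨y, _, n, rfl⟩, hy⟩ := IsLocalization.surj (.powers x) z
  have hz : Associated z (algebraMap R S y) := by
    refine ⟨(IsLocalization.Away.algebraMap_pow_isUnit (S := S) x n).unit, ?_⟩
    rw [IsUnit.unit_spec, ← hy, map_pow]
  have : IsLocalization.Away (algebraMap R S y) T := IsLocalization.Away.of_associated hz
  exact ⟨x * y, IsLocalization.Away.mul' S T x y⟩

lemma not_isNilpotent_of_isUnit_map {R S : Type u} [CommRing R] [CommRing S] [Nontrivial S]
    (f : R →+* S) {x : R} (hx : IsUnit (f x)) : ¬ IsNilpotent x :=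
  fun hn => (hn.map f).not_isUnit hx

/-- The target of a flat morphism from a smooth scheme is generically smooth. -/
lemma exists_smooth_away_of_flat (K O C : Type u) [Field K] [PerfectField K] [CommRing O]
    [CommRing C] [Algebra K O] [Algebra K C] [Algebra O C] [IsScalarTower K O C]
    [Algebra.Smooth K C] [Nontrivial C] [Module.Flat O C] [Algebra.FinitePresentation O C] :
    ∃ h : O, ¬ IsNilpotent h ∧ Algebra.Smooth K (Localization.Away h) := by
  have := isReduced_of_smooth K C
  have : IsNoetherianRing C := Algebra.FiniteType.isNoetherianRing K C
  obtain ⟨c, hc⟩ := exists_isDomain_away C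
  let C₁ := Localization.Away c
  have : Algebra.FinitePresentation C C₁ := IsLocalization.Away.finitePresentation c
  have : Algebra.FinitePresentation O C₁ := .trans O C C₁
  have : Module.Flat C C₁ := IsLocalization.flat _ (.powers c)
  have : Module.Flat O C₁ := .trans O C C₁
  have : Algebra.FiniteType K C₁ := .trans (S := C) inferInstance inferInstance
  let P : Ideal O := RingHom.ker (algebraMap O C₁)
  have hP : P.IsPrime := RingHom.ker_isPrime _
  -- The image of a flat map of finite presentation is open; take a basic open subset of it around
  -- the prime `P`.
  obtain ⟨_, ⟨_, ⟨h₁, rfl⟩, rfl⟩, hPh, hrange⟩ :=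
    PrimeSpectrum.isBasis_basic_opens.exists_subset_of_mem_open
      (show PrimeSpectrum.comap (algebraMap O C₁) ⊥ ∈ Set.range (PrimeSpectrum.comap (algebraMap O C₁)) from ⟨_, rfl⟩)
      (PrimeSpectrum.isOpenMap_comap_of_hasGoingDown_of_finitePresentation.isOpen_range)
  have hh₁ : algebraMap O C₁ h₁ ≠ 0 := by simpa using hPh
  -- Every prime `q` in this basic open subset lies below a prime of `C₁`. There flatness makes the
  -- local homomorphism injective, so an element of `P` already vanishes in the local ring at `q`.
  -- Hence a power of `h₁` kills it.
  have hker : ∀ t ∈ P, ∃ n, h₁ ^ n * t = 0 := by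
    intro t ht
    have : h₁ ∈ (Submodule.annihilator (Ideal.span {t})).radical := by
      rw [Ideal.radical_eq_sInf, Ideal.mem_sInf]
      rintro q ⟨hle, hq⟩
      by_contra hn
      obtain ⟨q', hq'⟩ := hrange (show (⟨q, hq⟩ : PrimeSpectrum O) ∈ _ from hn)
      obtain ⟨m, hm, hmt⟩ := exists_notMem_mul_mem (O := O) q'.asIdeal ⊥ (t := t) (c := 1)
        ((Ideal.ne_top_iff_one _).1 q'.2.ne_top) (by
          rw [one_mul, (ht : algebraMap O C₁ t = 0)]; exact zero_mem _)
      have hqq : q'.asIdeal.comap (algebraMap O C₁) = q := congr_arg PrimeSpectrum.asIdeal hq'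
      refine hm (show m ∈ q'.asIdeal.comap (algebraMap O C₁) from hqq ▸ hle ?_)
      rw [Submodule.mem_annihilator_span_singleton]
      exact hmt
    obtain ⟨n, hn⟩ := this
    rw [Submodule.mem_annihilator_span_singleton] at hn
    exact ⟨n, hn⟩
  let O₁ := Localization.Away h₁
  have : IsDomain O₁ := isDomain_away P hh₁ hker
  let C₂ := Localization.Away (algebraMap O C₁ h₁)
  have : IsDomain C₂ := IsLocalization.isDomain_localization (powers_le_nonZeroDivisors_of_noZeroDivisors hh₁)
  have hu : IsUnit (algebraMap O C₂ h₁) := by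
    rw [IsScalarTower.algebraMap_apply O C₁ C₂]
    exact IsLocalization.Away.algebraMap_isUnit _
  let : Algebra O₁ C₂ := (IsLocalization.Away.lift h₁ hu).toAlgebra
  have : IsScalarTower O O₁ C₂ := .of_algebraMap_eq fun x => (IsLocalization.Away.lift_eq h₁ hu x).symm
  have : IsScalarTower K O₁ C₂ := .of_algebraMap_eq fun x => by
    rw [IsScalarTower.algebraMap_apply K O O₁, ← IsScalarTower.algebraMap_apply O O₁ C₂,
      ← IsScalarTower.algebraMap_apply K O C₂]
  have : FaithfulSMul O₁ C₂ := by
    rw [faithfulSMul_iff_algebraMap_injective, injective_iff_map_eq_zero]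
    intro a ha
    obtain ⟨⟨x, t⟩, hx⟩ := IsLocalization.surj (.powers h₁) a
    have h1 : algebraMap O C₂ x = 0 := by
      rw [IsScalarTower.algebraMap_apply O O₁ C₂, ← hx, map_mul, ha, zero_mul]
    rw [IsScalarTower.algebraMap_apply O C₁ C₂, map_eq_zero_iff _
      (IsLocalization.injective C₂ (powers_le_nonZeroDivisors_of_noZeroDivisors hh₁))] at h1
    obtain ⟨n, hn⟩ := hker x h1
    have h2 : algebraMap O O₁ x = 0 :=
      (IsLocalization.map_eq_zero_iff (.powers h₁) _ x).2 ⟨⟨h₁ ^ n, n, rfl⟩, hn⟩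
    rw [h2] at hx
    exact (IsLocalization.map_units O₁ t).mul_left_eq_zero.mp hx
  have : Algebra.FiniteType K C₂ := .trans (S := C₁) inferInstance inferInstance
  obtain ⟨g, hg, _⟩ := exists_finiteType_away K O₁ C₂
  have : IsDomain (Localization.Away g) :=
    IsLocalization.isDomain_localization (powers_le_nonZeroDivisors_of_noZeroDivisors hg)
  obtain ⟨v, hv, hsm⟩ := exists_smooth_away_of_isDomain K (Localization.Away g)
  have : IsDomain (Localization.Away v) :=
    IsLocalization.isDomain_localization (powers_le_nonZeroDivisors_of_noZeroDivisors hv)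
  obtain ⟨g', _⟩ := exists_isLocalization_away (T := Localization.Away v) g v
  obtain ⟨h, _⟩ := exists_isLocalization_away (R := O) (T := Localization.Away v) h₁ g'
  refine ⟨h, not_isNilpotent_of_isUnit_map (algebraMap O (Localization.Away v))
    (IsLocalization.Away.algebraMap_isUnit h), ?_⟩
  exact Algebra.Smooth.of_equiv (A := Localization.Away v)
      ((IsLocalization.algEquiv (.powers h) (Localization.Away v) (Localization.Away h)).restrictScalars K)

/-! ### Smoothness of the target by homogeneity -/

section SmoothTarget

lemma hom_ext_of_forall_spec {X Y : Scheme.{u}} (f g : X ⟶ Y)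
    (h : ∀ (R : CommRingCat.{u}) (t : Spec R ⟶ X), t ≫ f = t ≫ g) : f = g :=
  Scheme.Cover.hom_ext X.affineCover _ _ fun _ => h _ _

/-- An affine open subset of `Y` around an image point, together with an affine open piece of its
preimage, reduces this to `exists_smooth_away_of_flat`. -/
lemma exists_smooth_open {K : Type u} [Field K] [PerfectField K] {X Y : Scheme.{u}} (p : X ⟶ Y)
    (y : Y ⟶ Spec (.of K)) [Flat p] [LocallyOfFinitePresentation p] [Smooth (p ≫ y)]
    [Nonempty X] : ∃ U : Y.Opens, (U : Set Y).Nonempty ∧ Smooth (U.ι ≫ y) := by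
  obtain ⟨x⟩ := ‹Nonempty X›
  obtain ⟨i, z, hz⟩ := Y.affineCover.exists_eq (p x)
  obtain ⟨O, j, hj, hzj⟩ : ∃ (O : CommRingCat.{u}) (j : Spec O ⟶ Y), IsOpenImmersion j ∧
      p x ∈ Set.range j := ⟨_, Y.affineCover.f i, Y.affineCover.map_prop i, z, hz⟩
  obtain ⟨w, hw⟩ := hzj
  obtain ⟨v, -, hv⟩ := Scheme.Pullback.exists_preimage_pullback x w hw.symm
  obtain ⟨C, c, hc, hvc⟩ : ∃ (C : CommRingCat.{u}) (c : Spec C ⟶ Limits.pullback p j), IsOpenImmersion c ∧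
      v ∈ Set.range c := by
    obtain ⟨i, z, hz⟩ := (Limits.pullback p j).affineCover.exists_eq v
    exact ⟨_, (Limits.pullback p j).affineCover.f i, (Limits.pullback p j).affineCover.map_prop i, z, hz⟩
  obtain ⟨φ, hφ⟩ := Spec.map_surjective (c ≫ Limits.pullback.snd p j)
  obtain ⟨ψ, hψ⟩ := Spec.map_surjective (j ≫ y)
  have hflat : Flat (Spec.map φ) := by rw [hφ]; infer_instance
  have hlfp : LocallyOfFinitePresentation (Spec.map φ) := by rw [hφ]; infer_instance
  have hsm : Smooth (Spec.map (ψ ≫ φ)) := by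
    rw [Spec.map_comp, hφ, hψ, Category.assoc, ← Limits.pullback.condition_assoc]
    infer_instance
  have : Nontrivial C := by
    obtain ⟨z, _⟩ := hvc
    exact PrimeSpectrum.nonempty_iff_nontrivial.mp ⟨z⟩
  rw [HasRingHomProperty.Spec_iff (P := @Flat)] at hflat
  rw [HasRingHomProperty.Spec_iff (P := @LocallyOfFinitePresentation)] at hlfp
  rw [HasRingHomProperty.Spec_iff (P := @Smooth)] at hsm
  algebraize [φ.hom, ψ.hom, (ψ ≫ φ).hom]
  have : IsScalarTower K O C := .of_algebraMap_eq fun _ => rfl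
  obtain ⟨h, hn, hs⟩ := exists_smooth_away_of_flat K O C
  let l : Spec (.of (Localization.Away h)) ⟶ Y :=
    Spec.map (CommRingCat.ofHom (algebraMap O (Localization.Away h))) ≫ j
  have hl : Smooth (l ≫ y) := by
    rw [Category.assoc, ← hψ, ← Spec.map_comp, HasRingHomProperty.Spec_iff (P := @Smooth)]
    rw [← RingHom.smooth_algebraMap] at hs
    exact hs
  have : IsOpenImmersion (Spec.map (CommRingCat.ofHom (algebraMap O (Localization.Away h)))) :=
    inferInstance
  refine ⟨l.opensRange, ?_, ?_⟩
  · have : Nontrivial (Localization.Away h) := by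
      by_contra hn'
      rw [not_nontrivial_iff_subsingleton] at hn'
      obtain ⟨⟨_, n, rfl⟩, hm⟩ := (IsLocalization.map_eq_zero_iff (.powers h) (Localization.Away h)
        (1 : O)).1 (Subsingleton.elim _ _)
      exact hn ⟨n, by simpa using hm⟩
    obtain ⟨z⟩ := PrimeSpectrum.nonempty_iff_nontrivial.mpr this
    exact ⟨l z, z, rfl⟩
  · have : l.opensRange.ι = l.isoOpensRange.inv ≫ l := by simp
    rw [this, Category.assoc]
    infer_instance

/-- If the union of all smooth open subsets were not `Y`, there would be a closed point of `X` over
its complement and another one over a smooth open subset. Both are `K`-points, and the automorphism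
`σ` that moves one image to the other pulls the smooth open subset back to a neighbourhood of the
bad point. -/
lemma smooth_of_forall_exists_iso {K : Type u} [Field K] [IsAlgClosed K] {X Y : Scheme.{u}}
    (p : X ⟶ Y) (y : Y ⟶ Spec (.of K)) [Flat p] [LocallyOfFinitePresentation p] [Surjective p]
    [Smooth (p ≫ y)]
    (h : ∀ a b : Spec (.of K) ⟶ X, a ≫ p ≫ y = 𝟙 _ → b ≫ p ≫ y = 𝟙 _ →
      ∃ σ : Y ⟶ Y, IsIso σ ∧ σ ≫ y = y ∧ a ≫ p ≫ σ = b ≫ p) : Smooth y := by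
  cases isEmpty_or_nonempty X with
  | inl hX => 
    have : IsEmpty Y := ⟨fun z => by obtain ⟨x, -⟩ := p.surjective z; exact hX.false x⟩
    infer_instance
  | inr hX =>
  have : JacobsonSpace X := LocallyOfFiniteType.jacobsonSpace (p ≫ y)
  obtain ⟨U, ⟨u, hu⟩, hU⟩ := exists_smooth_open p y
  let I := {V : Y.Opens // Smooth (V.ι ≫ y)}
  let W : Y.Opens := ⨆ V : I, V.1
  suffices hW : W = ⊤ by
    have : IsZariskiLocalAtSource @Smooth.{u} := HasRingHomProperty.instIsZariskiLocalAtSource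
    exact (IsZariskiLocalAtSource.iff_of_iSup_eq_top (P := @Smooth.{u}) _ hW).2 fun V => V.2
  by_contra hW
  have hne : ((p ⁻¹ᵁ W : X.Opens) : Set X)ᶜ.Nonempty := by
    rw [Set.nonempty_compl]
    intro hp
    refine hW (top_le_iff.mp fun z _ => ?_)
    obtain ⟨x, rfl⟩ := p.surjective z
    exact (hp ▸ Set.mem_univ x : x ∈ ((p ⁻¹ᵁ W : X.Opens) : Set X))
  obtain ⟨a, ha, hac⟩ := nonempty_inter_closedPoints hne
    (p ⁻¹ᵁ W).2.isClosed_compl.isLocallyClosed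
  obtain ⟨x₀, hx₀⟩ := p.surjective u
  obtain ⟨b, hb, hbc⟩ := nonempty_inter_closedPoints (X := X) (Z := (p ⁻¹ᵁ U : X.Opens))
    ⟨x₀, by simpa [hx₀] using hu⟩ (p ⁻¹ᵁ U).2.isLocallyClosed
  let a' := (pointEquivClosedPoint (p ≫ y)).symm ⟨a, hac⟩
  let b' := (pointEquivClosedPoint (p ≫ y)).symm ⟨b, hbc⟩
  obtain ⟨σ, _, hσ, hab⟩ := h a'.1 b'.1 a'.2 b'.2
  have ha' : a'.1 (IsLocalRing.closedPoint K) = a :=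
    congr_arg Subtype.val ((pointEquivClosedPoint (p ≫ y)).apply_symm_apply ⟨a, hac⟩)
  have hb' : b'.1 (IsLocalRing.closedPoint K) = b :=
    congr_arg Subtype.val ((pointEquivClosedPoint (p ≫ y)).apply_symm_apply ⟨b, hbc⟩)
  have hσa : σ (p a) = p b := by
    rw [← ha', ← hb']
    exact congr($hab (IsLocalRing.closedPoint K))
  refine ha ?_
  have hV : Smooth ((σ ⁻¹ᵁ U).ι ≫ y) := by
    rw [← hσ, ← morphismRestrict_ι_assoc]
    infer_instance
  exact (le_iSup (fun V : I => V.1) ⟨σ ⁻¹ᵁ U, hV⟩ : _ ≤ W) (show σ (p a) ∈ U by rw [hσa]; exact hb)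

end SmoothTarget

/-! ### Left translations and smoothness of the quotient -/

section Translation

variable {k A : Type u} [Field k] [CommRing A] [HopfAlgebra k A] {I : Ideal A}
  {K : Type u} [Field K] [Algebra k K]

/-- The tautological point of the subscheme `V(I)` over the base change of its coordinate ring. -/
noncomputable def basePt (K : Type u) [Field K] [Algebra k K] (I : Ideal A) :
    Pt k A (K ⊗[k] (A ⧸ I)) :=
  Pt.map (Algebra.TensorProduct.includeRight.comp (Ideal.Quotient.mkₐ k I)) (univPt k A)

lemma mem_basePt : Mem I (basePt (k := k) K I) := fun a ha => by
  change Algebra.TensorProduct.includeRight (Ideal.Quotient.mkₐ k I a) = 0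
  rw [Ideal.Quotient.mkₐ_eq_mk, Ideal.Quotient.eq_zero_iff_mem.2 ha, map_zero]

/-- A homomorphism on `K ⊗ A/I` is determined by its restriction to `K` and by a point. -/
lemma algHom_ext_basePt {R : Type u} [CommRing R] [Algebra k R] {φ ψ : K ⊗[k] (A ⧸ I) →ₐ[k] R}
    (h₁ : φ.comp Algebra.TensorProduct.includeLeft = ψ.comp Algebra.TensorProduct.includeLeft)
    (h₂ : Pt.map φ (basePt K I) = Pt.map ψ (basePt K I)) : φ = ψ := by
  refine Algebra.TensorProduct.ext h₁ (Ideal.Quotient.algHom_ext _ ?_)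
  ext a
  exact congr_arg (fun g : Pt k A R => g.ofConv a) h₂

lemma mem_map_mul_basePt (hI : IsSubgroup k I) {x : Pt k A K} (hx : Mem I x) : Mem I (Pt.map Algebra.TensorProduct.includeLeft x * basePt (k := k) K I) :=
  hI.mul_mem _ _ _ (mem_map _ hx) mem_basePt

/-- Left translation by a `K`-point on `V(I)_K`. -/
noncomputable def translation (hI : IsSubgroup k I) {x : Pt k A K} (hx : Mem I x) :
    K ⊗[k] (A ⧸ I) →ₐ[k] K ⊗[k] (A ⧸ I) :=
  Algebra.TensorProduct.lift Algebra.TensorProduct.includeLeft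
    (Ideal.Quotient.liftₐ I (Pt.map Algebra.TensorProduct.includeLeft x * basePt (k := k) K I).ofConv
      fun a ha => mem_map_mul_basePt hI hx a ha) fun _ _ => mul_comm _ _

variable (hI : IsSubgroup k I) {x : Pt k A K} (hx : Mem I x)

lemma translation_comp_includeLeft :
    (translation hI hx).comp Algebra.TensorProduct.includeLeft =
      (Algebra.TensorProduct.includeLeft : K →ₐ[k] K ⊗[k] (A ⧸ I)) :=
  Algebra.TensorProduct.lift_comp_includeLeft ..

lemma map_translation :
    Pt.map (translation hI hx) (basePt (k := k) K I) =
      Pt.map Algebra.TensorProduct.includeLeft x * basePt (k := k) K I := by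
  refine Pt.ext fun a => ?_
  change ((translation hI hx).comp Algebra.TensorProduct.includeRight) (Ideal.Quotient.mkₐ k I a) = _
  have : (translation hI hx).comp Algebra.TensorProduct.includeRight =
      Ideal.Quotient.liftₐ I (Pt.map Algebra.TensorProduct.includeLeft x * basePt (k := k) K I).ofConv
        fun a ha => mem_map_mul_basePt hI hx a ha :=
    Algebra.TensorProduct.lift_comp_includeRight _ _ fun _ _ => Commute.all _ _
  rw [this]
  rfl

lemma map_comp_translation {R : Type u} [CommRing R] [Algebra k R] (φ : K ⊗[k] (A ⧸ I) →ₐ[k] R) :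
    Pt.map (φ.comp (translation hI hx)) (basePt (k := k) K I) =
      Pt.map (φ.comp Algebra.TensorProduct.includeLeft) x * Pt.map φ (basePt (k := k) K I) := by
  change Pt.map φ (Pt.map (translation hI hx) (basePt (k := k) K I)) = _
  rw [map_translation, map_mul']
  rfl

lemma translation_comp_translation {y : Pt k A K} (hy : Mem I y) (hxy : x * y = 1) :
    (translation hI hy).comp (translation hI hx) = AlgHom.id k _ := by
  refine algHom_ext_basePt ?_ ?_
  · rw [AlgHom.comp_assoc, translation_comp_includeLeft, translation_comp_includeLeft]; rfl
  · rw [map_comp_translation, map_translation, translation_comp_includeLeft, ← mul_assoc,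
      ← map_mul', hxy]
    have : Pt.map (Algebra.TensorProduct.includeLeft : K →ₐ[k] K ⊗[k] (A ⧸ I)) (1 : Pt k A K) = 1 :=
      toFun_injective (post_one _)
    rw [this, one_mul]
    rfl

lemma toSpec_map_basePt {R : Type u} [CommRing R] [Algebra k R] (φ : K ⊗[k] (A ⧸ I) →ₐ[k] R) :
    toSpec I (Pt.map φ (basePt K I)) (mem_map φ mem_basePt) =
      Spec.map (CommRingCat.ofHom (φ.comp Algebra.TensorProduct.includeRight).toRingHom) := by
  rw [toSpec]
  congr 2
  refine Ideal.Quotient.ringHom_ext ?_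
  ext a
  rfl

/-- Left translation preserves left cosets, since `(x g)⁻¹ (x g') = g⁻¹ g'`. The first hypothesis
ensures that `x` becomes the same `R`-point along `φ` and along `ψ`. -/
lemma translation_coequalizes {J : Ideal A} {Q : Scheme.{u}} {q : Q ⟶ Spec (.of k)}
    {π : Spec (.of (A ⧸ I)) ⟶ Q} (hQ : IsQuotient I J q π) {R : Type u} [CommRing R] [Algebra k R]
    (φ ψ : K ⊗[k] (A ⧸ I) →ₐ[k] R)
    (h₁ : φ.comp Algebra.TensorProduct.includeLeft = ψ.comp Algebra.TensorProduct.includeLeft)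
    (h₂ : Spec.map (CommRingCat.ofHom (φ.comp Algebra.TensorProduct.includeRight).toRingHom) ≫ π =
      Spec.map (CommRingCat.ofHom (ψ.comp Algebra.TensorProduct.includeRight).toRingHom) ≫ π) :
    Spec.map (CommRingCat.ofHom
      ((φ.comp (translation hI hx)).comp Algebra.TensorProduct.includeRight).toRingHom) ≫ π =
    Spec.map (CommRingCat.ofHom
      ((ψ.comp (translation hI hx)).comp Algebra.TensorProduct.includeRight).toRingHom) ≫ π := by
  simp only [← toSpec_map_basePt, hQ.coset, inv_eq] at h₂ ⊢
  rw [map_comp_translation, map_comp_translation, h₁]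
  convert h₂ using 1
  group

set_option maxHeartbeats 1000000 in
/-- The quotient of a smooth group scheme by a subgroup scheme is smooth. -/
theorem smooth_of_isQuotient (K : Type u) [Field K] [Algebra k K] [IsAlgClosed K]
    (hI : IsSubgroup k I) [Algebra.Smooth k (A ⧸ I)] {J : Ideal A} {Q : Scheme.{u}}
    {q : Q ⟶ Spec (.of k)} {π : Spec (.of (A ⧸ I)) ⟶ Q} (hQ : IsQuotient I J q π) :
    Smooth q := by
  let s : Spec (.of K) ⟶ Spec (.of k) := Spec.map (CommRingCat.ofHom (algebraMap k K))
  have : Surjective s := inferInstance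
  have : Flat s := inferInstance
  -- Smoothness may be checked after the base change to `K`, where there are enough rational points
  -- to translate by.
  apply MorphismProperty.of_pullback_snd_of_descendsAlong (Q := @Surjective ⊓ @Flat ⊓ @QuasiCompact)
    (g := s)
  · exact ⟨⟨inferInstance, inferInstance⟩, inferInstance⟩
  let iL : Spec (.of (K ⊗[k] (A ⧸ I))) ⟶ Spec (.of K) := Spec.map (CommRingCat.ofHom
    (Algebra.TensorProduct.includeLeft : K →ₐ[k] K ⊗[k] (A ⧸ I)).toRingHom)
  let iR : Spec (.of (K ⊗[k] (A ⧸ I))) ⟶ Spec (.of (A ⧸ I)) := Spec.map (CommRingCat.ofHom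
    (Algebra.TensorProduct.includeRight : (A ⧸ I) →ₐ[k] K ⊗[k] (A ⧸ I)).toRingHom)
  have hpb : IsPullback iR iL (Spec.map (CommRingCat.ofHom (algebraMap k (A ⧸ I)))) s :=
    (isPullback_SpecMap_of_isPushout _ _ _ _ (CommRingCat.isPushout_tensorProduct k K (A ⧸ I))).flip
  rw [← hQ.over_base] at hpb
  let p : Spec (.of (K ⊗[k] (A ⧸ I))) ⟶ Limits.pullback q s :=
    Limits.pullback.lift (iR ≫ π) iL (by rw [Category.assoc]; exact hpb.w)
  have hp₁ : p ≫ Limits.pullback.fst q s = iR ≫ π := Limits.pullback.lift_fst ..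
  have hp₂ : p ≫ Limits.pullback.snd q s = iL := Limits.pullback.lift_snd ..
  have hp : IsPullback iR p π (Limits.pullback.fst q s) :=
    .of_bot (by rw [hp₂]; exact hpb) hp₁.symm (IsPullback.of_hasPullback q s)
  have := hQ.flat
  have := hQ.surjective
  have := hQ.finitePresentation
  have : Flat p := MorphismProperty.of_isPullback hp ‹_›
  have : Surjective p := MorphismProperty.of_isPullback hp ‹_›
  have : LocallyOfFinitePresentation p := MorphismProperty.of_isPullback hp ‹_›
  have : Smooth (p ≫ Limits.pullback.snd q s) := by
    rw [hp₂]
    refine MorphismProperty.of_isPullback hpb ?_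
    rw [hQ.over_base, HasRingHomProperty.Spec_iff (P := @Smooth)]
    rw [← RingHom.smooth_algebraMap] at *
    assumption
  let τ {x : Pt k A K} (hx : Mem I x) : Spec (.of (K ⊗[k] (A ⧸ I))) ⟶ Spec (.of (K ⊗[k] (A ⧸ I))) :=
    Spec.map (CommRingCat.ofHom (translation hI hx).toRingHom)
  have hτL {x : Pt k A K} (hx : Mem I x) : τ hx ≫ iL = iL := by
    rw [← Spec.map_comp, ← CommRingCat.ofHom_comp]
    exact congr_arg (fun f : K →ₐ[k] _ => Spec.map (CommRingCat.ofHom f.toRingHom))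
      (translation_comp_includeLeft hI hx)
  -- As an fppf covering, `p` is an effective epimorphism, so a translation descends once it
  -- respects the pairs of points with the same image under `p`. This is checked on affine test
  -- schemes.
  have hdesc {x : Pt k A K} (hx : Mem I x) : ∃ σ, p ≫ σ = τ hx ≫ p := by
    refine ⟨EffectiveEpi.desc p (τ hx ≫ p) fun {Z} g₁ g₂ hg => ?_, EffectiveEpi.fac ..⟩
    have hgL : g₁ ≫ iL = g₂ ≫ iL := by rw [← hp₂, reassoc_of% hg]
    have hgR : g₁ ≫ iR ≫ π = g₂ ≫ iR ≫ π := by rw [← hp₁, reassoc_of% hg]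
    refine Limits.pullback.hom_ext ?_ ?_
    · simp only [Category.assoc, hp₁]
      refine hom_ext_of_forall_spec _ _ fun R t => ?_
      obtain ⟨φ, hφ⟩ := Spec.map_surjective (t ≫ g₁)
      obtain ⟨ψ, hψ⟩ := Spec.map_surjective (t ≫ g₂)
      have hL : φ.hom.comp (Algebra.TensorProduct.includeLeft : K →ₐ[k] K ⊗[k] (A ⧸ I)).toRingHom =
          ψ.hom.comp (Algebra.TensorProduct.includeLeft : K →ₐ[k] K ⊗[k] (A ⧸ I)).toRingHom := by
        have : Spec.map φ ≫ iL = Spec.map ψ ≫ iL := by rw [hφ, hψ, Category.assoc, Category.assoc, hgL]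
        rw [← Spec.map_comp, ← Spec.map_comp] at this
        exact congr_arg CommRingCat.Hom.hom (Spec.map_injective this)
      let : Algebra k R := (φ.hom.comp (algebraMap k (K ⊗[k] (A ⧸ I)))).toAlgebra
      let φ' : K ⊗[k] (A ⧸ I) →ₐ[k] R := { φ.hom with commutes' := fun r => rfl }
      let ψ' : K ⊗[k] (A ⧸ I) →ₐ[k] R := { ψ.hom with
        commutes' := fun r => (RingHom.congr_fun hL (algebraMap k K r)).symm }
      have h := translation_coequalizes hI hx hQ φ' ψ' (AlgHom.ext fun r => RingHom.congr_fun hL r) (by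
        have : (Spec.map φ ≫ iR) ≫ π = (Spec.map ψ ≫ iR) ≫ π := by
          simp only [hφ, hψ, Category.assoc, hgR]
        rw [← Spec.map_comp, ← Spec.map_comp] at this
        exact this)
      rw [← reassoc_of% hφ, ← reassoc_of% hψ]
      have h₁ : Spec.map φ ≫ τ hx ≫ iR = Spec.map (CommRingCat.ofHom
          ((φ'.comp (translation hI hx)).comp Algebra.TensorProduct.includeRight).toRingHom) := by
        rw [← Spec.map_comp, ← Spec.map_comp]; rfl
      have h₂ : Spec.map ψ ≫ τ hx ≫ iR = Spec.map (CommRingCat.ofHom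
          ((ψ'.comp (translation hI hx)).comp Algebra.TensorProduct.includeRight).toRingHom) := by
        rw [← Spec.map_comp, ← Spec.map_comp]; rfl
      rw [reassoc_of% h₁, reassoc_of% h₂]
      exact h
    · simp only [Category.assoc, hp₂, hτL, hgL]
  refine smooth_of_forall_exists_iso p _ fun a b ha hb => ?_
  have hpoint (a : Spec (.of K) ⟶ Spec (.of (K ⊗[k] (A ⧸ I))))
      (ha : a ≫ p ≫ Limits.pullback.snd q s = 𝟙 _) : ∃ α : K ⊗[k] (A ⧸ I) →ₐ[k] K,
      α.comp Algebra.TensorProduct.includeLeft = AlgHom.id k K ∧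
      a = Spec.map (CommRingCat.ofHom α.toRingHom) := by
    obtain ⟨α, rfl⟩ := Spec.map_surjective a
    rw [hp₂, ← Spec.map_comp, ← Spec.map_id] at ha
    have h := congr_arg CommRingCat.Hom.hom (Spec.map_injective ha)
    exact ⟨{ α.hom with commutes' := fun r => RingHom.congr_fun h (algebraMap k K r) },
      AlgHom.ext fun r => RingHom.congr_fun h r, rfl⟩
  obtain ⟨α, hα, rfl⟩ := hpoint a ha
  obtain ⟨β, hβ, rfl⟩ := hpoint b hb
  -- Left translation by `b a⁻¹` carries the point `a` to the point `b`.
  let x : Pt k A K := Pt.map β (basePt K I) * (Pt.map α (basePt K I))⁻¹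
  have hx : Mem I x :=
    hI.mul_mem _ _ _ (mem_map _ mem_basePt) (hI.inv_mem _ _ (mem_map _ mem_basePt))
  have hx' : Mem I x⁻¹ := hI.inv_mem _ _ hx
  obtain ⟨σ, hσ⟩ := hdesc hx
  obtain ⟨σ', hσ'⟩ := hdesc hx'
  have hττ {x y : Pt k A K} (hx : Mem I x) (hy : Mem I y) (hxy : x * y = 1) : τ hy ≫ τ hx = 𝟙 _ := by
    rw [← Spec.map_comp, ← CommRingCat.ofHom_comp]
    change Spec.map (CommRingCat.ofHom ((translation hI hy).comp (translation hI hx)).toRingHom) = _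
    rw [translation_comp_translation hI hx hy hxy]
    exact Spec.map_id _
  refine ⟨σ, ⟨σ', ?_, ?_⟩, ?_, ?_⟩
  · rw [← cancel_epi p, reassoc_of% hσ, hσ', ← Category.assoc, hττ hx' hx (inv_mul_cancel x),
      Category.id_comp, Category.comp_id]
  · rw [← cancel_epi p, reassoc_of% hσ', hσ, ← Category.assoc, hττ hx hx' (mul_inv_cancel x),
      Category.id_comp, Category.comp_id]
  · rw [← cancel_epi p, reassoc_of% hσ, hp₂, hτL]
  · rw [hσ, ← Category.assoc]
    congr 1
    rw [← Spec.map_comp, ← CommRingCat.ofHom_comp]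
    have : α.comp (translation hI hx) = β := by
      refine algHom_ext_basePt ?_ ?_
      · rw [AlgHom.comp_assoc, translation_comp_includeLeft, hα, hβ]
      · rw [map_comp_translation, hα]
        change x * Pt.map α (basePt K I) = _
        rw [inv_mul_cancel_right]
    change Spec.map (CommRingCat.ofHom (α.comp (translation hI hx)).toRingHom) = _
    rw [this]

end Translation

/-! ### Descent of invariant closed subschemes -/

section Descent

/-- The image is the smallest closed subscheme through which `f` factors. The image of `f.toImage`
is a closed subscheme of it with the same property, so it is everything. -/
instance isSchemeTheoreticallyDominant_toImage {X Y : Scheme.{u}} (f : X ⟶ Y) :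
    IsSchemeTheoreticallyDominant f.toImage := by
  let D := f.toImage.ker.subschemeι
  have h : (D ≫ f.imageι).ker = f.imageι.ker := by
    refine le_antisymm ?_ (Scheme.Hom.le_ker_comp D f.imageι)
    have h₁ : f.toImage.toImage ≫ D ≫ f.imageι = f := by
      rw [← Category.assoc]
      erw [f.toImage.toImage_imageι]
      exact f.toImage_imageι
    have h₂ := Scheme.Hom.le_ker_comp f.toImage.toImage (D ≫ f.imageι)
    rw [h₁] at h₂
    rwa [Scheme.Hom.imageι, Scheme.IdealSheafData.ker_subschemeι]
  have : IsIso D := IsClosedImmersion.isIso_of_ker_eq _ _ D rfl h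
  exact ⟨(Scheme.isIso_subschemeι_iff_eq_bot _).1 this⟩

/-- A morphism factors through a closed subscheme if it does so locally. -/
lemma exists_lift_of_forall_spec {T X Z : Scheme.{u}} (z : Z ⟶ X) [Mono z] (b : T ⟶ X)
    (h : ∀ (R : CommRingCat.{u}) (t : Spec R ⟶ T), ∃ s, s ≫ z = t ≫ b) : ∃ s, s ≫ z = b := by
  have h' : ∀ i, ∃ s : T.affineCover.X i ⟶ Z, s ≫ z = T.affineCover.f i ≫ b := fun i => h _ _
  choose s hs using h'
  refine ⟨T.affineCover.glueMorphisms s fun i j => ?_, ?_⟩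
  · rw [← cancel_mono z, Category.assoc, Category.assoc, hs, hs, Limits.pullback.condition_assoc]
  · refine T.affineCover.hom_ext _ _ fun i => ?_
    rw [Scheme.Cover.ι_glueMorphisms_assoc, hs]

/-- A closed subscheme of the source of a flat morphism which is invariant under the corresponding
equivalence relation is the preimage of a closed subscheme of the target. -/
lemma exists_closed_subscheme_of_invariant {X Q Z : Scheme.{u}} (π : X ⟶ Q) [Flat π] (z : Z ⟶ X)
    [IsClosedImmersion z] [QuasiCompact (z ≫ π)]
    (h : ∀ (R : CommRingCat.{u}) (a : Spec R ⟶ Z) (b : Spec R ⟶ X), a ≫ z ≫ π = b ≫ π →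
      ∃ s, s ≫ z = b) :
    ∃ (H : Scheme.{u}) (i : H ⟶ Q), IsClosedImmersion i ∧ ∀ {T : Scheme.{u}} (b : T ⟶ X),
      (∃ t, t ≫ i = b ≫ π) ↔ ∃ s, s ≫ z = b := by
  -- The closed subscheme of the target is the scheme-theoretic image of `Z`.
  refine ⟨_, (z ≫ π).imageι, inferInstanceAs (IsClosedImmersion (Scheme.IdealSheafData.subschemeι _)),
    fun {T} b => ⟨?_, ?_⟩⟩
  · rintro ⟨t, ht⟩
    let i := (z ≫ π).imageι
    have : IsClosedImmersion i := inferInstanceAs (IsClosedImmersion (Scheme.IdealSheafData.subschemeι _))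
    -- Dominance of `Z` over its image survives the flat base change along `π`. By invariance the
    -- source of `w` maps into `Z`, so the whole preimage of the image is contained in `Z`.
    let w := Limits.pullback.snd (z ≫ π).toImage (Limits.pullback.fst i π)
    have hw : IsSchemeTheoreticallyDominant w := inferInstance
    obtain ⟨s, hs⟩ := exists_lift_of_forall_spec z (w ≫ Limits.pullback.snd i π) fun R t =>
      h R (t ≫ Limits.pullback.fst _ _) _ (by
        simp only [Category.assoc, w]
        rw [← Limits.pullback.condition, ← Limits.pullback.condition_assoc, Scheme.Hom.toImage_imageι])
    have hker : z.ker ≤ (Limits.pullback.snd i π).ker := by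
      refine (Scheme.Hom.le_ker_comp s z).trans ?_
      rw [hs, Scheme.Hom.ker_comp, hw.ker_eq_bot, Scheme.IdealSheafData.map_bot]
    refine ⟨Limits.pullback.lift t b ht ≫ IsClosedImmersion.lift z _ hker, ?_⟩
    rw [Category.assoc, IsClosedImmersion.lift_fac, Limits.pullback.lift_snd]
  · rintro ⟨s, rfl⟩
    exact ⟨s ≫ (z ≫ π).toImage, by rw [Category.assoc, Scheme.Hom.toImage_imageι, Category.assoc]⟩

end Descent

/-! ### Existence of the transporter in the quotient -/

section Transporter

variable {k A : Type u} [Field k] [CommRing A] [HopfAlgebra k A] {I : Ideal A}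

/-- The point of `V(I)` which corresponds to a homomorphism on its coordinate ring. -/
noncomputable def ptOfHom {R : Type u} [CommRing R] [Algebra k R] (β : A ⧸ I →ₐ[k] R) : Pt k A R :=
  toConv (β.comp (Ideal.Quotient.mkₐ k I))

@[simp] lemma ptOfHom_apply {R : Type u} [CommRing R] [Algebra k R] (β : A ⧸ I →ₐ[k] R) (a : A) :
    (ptOfHom β).ofConv a = β (Ideal.Quotient.mk I a) := rfl

lemma mem_ptOfHom {R : Type u} [CommRing R] [Algebra k R] (β : A ⧸ I →ₐ[k] R) : Mem I (ptOfHom β) :=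
  fun a ha => by rw [ptOfHom_apply, Ideal.Quotient.eq_zero_iff_mem.2 ha, map_zero]

lemma toSpec_ptOfHom {R : Type u} [CommRing R] [Algebra k R] (β : A ⧸ I →ₐ[k] R) :
    toSpec I (ptOfHom β) (mem_ptOfHom β) = Spec.map (CommRingCat.ofHom β.toRingHom) := by
  rw [toSpec]
  congr 2
  refine Ideal.Quotient.ringHom_ext ?_
  ext a
  rfl

/-- The homomorphism on the coordinate ring of `V(I)` which corresponds to a point. -/
noncomputable def homOfPt {R : Type u} [CommRing R] [Algebra k R] (g : Pt k A R) (hg : Mem I g) :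
    A ⧸ I →ₐ[k] R := Ideal.Quotient.liftₐ I g.ofConv hg

lemma toSpec_eq {R : Type u} [CommRing R] [Algebra k R] (g : Pt k A R) (hg : Mem I g) :
    toSpec I g hg = Spec.map (CommRingCat.ofHom (homOfPt g hg).toRingHom) := rfl

/-- The closed subscheme of `V(I)` defined by functions `F i`. -/
noncomputable abbrev zeroLocusι (I : Ideal A) {d : ℕ} (F : Fin d → A) :
    Spec (.of ((A ⧸ I) ⧸ Ideal.span (Set.range fun i => Ideal.Quotient.mk I (F i)))) ⟶
      Spec (.of (A ⧸ I)) :=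
  Spec.map (CommRingCat.ofHom (Ideal.Quotient.mk _))

instance isClosedImmersion_zeroLocusι {d : ℕ} (F : Fin d → A) :
    IsClosedImmersion (zeroLocusι I F) :=
  IsClosedImmersion.spec_of_quotient_mk (R := .of (A ⧸ I)) _

lemma exists_comp_zeroLocusι_iff {d : ℕ} (F : Fin d → A) {R : CommRingCat.{u}}
    (β : CommRingCat.of (A ⧸ I) ⟶ R) :
    (∃ s, s ≫ zeroLocusι I F = Spec.map β) ↔ ∀ i, β.hom (Ideal.Quotient.mk I (F i)) = 0 := by
  constructor
  · rintro ⟨s, hs⟩ i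
    obtain ⟨σ, rfl⟩ := Spec.map_surjective s
    rw [← Spec.map_comp] at hs
    rw [← Spec.map_injective hs]
    have hi : Ideal.Quotient.mk I (F i) ∈ Ideal.span (Set.range fun i => Ideal.Quotient.mk I (F i)) :=
      Ideal.subset_span ⟨i, rfl⟩
    change σ.hom (Ideal.Quotient.mk _ _) = 0
    rw [Ideal.Quotient.eq_zero_iff_mem.2 hi, map_zero]
  · intro h
    refine ⟨Spec.map (CommRingCat.ofHom (Ideal.Quotient.lift _ β.hom fun a ha => ?_)), ?_⟩
    · induction ha using Submodule.span_induction with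
      | mem x hx => obtain ⟨i, rfl⟩ := hx; exact h i
      | zero => exact map_zero _
      | add x y _ _ hx hy => rw [map_add, hx, hy, add_zero]
      | smul r x _ hx => rw [smul_eq_mul, map_mul, hx, mul_zero]
    · rw [← Spec.map_comp]
      congr 1

/-- The common zero locus of the `F i` in `V(I)` is stable under passing to another point of the
same coset, so it descends along the flat projection. -/
theorem exists_isTransporter [Algebra.FiniteType k A] {J : Ideal A} {Q : Scheme.{u}}
    {q : Q ⟶ Spec (.of k)} {π : Spec (.of (A ⧸ I)) ⟶ Q} (hQ : IsQuotient I J q π)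
    {γ e : Fun k A k} {W : Submodule k (Fun k A k)} {d : ℕ} {F : Fin d → A}
    (hF : ∀ (R : Type u) [CommRing R] [Algebra k R] (g : Pt k A R), Mem I g →
      (Ad (Pt.inv g) (extend R γ) - extend R e ∈ scalars R W ↔ ∀ i, g.ofConv (F i) = 0))
    (hinv : ∀ (R : Type u) [CommRing R] [Algebra k R] (g g' : Pt k A R), Mem J (Pt.inv g * g') →
      (Ad (Pt.inv g) (extend R γ) - extend R e ∈ scalars R W ↔
        Ad (Pt.inv g') (extend R γ) - extend R e ∈ scalars R W)) :
    ∃ (H : Scheme.{u}) (i : H ⟶ Q), IsTransporter I π γ e W i := by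
  have := hQ.flat
  have : IsNoetherianRing (A ⧸ I) := Algebra.FiniteType.isNoetherianRing k _
  have : QuasiCompact (zeroLocusι I F ≫ π) := inferInstance
  obtain ⟨H, i, hi, h⟩ := exists_closed_subscheme_of_invariant π (zeroLocusι I F) (by
    intro R a b hab
    obtain ⟨α, rfl⟩ := Spec.map_surjective a
    obtain ⟨β, rfl⟩ := Spec.map_surjective b
    obtain ⟨α, hα⟩ : ∃ α', Spec.map α' = Spec.map α ≫ zeroLocusι I F := ⟨_, Spec.map_comp _ _⟩
    have hα0 := (exists_comp_zeroLocusι_iff F α).1 ⟨_, hα.symm⟩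
    rw [exists_comp_zeroLocusι_iff]
    rw [← Category.assoc, ← hα] at hab
    have hk : α.hom.comp (algebraMap k (A ⧸ I)) = β.hom.comp (algebraMap k (A ⧸ I)) := by
      have := congr_arg (· ≫ q) hab
      simp only [Category.assoc, hQ.over_base, ← Spec.map_comp] at this
      exact congr_arg CommRingCat.Hom.hom (Spec.map_injective this)
    -- The two points agree after composition with `q`, so they induce the same `k`-algebra
    -- structure on `R` and can be compared as points of the group.
    let : Algebra k R := (α.hom.comp (algebraMap k (A ⧸ I))).toAlgebra
    let α' : A ⧸ I →ₐ[k] R := { α.hom with commutes' := fun r => rfl }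
    let β' : A ⧸ I →ₐ[k] R := { β.hom with commutes' := fun r => (RingHom.congr_fun hk r).symm }
    have hJ := (hQ.coset R (ptOfHom α') (ptOfHom β') (mem_ptOfHom α') (mem_ptOfHom β')).1 (by
      rw [toSpec_ptOfHom, toSpec_ptOfHom]; exact hab)
    exact (hF R _ (mem_ptOfHom β')).1 ((hinv R _ _ hJ).1 ((hF R _ (mem_ptOfHom α')).2 hα0)))
  refine ⟨H, i, hi, fun R _ _ g hg => ?_⟩
  rw [h, hF R g hg, toSpec_eq, exists_comp_zeroLocusι_iff]
  rfl

end Transporter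

/-! ### Derivations on étale charts, and affine charts of closed subschemes -/

/-- Formal étaleness identifies `Ω[C⁄k]` with the base change of `Ω[B⁄k]`, so linear forms extend
uniquely. -/
lemma exists_derivation_extending {k B C M : Type u} [CommRing k] [CommRing B] [Algebra k B]
    [CommRing C] [Algebra k C] [Algebra B C] [IsScalarTower k B C] [Algebra.FormallyEtale B C]
    [AddCommGroup M] [Module k M] [Module B M] [Module C M] [IsScalarTower B C M]
    [IsScalarTower k B M] [IsScalarTower k C M] (D : Derivation k B M) :
    ∃ D' : Derivation k C M, ∀ b, D' (algebraMap B C b) = D b := by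
  let e := KaehlerDifferential.tensorKaehlerEquivOfFormallyEtale k B C
  let ℓ : C ⊗[B] Ω[B⁄k] →ₗ[C] M := LinearMap.liftBaseChange C D.liftKaehlerDifferential
  let f : Ω[C⁄k] →ₗ[C] M := ℓ ∘ₗ e.symm.toLinearMap
  refine ⟨f.compDer (KaehlerDifferential.D k C), fun b => ?_⟩
  change ℓ (e.symm (KaehlerDifferential.D k C (algebraMap B C b))) = _
  rw [KaehlerDifferential.tensorKaehlerEquivOfFormallyEtale_symm_D_algebraMap]
  simp [ℓ]

section Chart

variable {H Q : Scheme.{u}} (i : H ⟶ Q) [IsClosedImmersion i] (U : Q.affineOpens)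

/-- The part of a closed subscheme which lies over an affine open subset. -/
noncomputable def chart : Spec (.of (Γ(Q, U.1) ⧸ i.ker.ideal U)) ⟶ H :=
  i.ker.subschemeCover.f U ≫ inv i.toImage

instance isOpenImmersion_chart : IsOpenImmersion (chart i U) := by
  have : IsOpenImmersion (i.ker.subschemeCover.f U) := i.ker.subschemeCover.map_prop U
  exact inferInstanceAs (IsOpenImmersion (i.ker.subschemeCover.f U ≫ inv i.toImage))

lemma inv_toImage_comp : inv i.toImage ≫ i = i.imageι := by
  rw [IsIso.inv_comp_eq, Scheme.Hom.toImage_imageι]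

lemma chart_comp :
    chart i U ≫ i = Spec.map (CommRingCat.ofHom (Ideal.Quotient.mk (i.ker.ideal U))) ≫ U.2.fromSpec := by
  refine (Category.assoc _ _ _).trans ?_
  rw [inv_toImage_comp]
  exact (i.ker.subschemeCover_map_subschemeι U).trans (i.ker.glueDataObjι_ι U)

lemma range_chart : Set.range (chart i U) = i ⁻¹ᵁ U.1 := by
  ext x
  constructor
  · rintro ⟨y, rfl⟩
    change i (chart i U y) ∈ U.1
    rw [← Scheme.Hom.comp_apply, chart_comp, Scheme.Hom.comp_apply]
    exact (U.2.range_fromSpec.le ⟨_, rfl⟩ :)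
  · intro hx
    have h : i.toImage x ∈ Set.range (i.ker.subschemeCover.f U) := by
      refine (i.ker.opensRange_subschemeCover_map U).ge (?_ : i.toImage x ∈ i.ker.subschemeι ⁻¹ᵁ U.1)
      change i.imageι (i.toImage x) ∈ U.1
      rw [← Scheme.Hom.comp_apply, Scheme.Hom.toImage_imageι]
      exact hx
    obtain ⟨y, hy⟩ := h
    refine ⟨y, ?_⟩
    change (inv i.toImage) (i.ker.subschemeCover.f U y) = x
    rw [hy, ← Scheme.Hom.comp_apply, IsIso.hom_inv_id]
    rfl

/-- A morphism into an affine open subset factors through a closed subscheme if and only if it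
kills the ideal of the subscheme. -/
lemma exists_comp_eq_iff_of_isAffineOpen {R : CommRingCat.{u}} (ρ : Γ(Q, U.1) ⟶ R) :
    (∃ t, t ≫ i = Spec.map ρ ≫ U.2.fromSpec) ↔ ∀ s ∈ i.ker.ideal U, ρ.hom s = 0 := by
  constructor
  · rintro ⟨t, ht⟩ s hs
    have hrange : Set.range t ⊆ Set.range (chart i U) := by
      rw [range_chart]
      rintro _ ⟨y, rfl⟩
      change i (t y) ∈ U.1
      rw [← Scheme.Hom.comp_apply, ht, Scheme.Hom.comp_apply]
      exact (U.2.range_fromSpec.le ⟨_, rfl⟩ :)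
    obtain ⟨τ, hτ⟩ := Spec.map_surjective (IsOpenImmersion.lift (chart i U) t hrange)
    have h : Spec.map τ ≫ chart i U = t := by rw [hτ, IsOpenImmersion.lift_fac]
    rw [← h, Category.assoc, chart_comp, ← Category.assoc, ← Spec.map_comp] at ht
    have hU : IsAffineOpen U.1 := U.2
    have hmono : Mono hU.fromSpec := inferInstance
    rw [← Spec.map_injective (hmono.right_cancellation _ _ ht)]
    change τ.hom (Ideal.Quotient.mk _ s) = 0
    rw [Ideal.Quotient.eq_zero_iff_mem.2 hs, map_zero]
  · intro h
    refine ⟨Spec.map (CommRingCat.ofHom (Ideal.Quotient.lift _ ρ.hom h)) ≫ chart i U, ?_⟩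
    rw [Category.assoc, chart_comp, ← Category.assoc, ← Spec.map_comp]
    congr 2

end Chart

lemma smooth_of_forall_exists_isOpenImmersion {X Y : Scheme.{u}} (f : X ⟶ Y)
    (h : ∀ x : X, ∃ (Z : Scheme.{u}) (l : Z ⟶ X), IsOpenImmersion l ∧ x ∈ Set.range l ∧
      Smooth (l ≫ f)) : Smooth f := by
  choose Z l hl hx hs using h
  have : IsZariskiLocalAtSource @Smooth.{u} := HasRingHomProperty.instIsZariskiLocalAtSource
  refine (IsZariskiLocalAtSource.iff_of_iSup_eq_top (P := @Smooth.{u})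
    (fun x => (l x).opensRange) ?_).2 fun x => ?_
  · exact top_le_iff.mp fun x _ => TopologicalSpace.Opens.mem_iSup.2 ⟨x, hx x⟩
  · have : (l x).opensRange.ι = (l x).isoOpensRange.inv ≫ l x := by simp
    rw [this, Category.assoc]
    have := hs x
    infer_instance

/-- This moves the derivations found on the group to a chart which is étale over `V(I)`: they kill
`I`, hence descend to `A ⧸ I` and then extend to `C`. -/
lemma exists_derivation_of_quotient {k A C κ : Type u} [Field k] [CommRing A] [Algebra k A]
    {I : Ideal A} [CommRing C] [Algebra k C] [Algebra (A ⧸ I) C] [IsScalarTower k (A ⧸ I) C]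
    [Algebra.FormallyEtale (A ⧸ I) C] [Field κ] [Algebra k κ] [Algebra C κ] [Algebra (A ⧸ I) κ]
    [IsScalarTower (A ⧸ I) C κ] [IsScalarTower k C κ] [IsScalarTower k (A ⧸ I) κ]
    (D : A →ₗ[k] κ) (hD : ∀ a b, D (a * b) = algebraMap (A ⧸ I) κ (Ideal.Quotient.mk I a) * D b +
      algebraMap (A ⧸ I) κ (Ideal.Quotient.mk I b) * D a) (hDI : ∀ a ∈ I, D a = 0) :
    ∃ D' : C →ₗ[k] κ, (∀ a b, D' (a * b) = algebraMap C κ a * D' b + algebraMap C κ b * D' a) ∧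
      ∀ a, D' (algebraMap (A ⧸ I) C (Ideal.Quotient.mk I a)) = D a := by
  let D₀ : A ⧸ I →ₗ[k] κ := (I.restrictScalars k).liftQ D hDI
  let D₁ : Derivation k (A ⧸ I) κ := Derivation.mk' D₀ fun a b => by
    obtain ⟨a, rfl⟩ := Ideal.Quotient.mk_surjective a
    obtain ⟨b, rfl⟩ := Ideal.Quotient.mk_surjective b
    rw [Algebra.smul_def, Algebra.smul_def]
    exact hD a b
  obtain ⟨D', h⟩ := exists_derivation_extending (C := C) D₁
  refine ⟨D', fun a b => ?_, fun a => h _⟩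
  rw [← Algebra.smul_def, ← Algebra.smul_def]
  exact D'.leibniz a b

/-- Testing with the two quotient maps gives the two inclusions. -/
lemma ideal_eq_of_forall_hom {C : Type u} [CommRing C] {a b : Ideal C}
    (h : ∀ (R : Type u) [CommRing R] (ρ : C →+* R), (∀ s ∈ a, ρ s = 0) ↔ ∀ s ∈ b, ρ s = 0) :
    a = b :=
  le_antisymm
    (fun s hs => Ideal.Quotient.eq_zero_iff_mem.1 <| (h _ (Ideal.Quotient.mk b)).2
      (fun _ ht => Ideal.Quotient.eq_zero_iff_mem.2 ht) s hs)
    (fun s hs => Ideal.Quotient.eq_zero_iff_mem.1 <| (h _ (Ideal.Quotient.mk a)).1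
      (fun _ ht => Ideal.Quotient.eq_zero_iff_mem.2 ht) s hs)

lemma forall_mem_span_range_iff {C R ι : Type*} [CommRing C] [CommRing R] (f : ι → C)
    (ρ : C →+* R) : (∀ s ∈ Ideal.span (Set.range f), ρ s = 0) ↔ ∀ i, ρ (f i) = 0 := by
  have := Ideal.span_le (s := Set.range f) (I := RingHom.ker ρ)
  rw [Set.range_subset_iff] at this
  exact this

/-! ### Local equations of the transporter -/

section LocalEquations

variable {k A : Type u} [Field k] [CommRing A] [HopfAlgebra k A] {I J : Ideal A} {Q H : Scheme.{u}}
  {q : Q ⟶ Spec (.of k)} {π : Spec (.of (A ⧸ I)) ⟶ Q} {γ e : Fun k A k}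
  {W : Submodule k (Fun k A k)} {i : H ⟶ Q} {d : ℕ} {F : Fin d → A}

/-- The equations of the transporter generate the ideal of its image in the quotient. -/
lemma map_ideal_eq_span (hH : IsTransporter I π γ e W i)
    (hF : ∀ (R : Type u) [CommRing R] [Algebra k R] (g : Pt k A R), Mem I g →
      (Ad (Pt.inv g) (extend R γ) - extend R e ∈ scalars R W ↔ ∀ i, g.ofConv (F i) = 0))
    (U : Q.affineOpens) {C : CommRingCat.{u}} (φ : Γ(Q, U.1) ⟶ C) (χ : .of (A ⧸ I) ⟶ C)
    (h : Spec.map χ ≫ π = Spec.map φ ≫ U.2.fromSpec) :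
    (i.ker.ideal U).map φ.hom = Ideal.span (Set.range fun l => χ.hom (Ideal.Quotient.mk I (F l))) := by
  have := hH.closed
  refine ideal_eq_of_forall_hom fun R _ ρ => ?_
  rw [forall_mem_span_range_iff]
  let : Algebra k R := ((ρ.comp χ.hom).comp (algebraMap k (A ⧸ I))).toAlgebra
  let β : A ⧸ I →ₐ[k] R := { ρ.comp χ.hom with commutes' := fun r => rfl }
  have h₁ := hH.factors R (ptOfHom β) (mem_ptOfHom β)
  rw [hF R _ (mem_ptOfHom β), toSpec_ptOfHom] at h₁
  have h₂ : Spec.map (CommRingCat.ofHom β.toRingHom) ≫ π =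
      Spec.map (φ ≫ CommRingCat.ofHom ρ) ≫ U.2.fromSpec := by
    rw [Spec.map_comp, Category.assoc, ← h, ← Category.assoc, ← Spec.map_comp]
    rfl
  rw [h₂, exists_comp_eq_iff_of_isAffineOpen] at h₁
  refine Iff.trans ?_ h₁
  have := Ideal.map_le_iff_le_comap (f := φ.hom) (I := i.ker.ideal U) (K := RingHom.ker ρ)
  exact this

/-- At a point of an affine open subset of the quotient, the projection from the group is, up to
an étale map, a flat homomorphism of rings. -/
lemma exists_flat_chart (hQ : IsQuotient I J q π) (U : Q.affineOpens) (w : Spec Γ(Q, U.1)) :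
    ∃ (C : CommRingCat.{u}) (φ : Γ(Q, U.1) ⟶ C) (χ : .of (A ⧸ I) ⟶ C) (v : Spec C),
      φ.hom.Flat ∧ χ.hom.FormallyEtale ∧ Spec.map φ v = w ∧
        Spec.map χ ≫ π = Spec.map φ ≫ U.2.fromSpec := by
  have := hQ.flat
  have := hQ.surjective
  have hU : IsAffineOpen U.1 := U.2
  -- The ring `C` belongs to an affine open piece of the preimage of `U`, around a point above `w`.
  -- This piece is flat over `U` and open in the group.
  obtain ⟨x, hx⟩ := π.surjective (hU.fromSpec w)
  obtain ⟨v, -, hv⟩ := Scheme.Pullback.exists_preimage_pullback x w hx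
  obtain ⟨C, c, hc, v, rfl⟩ : ∃ (C : CommRingCat.{u}) (c : Spec C ⟶ Limits.pullback π hU.fromSpec),
      IsOpenImmersion c ∧ v ∈ Set.range c := by
    obtain ⟨i, z, hz⟩ := (Limits.pullback π hU.fromSpec).affineCover.exists_eq v
    exact ⟨_, (Limits.pullback π hU.fromSpec).affineCover.f i,
      (Limits.pullback π hU.fromSpec).affineCover.map_prop i, z, hz⟩
  obtain ⟨φ, hφ⟩ := Spec.map_surjective (c ≫ Limits.pullback.snd π hU.fromSpec)
  obtain ⟨χ, hχ⟩ := Spec.map_surjective (c ≫ Limits.pullback.fst π hU.fromSpec)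
  refine ⟨C, φ, χ, v, ?_, ?_, ?_, ?_⟩
  · rw [← HasRingHomProperty.Spec_iff (P := @Flat), hφ]
    infer_instance
  · have : Etale (Spec.map χ) := by rw [hχ]; infer_instance
    rw [HasRingHomProperty.Spec_iff (P := @Etale)] at this
    exact this.1
  · rw [hφ]
    exact hv
  · rw [hφ, hχ, Category.assoc, Category.assoc, Limits.pullback.condition]

end LocalEquations

section LocalEquations

variable {k A : Type u} [Field k] [CommRing A] [HopfAlgebra k A] {I J : Ideal A} {Q H : Scheme.{u}}
  {q : Q ⟶ Spec (.of k)} {π : Spec (.of (A ⧸ I)) ⟶ Q} {γ e : Fun k A k}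
  {W : Submodule k (Fun k A k)} {i : H ⟶ Q} {d : ℕ} {F : Fin d → A}

/-- An affine open subset of the quotient has, near each point of the transporter, a localization
on which the ideal of the transporter is generated by a regular sequence. -/
lemma exists_local_equations (hQ : IsQuotient I J q π) (hH : IsTransporter I π γ e W i)
    (hF : ∀ (R : Type u) [CommRing R] [Algebra k R] (g : Pt k A R), Mem I g →
      (Ad (Pt.inv g) (extend R γ) - extend R e ∈ scalars R W ↔ ∀ i, g.ofConv (F i) = 0))
    (hD : ∀ (R : Type u) [CommRing R] [Algebra k R] (g : Pt k A R), Mem I g →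
      (∀ i, g.ofConv (F i) = 0) → ∀ l, ∃ D : A →ₗ[k] R,
        (∀ a b, D (a * b) = g.ofConv a * D b + g.ofConv b * D a) ∧ (∀ a ∈ I, D a = 0) ∧
        ∀ i, D (F i) = if l = i then 1 else 0)
    (U : Q.affineOpens) [Algebra k Γ(Q, U.1)] [Algebra.Smooth k Γ(Q, U.1)]
    (hk : Spec.map (CommRingCat.ofHom (algebraMap k Γ(Q, U.1))) = U.2.fromSpec ≫ q)
    (w : Spec Γ(Q, U.1)) (hw : i.ker.ideal U ≤ w.asIdeal) :
    ∃ (h : Γ(Q, U.1)) (s : Fin d → Γ(Q, U.1)), h ∉ w.asIdeal ∧ (∀ j, s j ∈ i.ker.ideal U) ∧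
      ∀ (S : Type u) [CommRing S] [Algebra Γ(Q, U.1) S] [Algebra k S] [IsScalarTower k Γ(Q, U.1) S]
        [IsLocalization.Away h S],
        RingTheory.Sequence.IsWeaklyRegular S (List.ofFn fun j => algebraMap Γ(Q, U.1) S (s j)) ∧
        (i.ker.ideal U).map (algebraMap Γ(Q, U.1) S) =
          Ideal.span (Set.range fun j => algebraMap Γ(Q, U.1) S (s j)) ∧
        Algebra.Smooth k (S ⧸ (i.ker.ideal U).map (algebraMap Γ(Q, U.1) S)) := by
  obtain ⟨C, φ, χ, v, hφ, hχ, rfl, hχφ⟩ := exists_flat_chart hQ U w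
  have hJF := map_ideal_eq_span hH hF U φ χ hχφ
  have hkC : χ.hom.comp (algebraMap k (A ⧸ I)) = φ.hom.comp (algebraMap k Γ(Q, U.1)) := by
    have := congr_arg (· ≫ q) hχφ
    simp only [Category.assoc, hQ.over_base, ← hk, ← Spec.map_comp] at this
    exact congr_arg CommRingCat.Hom.hom (Spec.map_injective this)
  clear hχφ hk
  generalize i.ker.ideal U = a at *
  generalize Γ(Q, U.1) = O at *
  let : Algebra O C := φ.hom.toAlgebra
  let : Algebra (A ⧸ I) C := χ.hom.toAlgebra
  let : Algebra k C := (φ.hom.comp (algebraMap k O)).toAlgebra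
  have : IsScalarTower k O C := .of_algebraMap_eq fun _ => rfl
  have : IsScalarTower k (A ⧸ I) C := .of_algebraMap_eq fun r => (RingHom.congr_fun hkC r).symm
  have : Module.Flat O C := hφ
  have : Algebra.FormallyEtale (A ⧸ I) C := hχ
  obtain ⟨κ, _, _, hker⟩ : ∃ (κ : Type u) (_ : Field κ) (_ : Algebra C κ),
      ∀ c : C, algebraMap C κ c = 0 ↔ c ∈ v.asIdeal := by
    have : v.asIdeal.IsPrime := PrimeSpectrum.isPrime v
    exact ⟨v.asIdeal.ResidueField, inferInstance, inferInstance,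
      fun c => Ideal.algebraMap_residueField_eq_zero⟩
  let : Algebra O κ := ((algebraMap C κ).comp (algebraMap O C)).toAlgebra
  let : Algebra (A ⧸ I) κ := ((algebraMap C κ).comp (algebraMap (A ⧸ I) C)).toAlgebra
  let : Algebra k κ := ((algebraMap C κ).comp (algebraMap k C)).toAlgebra
  have : IsScalarTower O C κ := .of_algebraMap_eq fun _ => rfl
  have : IsScalarTower (A ⧸ I) C κ := .of_algebraMap_eq fun _ => rfl
  have : IsScalarTower k C κ := .of_algebraMap_eq fun _ => rfl
  have : IsScalarTower k O κ := .of_algebraMap_eq fun _ => rfl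
  have : IsScalarTower k (A ⧸ I) κ := .of_algebraMap_eq fun r => by
    rw [IsScalarTower.algebraMap_apply (A ⧸ I) C κ, ← IsScalarTower.algebraMap_apply k (A ⧸ I) C]
    rfl
  have hf (l : Fin d) : algebraMap C κ (χ.hom (Ideal.Quotient.mk I (F l))) = 0 := by
    rw [hker]
    have : a.map φ.hom ≤ v.asIdeal := Ideal.map_le_iff_le_comap.2 hw
    exact this (hJF ▸ Ideal.subset_span ⟨l, rfl⟩)
  -- The residue field of the chosen point above `w` gives a `κ`-point of the group at which all `F
  -- i` vanish, so the dual derivations exist there.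
  have hD' := hD κ (ptOfHom (IsScalarTower.toAlgHom k (A ⧸ I) κ)) (mem_ptOfHom _) hf
  choose D₀ h₁ h₂ h₃ using hD'
  choose D h₄ h₅ using fun l => exists_derivation_of_quotient (C := C) (D₀ l) (h₁ l) (h₂ l)
  obtain ⟨h, s, hh, hs, hS⟩ := exists_regular_sequence (k := k) (κ := κ) hJF hf D h₄
    fun l i => (h₅ l (F i)).trans (h₃ l i)
  exact ⟨h, s, fun hv => hh ((hker _).2 hv), hs, hS⟩

end LocalEquations

/-! ### Regular charts of the transporter -/

section LocalCompleteIntersection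

variable {k A : Type u} [Field k] [CommRing A] [HopfAlgebra k A] {I J : Ideal A} {Q H : Scheme.{u}}
  {q : Q ⟶ Spec (.of k)} {π : Spec (.of (A ⧸ I)) ⟶ Q} {γ e : Fun k A k}
  {W : Submodule k (Fun k A k)} {i : H ⟶ Q} {d : ℕ} {F : Fin d → A}

lemma nontrivial_quotient_of_mem [IsClosedImmersion i] (U : Q.affineOpens) (x : H) (hx : i x ∈ U.1) :
    Nontrivial (Γ(Q, U.1) ⧸ i.ker.ideal U) := by
  obtain ⟨y, -⟩ := (range_chart i U).ge hx
  exact PrimeSpectrum.nonempty_iff_nontrivial.mp ⟨y⟩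

lemma exists_point_of_mem [IsClosedImmersion i] (U : Q.affineOpens) (x : H) (hx : i x ∈ U.1) :
    ∃ w : Spec Γ(Q, U.1), U.2.fromSpec w = i x ∧ i.ker.ideal U ≤ w.asIdeal := by
  obtain ⟨y, rfl⟩ := (range_chart i U).ge hx
  refine ⟨Spec.map (CommRingCat.ofHom (Ideal.Quotient.mk (i.ker.ideal U))) y, ?_, fun s hs => ?_⟩
  · rw [← Scheme.Hom.comp_apply, ← chart_comp, Scheme.Hom.comp_apply]
  · change Ideal.Quotient.mk _ s ∈ y.asIdeal
    rw [Ideal.Quotient.eq_zero_iff_mem.2 hs]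
    exact zero_mem _

/-- The transporter is, near each of its points, smooth and cut out by a regular sequence. -/
theorem exists_regular_chart (hQ : IsQuotient I J q π) [Smooth q]
    (hH : IsTransporter I π γ e W i)
    (hF : ∀ (R : Type u) [CommRing R] [Algebra k R] (g : Pt k A R), Mem I g →
      (Ad (Pt.inv g) (extend R γ) - extend R e ∈ scalars R W ↔ ∀ i, g.ofConv (F i) = 0))
    (hD : ∀ (R : Type u) [CommRing R] [Algebra k R] (g : Pt k A R), Mem I g →
      (∀ i, g.ofConv (F i) = 0) → ∀ l, ∃ D : A →ₗ[k] R,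
        (∀ a b, D (a * b) = g.ofConv a * D b + g.ofConv b * D a) ∧ (∀ a ∈ I, D a = 0) ∧
        ∀ i, D (F i) = if l = i then 1 else 0) (x : H) :
    ∃ (U : Q.affineOpens) (rs : List Γ(Q, U.1)), i x ∈ U.1 ∧ rs.length = d ∧
      RingTheory.Sequence.IsRegular Γ(Q, U.1) rs ∧ Ideal.ofList rs = i.ker.ideal U ∧
      ∃ (Z : Scheme.{u}) (l : Z ⟶ H), IsOpenImmersion l ∧ x ∈ Set.range l ∧ Smooth (l ≫ i ≫ q) := by
  have := hH.closed
  obtain ⟨_, ⟨V, hV, rfl⟩, hxV, -⟩ := Q.isBasis_affineOpens.exists_subset_of_mem_open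
    (Set.mem_univ (i x)) isOpen_univ
  let U : Q.affineOpens := ⟨V, hV⟩
  obtain ⟨w, hw, hwI⟩ := exists_point_of_mem (i := i) U x hxV
  obtain ⟨ψ, hψ⟩ := Spec.map_surjective (hV.fromSpec ≫ q)
  have hV' : IsAffineOpen V := hV
  have : Smooth hV'.fromSpec := inferInstance
  have hsm : Smooth (Spec.map ψ) := by rw [hψ]; infer_instance
  rw [HasRingHomProperty.Spec_iff (P := @Smooth)] at hsm
  let : Algebra k Γ(Q, V) := ψ.hom.toAlgebra
  have : Algebra.Smooth k Γ(Q, V) := hsm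
  obtain ⟨h, s, hh, hs, hS⟩ := exists_local_equations hQ hH hF hD U hψ w hwI
  let U' : Q.affineOpens := Q.affineBasicOpen (U := U) h
  let res : Γ(Q, V) ⟶ Γ(Q, U'.1) := Q.presheaf.map (homOfLE (Q.basicOpen_le h)).op
  have hxU' : i x ∈ U'.1 := by
    have : w ∈ hV.fromSpec ⁻¹ᵁ Q.basicOpen h := by
      rw [hV.fromSpec_preimage_basicOpen]
      exact hh
    rw [← hw]
    exact this
  let : Algebra k Γ(Q, U'.1) := (res.hom.comp ψ.hom).toAlgebra
  let : Algebra Γ(Q, V) Γ(Q, U'.1) := res.hom.toAlgebra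
  have : IsScalarTower k Γ(Q, V) Γ(Q, U'.1) := .of_algebraMap_eq fun _ => rfl
  have : IsLocalization.Away h Γ(Q, U'.1) := hV.isLocalization_basicOpen h
  obtain ⟨h₁, h₂, h₃⟩ := hS Γ(Q, U'.1)
  have hI : (i.ker.ideal U).map (algebraMap Γ(Q, V) Γ(Q, U'.1)) = i.ker.ideal U' :=
    i.ker.map_ideal_basicOpen U h
  rw [hI] at h₂ h₃
  have hofList : Ideal.ofList (List.ofFn fun j => algebraMap Γ(Q, V) Γ(Q, U'.1) (s j)) =
      i.ker.ideal U' := by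
    rw [h₂, Ideal.ofList]
    congr 1
    ext a
    exact List.mem_ofFn
  refine ⟨U', _, hxU', List.length_ofFn, ⟨h₁, ?_⟩, hofList, _, chart i U', inferInstance,
    (range_chart i U').ge hxU', ?_⟩
  -- Beyond weak regularity the ideal has to be proper, which holds because the chart contains the
  -- point `x` of the transporter.
  · rw [hofList, smul_eq_mul, Ideal.mul_top]
    have := nontrivial_quotient_of_mem (i := i) U' x hxU'
    exact (Ideal.Quotient.nontrivial_iff.1 this).symm
  · have hres : U'.2.fromSpec = Spec.map res ≫ hV.fromSpec := (hV.map_fromSpec U'.2 _).symm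
    rw [← Category.assoc, chart_comp, hres, Category.assoc, Category.assoc, ← hψ, ← Spec.map_comp,
      ← Spec.map_comp, HasRingHomProperty.Spec_iff (P := @Smooth)]
    rw [← RingHom.smooth_algebraMap] at h₃
    exact h₃

end LocalCompleteIntersection

end GradedLie

/-! ### The main theorem -/

theorem lemma4p2 {k K A : Type u} [Field k] [Field K] [Algebra k K] [IsAlgClosure k K]
    [CommRing A] [HopfAlgebra k A] (hG : GradedLie.IsConnectedReductive k K A)
    (θ : (K ⊗[k] A) ≃ₐc[K] (K ⊗[k] A)) (m : ℕ)
    (hθ : orderOf (θ : (K ⊗[k] A) ≃ₐ[K] (K ⊗[k] A)) = m) (hm : (m : k) ≠ 0)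
    (ζ : K) (hζ : IsPrimitiveRoot ζ m) (n : ℤ)
    (I₀ : Ideal A) (hI₀ : GradedLie.IsFixedComponent θ I₀)
    (hdef : GradedLie.EigenDefinedOver θ (ζ ^ n))
    (lam : A →ₐc[k] LaurentPolynomial k) (e h f : GradedLie.Fun k A k)
    (hlam : GradedLie.IsAssociated θ ζ n I₀ lam e h f)
    (γ : GradedLie.Fun k A k) (hγ : γ ∈ GradedLie.eigen θ (ζ ^ n))
    {Q : Scheme.{u}} (q : Q ⟶ Spec (.of k)) (π : Spec (.of (A ⧸ I₀)) ⟶ Q)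
    (hQ : GradedLie.IsQuotient I₀
      (GradedLie.stabilizerComponent I₀ lam (GradedLie.eigen θ (ζ ^ n)) e) q π) :
    (∃ (H : Scheme.{u}) (i : H ⟶ Q), GradedLie.IsTransporter I₀ π γ e
      (GradedLie.weightLE lam (GradedLie.eigen θ (ζ ^ n)) 1) i) ∧
    ∀ (H : Scheme.{u}) (i : H ⟶ Q), GradedLie.IsTransporter I₀ π γ e
      (GradedLie.weightLE lam (GradedLie.eigen θ (ζ ^ n)) 1) i →
      Smooth (i ≫ q) ∧
      ∃ d : ℕ, Module.finrank k (GradedLie.eigen θ (ζ ^ n)) =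
          Module.finrank k (GradedLie.weightLE lam (GradedLie.eigen θ (ζ ^ n)) 1) + d ∧
        GradedLie.IsLocalCompleteIntersection i d := by
  have := hG.finiteType
  have := hG.smooth
  have : IsAlgClosed K := IsAlgClosure.isAlgClosed k
  have hm0 : m ≠ 0 := fun h0 => hm (by rw [h0, Nat.cast_zero])
  have hζ0 : ζ ≠ 0 := hζ.ne_zero hm0
  have hsub := GradedLie.isSubgroup_of_isFixedComponent hI₀
  have : Algebra.Smooth k (A ⧸ I₀) := GradedLie.smooth_of_isFixedComponent hI₀ hθ hm
  obtain ⟨d, F, hd, hF, hD⟩ := hlam.exists_equations hζ0 hI₀ hγ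
  have : Smooth q := GradedLie.smooth_of_isQuotient K hsub hQ
  refine ⟨GradedLie.exists_isTransporter hQ hF fun R _ _ g g' hu =>
    GradedLie.transporter_iff_of_mem_stabilizerComponent (GradedLie.eigen_le_lie θ _) hlam.e_mem hsub
      (fun R _ _ g hg X hX => GradedLie.Ad_mem_scalars_eigen hI₀ hg hX) hu γ, fun H i hH => ?_⟩
  have h := GradedLie.exists_regular_chart hQ hH hF hD
  refine ⟨GradedLie.smooth_of_forall_exists_isOpenImmersion _ fun x => ?_, d, hd, fun x => ?_⟩
  · obtain ⟨_, _, _, _, _, _, hx⟩ := h x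
    exact hx
  · obtain ⟨U, rs, h₁, h₂, h₃, h₄, _⟩ := h x
    exact ⟨U, rs, h₁, h₂, h₃, h₄⟩
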